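/- **Setting.** Let $N,n\ge 1$, $A\in\mathbb R^{n\times n}$, $B\in\mathbb R^{n\times m}$, $C_i\in\mathbb R^{p_i\times n}$ ($i=1,\dots,N$), $p=\sum_i p_i$, and let $C=(C_1^\top,\dots,C_N^\top)^\top\in\mathbb R^{p\times n}$ be such that $(A,C)$ is observable; let $\tilde n$ be the least $k$ for which the matrix with block rows $C,CA,\dots,CA^{k-1}$ has full rank $n$. Consider the plant $\dot x=Ax+Bu+\gamma(t,x)+q_x$ with continuous $\gamma:\mathbb R\times\mathbb R^n\to\mathbb R^n$ and outputs $y_i=C_ix+q_{y,i}$. Let $G_0\in\mathbb R^{n\times n}$, $Y_0\in\mathbb R^{n\times p}$ satisfy $AG_0-G_0A-Y_0C=A$, $CG_0=0$, with $I_n+G_0$ invertible and $A+L_0C$ nilpotent, where $L_0=(I_n+G_0)^{-1}Y_0$, and suppose $L_0=0$. For $\mu\in\mathbb R$ put $G_{\mathbf d}=\mu G_0+I_n$ and $\mathbf d(s)=\exp(sG_{\mathbf d})$. Let $\mathcal G$ be a strongly connected directed graph without self-loops on $\{1,\dots,N\}$, with adjacency matrix $(a_{ij})$ ($a_{ij}=1$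 if $(i,j)$ is an edge and $a_{ij}=0$ otherwise) and Laplacian $\mathcal L=(l_{ij})$, $l_{ij}=-a_{ij}$ for $i\ne j$, $l_{ii}=\sum_k a_{ik}$. Let $\zeta^\top\mathcal L=0$, $\zeta^\top\mathbf 1_N=1$ and $T^{-1}\mathcal LT=\mathrm{diag}(0,\Delta)$ with $T=(\mathbf 1_N,Y_1)$, $T^{-1}=(\zeta,Y_2)^\top$. Let $\rho>0$, $P_a\in\mathbb R^{n\times n}$, $P_a\succ0$, $(\Delta^\top+\Delta)\otimes P_a\succ 0$, $Y\in\mathbb R^{n\times p}$, $P_a^{-1}Y=(\bar H_1,\dots,\bar H_N)$ with $\bar H_i\in\mathbb R^{n\times p_i}$, and $H_i=\bar H_i/\zeta_i$. For a generator $G$ and a matrix $P\succ0$ with $PG+G^\top P\succ 0$, the canonical homogeneous norm induced by $\|x\|_P=\sqrt{x^\top Px}$ is $\|0\|=0$ and, for $x\neq0$, $\|x\|=e^{s}$ with $\|\exp(-sG)x\|_P=1$. Let $\|\cdot\|_{\mathbf d}$ be the one for $(G_{\mathbf d},P_a)$ on $\mathbb R^n$ and $\|\cdot\|_{\tilde{\mathbf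 d}}$ the one for $(I_N\otimes G_{\mathbf d},P)$, $P=I_N\otimes P_a$, on $\mathbb R^{Nn}$; put $\tilde{\mathbf d}(s)=I_N\otimes\mathbf d(s)$. For the observers $\dot{\hat x}_i=A\hat x_i+Bu+\gamma(t,\hat x_i)+g(|\omega_i|)H_i\omega_i+\nu\|\theta_i\|_{\mathbf d}^{\mu}\theta_i$, with $g(r)=\exp(\mu(G_0+I_n)\ln r)$, $\omega_i=C_i\hat x_i-y_i$, $\theta_i=\sum_ja_{ij}(\hat x_j-\hat x_i)$, the errors $e_i=\hat x_i-x$ satisfy the error equation $$\dot e_i=Ae_i+g(|\omega_i|)H_i\omega_i+\nu\|\theta_i\|_{\mathbf d}^{\mu}\theta_i+\gamma(t,x+e_i)-\gamma(t,x)-q_x,\quad \omega_i=C_ie_i-q_{y,i},\quad \theta_i=-\sum_jl_{ij}e_j,\quad i=1,\dots,N,$$ where the terms containing $g(|\omega_i|)\omega_i$ and $\|\theta_i\|^\mu_{\mathbf d}\theta_i$ are $0$ for $\omega_i=0$ and $\theta_i=0$, respectively. **Proposition.** There is $\nu_0>0$ such that for every $\nu\ge\nu_0$ there is $\varepsilon>0$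 such that the following holds for every $\mu$ with $|\mu|<\varepsilon$, $\mu>-1/\tilde n$, for which $$P_aG_{\mathbf d}+G_{\mathbf d}^\top P_a\succ0,\qquad P_aA+A^\top P_a+YC+C^\top Y^\top+\rho(P_aG_{\mathbf d}+G_{\mathbf d}^\top P_a)\prec0 .$$ If $0<\tau<\rho/3$ and the continuous function $\gamma$ satisfies $$\big\|\tilde{\mathbf d}(-\ln\|\hat x-\tilde x\|_{\tilde{\mathbf d}})\big(\gamma(t,\hat x_i)-\gamma(t,x)\big)_{i=1}^N\big\|_P\le\tau\|\hat x-\tilde x\|_{\tilde{\mathbf d}}^{\mu}$$ for all $t>0$, $x\in\mathbb R^n$, $\hat x=(\hat x_1,\dots,\hat x_N)\in\mathbb R^{Nn}$, $\hat x\ne\tilde x:=\mathbf 1_N\otimes x$, then the error equation is input-to-state stable with respect to $q=(q_x,q_y)\in L^\infty$: there are $\beta\in\mathcal{KL}$ and $\alpha\in\mathcal K$ such that for every input $u$, every $q\in L^\infty([0,\infty),\mathbb R^{n+p})$, every corresponding plant trajectory $x$ on an interval $[0,T)$, $T\le\infty$, and every $e_0\in\mathbb R^{Nn}$, the error equation has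 a solution on $[0,T)$ with $e(0)=e_0$, and every solution on an interval $[0,S)$, $S\le T$, with $e(0)=e_0$ satisfies $$\|e(t)\|\le\beta(\|e_0\|,t)+\alpha\big(\|q\|_{L^\infty[0,t)}\big),\qquad 0\le t<S .$$ Solutions are locally absolutely continuous functions satisfying the equation almost everywhere. A function is of class $\mathcal K$ if it is continuous and strictly increasing on $[0,\infty)$ and vanishes at $0$; $\beta$ is of class $\mathcal{KL}$ if it is continuous on $[0,\infty)^2$, $\beta(\cdot,t)\in\mathcal K$ for each $t$, $\beta(r,t)\to0$ as $t\to\infty$ for each $r\ge 0$, and $\beta(r,\cdot)$ is strictly decreasing for each $r>0$. -/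

import Mathlib

open MeasureTheory Filter Topology
open scoped Matrix Kronecker ENNReal

/-! ### Weighted norms, linear dilations, canonical homogeneous norms -/

/-- The weighted Euclidean norm `‖x‖_P = √(xᵀ P x)`. -/
noncomputable def weightedNorm {ι : Type*} [Fintype ι] (P : Matrix ι ι ℝ) (x : ι → ℝ) : ℝ :=
  Real.sqrt (x ⬝ᵥ (P *ᵥ x))

/-- The Euclidean norm `|x|`. -/
noncomputable def euclNorm {ι : Type*} [Fintype ι] (x : ι → ℝ) : ℝ :=
  ‖WithLp.toLp 2 x‖

/-- The linear dilation `𝐝(s) = exp (s G)` with generator `G`. -/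
noncomputable def dilation {ι : Type*} [Fintype ι] [DecidableEq ι]
    (G : Matrix ι ι ℝ) (s : ℝ) : Matrix ι ι ℝ :=
  NormedSpace.exp (s • G)

open Classical in
/-- The canonical homogeneous norm induced by `‖·‖_P` and the dilation with generator `G`:
`‖0‖_𝐝 = 0`, and `‖x‖_𝐝 = exp s` with `‖𝐝(-s) x‖_P = 1` for `x ≠ 0`. (Such an `s` exists and is
unique when `P` and `P G + Gᵀ P` are positive definite.) -/
noncomputable def homNorm {ι : Type*} [Fintype ι] [DecidableEq ι]
    (G P : Matrix ι ι ℝ) (x : ι → ℝ) : ℝ :=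
  if x = 0 then 0
  else Real.exp (Classical.epsilon fun s : ℝ => weightedNorm P (dilation G (-s) *ᵥ x) = 1)

/-! ### Graphs -/

/-- Every node can be reached from every other node along directed edges. -/
def IsStronglyConnectedDigraph {V : Type*} (𝒢 : Digraph V) : Prop :=
  ∀ i j, Relation.ReflTransGen 𝒢.Adj i j

open Classical in
/-- `a i j = 1` if `(i, j)` is an edge (node `j` transfers its information to node `i`). -/
noncomputable def adjacencyMatrix {V : Type*} (𝒢 : Digraph V) : Matrix V V ℝ :=
  Matrix.of fun i j => if 𝒢.Adj i j then 1 else 0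

open Classical in
/-- The Laplacian: `l i j = -a i j` for `i ≠ j` and `l i i = ∑ k, a i k`. -/
noncomputable def laplacianMatrix {V : Type*} [Fintype V] (𝒢 : Digraph V) : Matrix V V ℝ :=
  Matrix.of fun i j =>
    if i = j then ∑ k, adjacencyMatrix 𝒢 i k else - adjacencyMatrix 𝒢 i j

/-- `Δ` is the block of `𝓛` belonging to its nonzero eigenvalues: `T⁻¹ 𝓛 T = diag(0, Δ)` for some
`T = (𝟏, Y₁)` with `T⁻¹ = (ζ, Y₂)ᵀ`. -/
def IsLaplacianReduction {N : ℕ} (𝓛 : Matrix (Fin N) (Fin N) ℝ) (ζ : Fin N → ℝ)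
    (Δ : Matrix (Fin (N - 1)) (Fin (N - 1)) ℝ) : Prop :=
  ∃ (T : Matrix (Fin N) (Unit ⊕ Fin (N - 1)) ℝ) (Tinv : Matrix (Unit ⊕ Fin (N - 1)) (Fin N) ℝ)
    (Y₁ Y₂ : Matrix (Fin N) (Fin (N - 1)) ℝ),
    T = Matrix.fromCols (Matrix.replicateCol Unit fun _ => 1) Y₁ ∧
    Tinv = Matrix.fromRows (Matrix.replicateRow Unit ζ) Y₂ᵀ ∧
    T * Tinv = 1 ∧ Tinv * T = 1 ∧
    Tinv * 𝓛 * T = Matrix.fromBlocks 0 0 0 Δ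

/-! ### Observability and the homogenizing equation -/

/-- The collection `C = (C₁ᵀ, …, C_Nᵀ)ᵀ` of the output matrices; its rows are indexed by pairs
(sensor, component). -/
def stackedOutput {N n : ℕ} {p : Fin N → ℕ} (C : ∀ i, Matrix (Fin (p i)) (Fin n) ℝ) :
    Matrix (Σ i, Fin (p i)) (Fin n) ℝ :=
  Matrix.of fun k j => C k.1 k.2 j

/-- The matrix with block rows `C, C A, …, C A ^ (k - 1)`. -/
def observabilityMatrix {n : ℕ} {κ : Type*} (A : Matrix (Fin n) (Fin n) ℝ)
    (C : Matrix κ (Fin n) ℝ) (k : ℕ) : Matrix (Fin k × κ) (Fin n) ℝ :=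
  Matrix.of fun r j => (C * A ^ (r.1 : ℕ)) r.2 j

/-- The pair `(A, C)` is observable (Kalman rank condition). -/
def IsObservablePair {n : ℕ} {κ : Type*} (A : Matrix (Fin n) (Fin n) ℝ)
    (C : Matrix κ (Fin n) ℝ) : Prop :=
  (observabilityMatrix A C n).rank = n

/-- The number `ñ`: the least `k` such that `C, C A, …, C A ^ (k - 1)` has full rank. -/
noncomputable def observabilityIndex {n : ℕ} {κ : Type*} (A : Matrix (Fin n) (Fin n) ℝ)
    (C : Matrix κ (Fin n) ℝ) : ℕ :=
  sInf {k | (observabilityMatrix A C k).rank = n}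

/-- The output-injection gain `L₀ = (I + G₀)⁻¹ Y₀`. -/
noncomputable def injectionGain {n : ℕ} {κ : Type*} [Fintype κ] (G₀ : Matrix (Fin n) (Fin n) ℝ)
    (Y₀ : Matrix (Fin n) κ ℝ) : Matrix (Fin n) κ ℝ :=
  (1 + G₀)⁻¹ * Y₀

/-- `(Y₀, G₀)` solves `A G₀ - G₀ A - Y₀ C = A`, `C G₀ = 0`, with `I + G₀` invertible and
`A + L₀ C` nilpotent. -/
structure IsHomogenizingPair {n : ℕ} {κ : Type*} [Fintype κ] (A : Matrix (Fin n) (Fin n) ℝ)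
    (C : Matrix κ (Fin n) ℝ) (Y₀ : Matrix (Fin n) κ ℝ) (G₀ : Matrix (Fin n) (Fin n) ℝ) : Prop where
  eq_A : A * G₀ - G₀ * A - Y₀ * C = A
  eq_C : C * G₀ = 0
  isUnit : IsUnit (1 + G₀)
  nilpotent : IsNilpotent (A + injectionGain G₀ Y₀ * C)

/-- The generator `G_𝐝 = μ G₀ + I`. -/
def dilationGenerator {n : ℕ} (G₀ : Matrix (Fin n) (Fin n) ℝ) (μ : ℝ) :
    Matrix (Fin n) (Fin n) ℝ :=
  μ • G₀ + 1

/-- The gains `H_i = H̄_i / ζ_i`, where `P_a⁻¹ Y = (H̄₁, …, H̄_N)`. -/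
noncomputable def observerGain {N n : ℕ} {p : Fin N → ℕ} (Pa : Matrix (Fin n) (Fin n) ℝ)
    (Y : Matrix (Fin n) (Σ i, Fin (p i)) ℝ) (ζ : Fin N → ℝ) (i : Fin N) :
    Matrix (Fin n) (Fin (p i)) ℝ :=
  Matrix.of fun a b => (Pa⁻¹ * Y) a ⟨i, b⟩ / ζ i

/-- The linear matrix inequalities
`P_a G_𝐝 + G_𝐝ᵀ P_a ≻ 0` and `P_a A + Aᵀ P_a + Y C + Cᵀ Yᵀ + ρ (P_a G_𝐝 + G_𝐝ᵀ P_a) ≺ 0`. -/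
def SatisfiesLMI {n : ℕ} {κ : Type*} [Fintype κ] (A : Matrix (Fin n) (Fin n) ℝ)
    (C : Matrix κ (Fin n) ℝ) (Gd Pa : Matrix (Fin n) (Fin n) ℝ) (Y : Matrix (Fin n) κ ℝ)
    (ρ : ℝ) : Prop :=
  (Pa * Gd + Gdᵀ * Pa).PosDef ∧
  (-(Pa * A + Aᵀ * Pa + Y * C + Cᵀ * Yᵀ + ρ • (Pa * Gd + Gdᵀ * Pa))).PosDef

/-! ### Plant, error equation, constraint on the nonlinearity -/

/-- The right-hand side `A x + B u(t) + γ(t, x) + q_x(t)` of the plant. -/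
def plantField {n m : ℕ} (A : Matrix (Fin n) (Fin n) ℝ) (B : Matrix (Fin n) (Fin m) ℝ)
    (γ : ℝ → (Fin n → ℝ) → Fin n → ℝ) (u : ℝ → Fin m → ℝ) (qx : ℝ → Fin n → ℝ)
    (t : ℝ) (x : Fin n → ℝ) : Fin n → ℝ :=
  A *ᵥ x + B *ᵥ u t + γ t x + qx t

/-- The right-hand side of the error equation, in blocks `i = 1, …, N`, for `e_i = x̂_i - x`:
`A e_i + g(|ω_i|) H_i ω_i + ν ‖θ_i‖_𝐝^μ θ_i + γ(t, x̂_i) - γ(t, x) - q_x(t)` with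
`ω_i = C_i e_i - q_{y,i}(t)`, `θ_i = -(𝓛_i ⊗ I) e`, `g(r) = exp (μ (G₀ + I) ln r)`; here `x` is the
plant trajectory. -/
noncomputable def errorField {N n : ℕ} {p : Fin N → ℕ} (A : Matrix (Fin n) (Fin n) ℝ)
    (C : ∀ i, Matrix (Fin (p i)) (Fin n) ℝ) (G₀ Pa : Matrix (Fin n) (Fin n) ℝ)
    (H : ∀ i, Matrix (Fin n) (Fin (p i)) ℝ) (𝓛 : Matrix (Fin N) (Fin N) ℝ) (ν μ : ℝ)
    (γ : ℝ → (Fin n → ℝ) → Fin n → ℝ) (x : ℝ → Fin n → ℝ)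
    (qx : ℝ → Fin n → ℝ) (qy : ℝ → ∀ i, Fin (p i) → ℝ)
    (t : ℝ) (e : Fin N → Fin n → ℝ) : Fin N → Fin n → ℝ := fun i =>
  let ω : Fin (p i) → ℝ := C i *ᵥ e i - qy t i
  let θ : Fin n → ℝ := - ∑ j, 𝓛 i j • e j
  A *ᵥ e i
    + NormedSpace.exp ((μ * Real.log (euclNorm ω)) • (G₀ + 1)) *ᵥ (H i *ᵥ ω)
    + (ν * homNorm (dilationGenerator G₀ μ) Pa θ ^ μ) • θ
    + (γ t (x t + e i) - γ t (x t))
    - qx t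

/-- The constraint on the nonlinearity:
`‖𝐝̃(-ln ‖x̂ - x̃‖_𝐝̃) (γ̂(t, x̂) - γ̃(t, x))‖_P ≤ τ ‖x̂ - x̃‖_𝐝̃^μ` for `t > 0`, `x̂ ≠ x̃ = 𝟏 ⊗ x`, where
`P = I ⊗ P_a` and `𝐝̃` is generated by `I ⊗ G_𝐝`. -/
def SatisfiesGrowth (N : ℕ) {n : ℕ} (Gd Pa : Matrix (Fin n) (Fin n) ℝ) (μ τ : ℝ)
    (γ : ℝ → (Fin n → ℝ) → Fin n → ℝ) : Prop :=
  ∀ t : ℝ, 0 < t → ∀ (xhat : Fin N → Fin n → ℝ) (x : Fin n → ℝ), (xhat ≠ fun _ => x) →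
    let P : Matrix (Fin N × Fin n) (Fin N × Fin n) ℝ := 1 ⊗ₖ Pa
    let G : Matrix (Fin N × Fin n) (Fin N × Fin n) ℝ := 1 ⊗ₖ Gd
    let r : ℝ := homNorm G P fun k => xhat k.1 k.2 - x k.2
    weightedNorm P (dilation G (-Real.log r) *ᵥ fun k => γ t (xhat k.1) k.2 - γ t x k.2)
      ≤ τ * r ^ μ

/-! ### Solutions and input-to-state stability -/

/-- The time interval `[0, T)`, where `T = ⊤` is allowed. -/
def timeInterval (T : EReal) : Set ℝ := {t | 0 ≤ t ∧ (t : EReal) < T}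

/-- `x` is a (Carathéodory, i.e. locally absolutely continuous) solution of `ẋ = f(t, x)`,
`x(0) = x₀`, on `[0, T)`. -/
def IsSolutionOn {E : Type*} [NormedAddCommGroup E] [NormedSpace ℝ E]
    (f : ℝ → E → E) (T : EReal) (x₀ : E) (x : ℝ → E) : Prop :=
  ∀ t ∈ timeInterval T,
    IntervalIntegrable (fun s => f s (x s)) volume 0 t ∧ x t = x₀ + ∫ s in (0 : ℝ)..t, f s (x s)

/-- Class `𝒦` functions on `[0, ∞)`. -/
def ClassK (α : ℝ → ℝ) : Prop :=
  ContinuousOn α (Set.Ici 0) ∧ StrictMonoOn α (Set.Ici 0) ∧ α 0 = 0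

/-- Class `𝒦ℒ` functions on `[0, ∞) × [0, ∞)`. -/
def ClassKL (β : ℝ → ℝ → ℝ) : Prop :=
  ContinuousOn (Function.uncurry β) (Set.Ici 0 ×ˢ Set.Ici 0) ∧
  (∀ t, 0 ≤ t → ClassK fun r => β r t) ∧
  (∀ r, 0 < r → StrictAntiOn (β r) (Set.Ici 0)) ∧
  (∀ r, 0 ≤ r → Tendsto (β r) atTop (𝓝 0))

/-- `‖q‖_{L^∞[0,t)}`. -/
noncomputable def supNormUpTo {Q : Type*} [NormedAddCommGroup Q] (q : ℝ → Q) (t : ℝ) : ℝ :=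
  (eLpNorm q ∞ (volume.restrict (Set.Ico 0 t))).toReal

/-- Input-to-state stability of the error equation with respect to `q = (q_x, q_y)`: along every
plant trajectory `x` on `[0, T)` and for every `q ∈ L^∞`, the error equation has a solution on
`[0, T)` from every initial error, and all its solutions, also those on shorter intervals, satisfy
`‖e(t)‖ ≤ β(‖e(0)‖, t) + α(‖q‖_{L^∞[0,t)})`, with `β ∈ 𝒦ℒ` and `α ∈ 𝒦` depending neither on the
initial values nor on `x`, `u`, `q`. The norms of `e` and `q` are maximum norms. -/
def ErrorEquationISS {N n m : ℕ} {p : Fin N → ℕ} (A : Matrix (Fin n) (Fin n) ℝ)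
    (B : Matrix (Fin n) (Fin m) ℝ) (C : ∀ i, Matrix (Fin (p i)) (Fin n) ℝ)
    (G₀ Pa : Matrix (Fin n) (Fin n) ℝ) (H : ∀ i, Matrix (Fin n) (Fin (p i)) ℝ)
    (𝓛 : Matrix (Fin N) (Fin N) ℝ) (ν μ : ℝ) (γ : ℝ → (Fin n → ℝ) → Fin n → ℝ) : Prop :=
  ∃ (β : ℝ → ℝ → ℝ) (α : ℝ → ℝ), ClassKL β ∧ ClassK α ∧
    ∀ (T : EReal) (u : ℝ → Fin m → ℝ) (qx : ℝ → Fin n → ℝ) (qy : ℝ → ∀ i, Fin (p i) → ℝ)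
      (x₀ : Fin n → ℝ) (x : ℝ → Fin n → ℝ),
      MemLp (fun t => (qx t, qy t)) ∞ (volume.restrict (Set.Ici 0)) →
      IsSolutionOn (plantField A B γ u qx) T x₀ x →
      ∀ e₀ : Fin N → Fin n → ℝ,
        (∃ e, IsSolutionOn (errorField A C G₀ Pa H 𝓛 ν μ γ x qx qy) T e₀ e) ∧
        ∀ S ≤ T, ∀ e, IsSolutionOn (errorField A C G₀ Pa H 𝓛 ν μ γ x qx qy) S e₀ e →
          ∀ t ∈ timeInterval S,
            ‖e t‖ ≤ β ‖e₀‖ t + α (supNormUpTo (fun s => (qx s, qy s)) t)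

/-!
The error equation is a perturbation of a linear one, and homogeneity turns the perturbation
estimate, which is local, into a global one.

*Homogeneity.* Since `L₀ = 0`, the pair `(A, G₀)` satisfies `A G₀ = (G₀ + 1) A` and `C G₀ = 0`
(`IsHomogenizingPair.commutator_eq`). Hence, if `e_i = 𝐝(ln v) z_i`, the rescaled field
`𝐝(-ln v) f(t, e)` is `v ^ μ` times a field of the same form in `z`, with the disturbances rescaled
(`dilation_neg_mulVec_errorField`). It therefore suffices to study the field on a compact shell.

*Dissipation on the shell.* Let `Q` be the quadratic form of `lyapunovForm`, the sum of the squared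
`P_a`-norms of the `ζ`-weighted average of the errors and of their disagreement coordinates. For
`μ = 0` and no disturbance the field is linear up to `γ`: on the average the matrix inequality acts,
because `∑ ζ_i H_i C_i = P_a⁻¹ Y C`; on the disagreement the coupling dominates for large `ν`,
because `Δ + Δᵀ` is positive. Here `ζ_i > 0` by strong connectivity
(`pos_of_vecMul_laplacianMatrix_eq_zero`, `IsReductionPair.exists_couplingGain`). On the shell
`1 ≤ Q ≤ 4` the nonlinear terms differ from the linear ones by `O(|μ| + |q|)`, uniformly also near
the points where `ω_i = 0` or `θ_i = 0`, since `r |r ^ μ - 1| = O(|μ|)` for bounded `r`. So the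
strict decay survives for small `μ` and small rescaled disturbances
(`IsReductionPair.exists_dissipation`).

*Barrier.* In place of a differentiable homogeneous Lyapunov function, an explicit scale `v(t)` is
compared with `e`. It decreases to a level fixed by the disturbance, from an initial value fixed by
that level and `‖e₀‖`, so slowly that `Q(𝐝(-ln v(t)) e(t))` cannot grow while it lies between `1`
and `4`. Hence this quantity never exceeds `1` (`le_one_of_dilated_trajectory`), and the size of
`v(t)` gives the input-to-state estimate (`IsExpBound.exists_iss_estimate`). The decay rate of the
scale is admissible for both signs of `μ`, so one comparison function serves all cases.

*Existence.* The field is continuous in the error, so the equation with the error truncated to a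
large box has a solution by the Carathéodory–Peano theorem
(`IsCaratheodoryField.exists_isSolutionOn`). By the estimate just proved this solution never meets
the truncation (`IsCaratheodoryField.exists_isSolutionOn_of_bound`).
-/

/-! ### The matrix exponential acting on vectors -/

section MatrixExponential

attribute [local instance] Matrix.linftyOpNormedRing Matrix.linftyOpNormedAlgebra
  Matrix.linftyOpNormedAddCommGroup Matrix.linftyOpNormedSpace

variable {ι κ : Type*} [Fintype ι] [DecidableEq ι] [Fintype κ] [DecidableEq κ]

theorem norm_exp_sub_one_le_exp_norm_sub_one (K : Matrix ι ι ℝ) :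
    ‖NormedSpace.exp K - 1‖ ≤ Real.exp ‖K‖ - 1 := by
  have h1 := NormedSpace.exp_series_hasSum_exp' (𝕂 := ℝ) K
  have h2 := NormedSpace.exp_series_hasSum_exp' (𝕂 := ℝ) ‖K‖
  rw [← Real.exp_eq_exp_ℝ] at h2
  have h3 := (hasSum_nat_add_iff' 1).2 h1
  have h4 := (hasSum_nat_add_iff' 1).2 h2
  simp only [Finset.range_one, Finset.sum_singleton, Nat.factorial_zero, Nat.cast_one, inv_one,
    pow_zero, smul_eq_mul, mul_one, one_smul] at h3 h4
  refine h3.norm_le_of_bounded h4 fun n => ?_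
  rw [norm_smul, Real.norm_of_nonneg (by positivity)]
  gcongr
  exact norm_pow_le' K (Nat.succ_pos n)

/-- Every matrix `K` has a constant `k` controlling the distance of `exp (σ K)` from the
identity in the maximum norm. -/
theorem exists_exp_smul_mulVec_bound (K : Matrix ι ι ℝ) :
    ∃ k : ℝ, 0 ≤ k ∧ ∀ (σ : ℝ) (x : ι → ℝ),
      ‖NormedSpace.exp (σ • K) *ᵥ x - x‖ ≤ (Real.exp (k * |σ|) - 1) * ‖x‖ := by
  refine ⟨‖K‖, norm_nonneg _, fun σ x => ?_⟩
  have h : NormedSpace.exp (σ • K) *ᵥ x - x = (NormedSpace.exp (σ • K) - 1) *ᵥ x := by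
    rw [Matrix.sub_mulVec, Matrix.one_mulVec]
  rw [h]
  refine (Matrix.linfty_opNorm_mulVec _ _).trans ?_
  gcongr
  have := norm_exp_sub_one_le_exp_norm_sub_one (σ • K)
  rwa [norm_smul, Real.norm_eq_abs, mul_comm] at this

theorem exp_add_smul_mulVec (K : Matrix ι ι ℝ) (s t : ℝ) (x : ι → ℝ) :
    NormedSpace.exp ((s + t) • K) *ᵥ x
      = NormedSpace.exp (s • K) *ᵥ (NormedSpace.exp (t • K) *ᵥ x) := by
  rw [Matrix.mulVec_mulVec, ← Matrix.exp_add_of_commute, add_smul]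
  exact ((Commute.refl K).smul_left s).smul_right t

theorem exp_smul_add_one (K : Matrix ι ι ℝ) (s a b : ℝ) :
    NormedSpace.exp (s • (a • K + b • 1))
      = Real.exp (s * b) • NormedSpace.exp ((s * a) • K) := by
  rw [smul_add, smul_smul, smul_smul, add_comm, Matrix.exp_add_of_commute]
  · have : NormedSpace.exp ((s * b) • (1 : Matrix ι ι ℝ)) = Real.exp (s * b) • 1 := by
      have := (NormedSpace.algebraMap_exp_comm (𝕂 := ℝ) (𝔸 := Matrix ι ι ℝ) (s * b)).symm
      rw [Algebra.algebraMap_eq_smul_one, Algebra.algebraMap_eq_smul_one] at this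
      rw [Real.exp_eq_exp_ℝ]
      exact this
    rw [this, smul_mul_assoc, one_mul]
  · exact (Commute.one_left _).smul_left _

theorem mul_exp_smul_of_intertwine (M : Matrix κ ι ℝ) (K : Matrix ι ι ℝ) (L : Matrix κ κ ℝ)
    (h : M * K = L * M) (s : ℝ) :
    M * NormedSpace.exp (s • K) = NormedSpace.exp (s • L) * M := by
  have hpow : ∀ n : ℕ, M * (s • K) ^ n = (s • L) ^ n * M := by
    intro n
    induction n with
    | zero => simp
    | succ n ih =>
      rw [pow_succ, ← Matrix.mul_assoc, ih, Matrix.mul_assoc, Matrix.mul_smul, h,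
        ← Matrix.smul_mul, ← Matrix.mul_assoc, ← pow_succ]
  have h1 := (NormedSpace.exp_series_hasSum_exp' (𝕂 := ℝ) (s • K)).map
    (Matrix.addMonoidHomMulLeft M) (by
      change Continuous fun N : Matrix ι ι ℝ => M * N
      fun_prop)
  have h2 := (NormedSpace.exp_series_hasSum_exp' (𝕂 := ℝ) (s • L)).map
    (Matrix.addMonoidHomMulRight M) (by
      change Continuous fun N : Matrix κ κ ℝ => N * M
      fun_prop)
  refine h1.unique ?_
  convert h2 using 1
  · funext n
    simp [Matrix.addMonoidHomMulLeft, Matrix.addMonoidHomMulRight, hpow]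
  · rfl

theorem continuous_exp_matrix : Continuous (NormedSpace.exp : Matrix ι ι ℝ → Matrix ι ι ℝ) :=
  NormedSpace.exp_continuous

theorem hasDerivAt_exp_smul_mulVec (K : Matrix ι ι ℝ) (x : ι → ℝ) (s : ℝ) :
    HasDerivAt (fun u : ℝ => NormedSpace.exp (u • K) *ᵥ x)
      (K *ᵥ (NormedSpace.exp (s • K) *ᵥ x)) s := by
  have h := hasDerivAt_exp_smul_const' (𝕂 := ℝ) K s
  let φ : Matrix ι ι ℝ →ₗ[ℝ] (ι → ℝ) :=
    { toFun := fun M => M *ᵥ x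
      map_add' := fun M N => Matrix.add_mulVec M N x
      map_smul' := fun c M => Matrix.smul_mulVec c M x }
  have := (LinearMap.toContinuousLinearMap φ).hasFDerivAt.comp_hasDerivAt s h
  rw [Matrix.mulVec_mulVec]
  exact this

end MatrixExponential

/-! ### Absolutely continuous functions -/

section AbsolutelyContinuous

open AbsolutelyContinuousOnInterval

theorem AbsolutelyContinuousOnInterval.comp_lipschitzOnWith {X Y : Type*} [PseudoMetricSpace X]
    [PseudoMetricSpace Y] {f : ℝ → X} {a b : ℝ} (hf : AbsolutelyContinuousOnInterval f a b)
    {Ψ : X → Y} {s : Set X} {K : NNReal} (hΨ : LipschitzOnWith K Ψ s)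
    (hfs : ∀ t ∈ Set.uIcc a b, f t ∈ s) :
    AbsolutelyContinuousOnInterval (fun t => Ψ (f t)) a b := by
  have h2 : Tendsto (fun E : ℕ × (ℕ → ℝ × ℝ) =>
      K * ∑ i ∈ Finset.range E.1, dist (f (E.2 i).1) (f (E.2 i).2))
      (totalLengthFilter ⊓ 𝓟 (disjWithin a b)) (𝓝 0) := by
    simpa using Tendsto.const_mul (K : ℝ) hf
  refine squeeze_zero' (Eventually.of_forall fun E => Finset.sum_nonneg fun i _ => dist_nonneg)
    ?_ h2
  have : ∀ᶠ E in totalLengthFilter ⊓ 𝓟 (disjWithin a b), E ∈ disjWithin a b :=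
    eventually_inf_principal.2 (Eventually.of_forall fun E hE => hE)
  filter_upwards [this] with E hE
  rw [Finset.mul_sum]
  exact Finset.sum_le_sum fun i hi =>
    hΨ.dist_le_mul _ (hfs _ (hE.1 i hi).1) _ (hfs _ (hE.1 i hi).2)

theorem absolutelyContinuousOnInterval_pi {ι : Type*} [Fintype ι] {X : ι → Type*}
    [∀ i, PseudoMetricSpace (X i)] {f : ℝ → ∀ i, X i} {a b : ℝ}
    (hf : ∀ i, AbsolutelyContinuousOnInterval (fun t => f t i) a b) :
    AbsolutelyContinuousOnInterval f a b := by
  have h2 : Tendsto (fun E : ℕ × (ℕ → ℝ × ℝ) =>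
      ∑ j, ∑ i ∈ Finset.range E.1, dist (f (E.2 i).1 j) (f (E.2 i).2 j))
      (totalLengthFilter ⊓ 𝓟 (disjWithin a b)) (𝓝 0) := by
    simpa using tendsto_finsetSum Finset.univ fun j _ => hf j
  refine squeeze_zero (fun E => Finset.sum_nonneg fun i _ => dist_nonneg) (fun E => ?_) h2
  rw [Finset.sum_comm]
  refine Finset.sum_le_sum fun i _ => ?_
  refine (dist_pi_le_iff (Finset.sum_nonneg fun j _ => dist_nonneg)).2 fun j => ?_
  exact Finset.single_le_sum (f := fun j => dist (f (E.2 i).1 j) (f (E.2 i).2 j))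
    (fun j _ => dist_nonneg) (Finset.mem_univ j)

theorem AbsolutelyContinuousOnInterval.prodMk {X Y : Type*} [PseudoMetricSpace X]
    [PseudoMetricSpace Y] {f : ℝ → X} {g : ℝ → Y} {a b : ℝ}
    (hf : AbsolutelyContinuousOnInterval f a b) (hg : AbsolutelyContinuousOnInterval g a b) :
    AbsolutelyContinuousOnInterval (fun t => (f t, g t)) a b := by
  have h2 := Tendsto.add hf hg
  rw [add_zero] at h2
  refine squeeze_zero (fun E => Finset.sum_nonneg fun i _ => dist_nonneg) (fun E => ?_) h2
  rw [← Finset.sum_add_distrib]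
  refine Finset.sum_le_sum fun i _ => ?_
  rw [Prod.dist_eq]
  exact max_le_add_of_nonneg dist_nonneg dist_nonneg

theorem AbsolutelyContinuousOnInterval.comp_contDiff {E F : Type*} [NormedAddCommGroup E]
    [NormedSpace ℝ E] [ProperSpace E] [NormedAddCommGroup F] [NormedSpace ℝ F]
    {f : ℝ → E} {a b : ℝ}
    (hf : AbsolutelyContinuousOnInterval f a b) {Ψ : E → F} (hΨ : ContDiff ℝ 1 Ψ) :
    AbsolutelyContinuousOnInterval (fun t => Ψ (f t)) a b := by
  obtain ⟨C, hC⟩ := hf.exists_bound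
  obtain ⟨K, hK⟩ := (hΨ.contDiffOn (s := Metric.closedBall 0 C)).exists_lipschitzOnWith
    (by decide) (convex_closedBall 0 C) (isCompact_closedBall 0 C)
  exact hf.comp_lipschitzOnWith hK fun t ht => by simpa using hC t ht

/-- A level that an absolutely continuous function cannot cross upwards: if `m` starts at or below
`1` and has nonpositive derivative almost everywhere where `1 ≤ m ≤ 4`, then `m ≤ 1`. -/
theorem AbsolutelyContinuousOnInterval.le_one_of_deriv_nonpos {m : ℝ → ℝ} {b : ℝ} (hb : 0 ≤ b)
    (hm : AbsolutelyContinuousOnInterval m 0 b) (h0 : m 0 ≤ 1)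
    (hder : ∀ᵐ s, s ∈ Set.Icc 0 b → 1 ≤ m s → m s ≤ 4 → deriv m s ≤ 0) : m b ≤ 1 := by
  by_contra! hcon
  have hcont : ContinuousOn m (Set.Icc 0 b) := by simpa [Set.uIcc_of_le hb] using hm.continuousOn
  -- the last time at which `m ≤ 1`
  let s : Set ℝ := Set.Icc 0 b ∩ m ⁻¹' Set.Iic 1
  have hs : IsCompact s := by
    refine isCompact_Icc.of_isClosed_subset ?_ Set.inter_subset_left
    exact hcont.preimage_isClosed_of_isClosed isClosed_Icc isClosed_Iic
  obtain ⟨t₀, ht₀, hmax⟩ := hs.exists_isGreatest ⟨0, ⟨le_rfl, hb⟩, h0⟩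
  have ht₀b : t₀ < b := lt_of_le_of_ne ht₀.1.2 fun h => by
    have := ht₀.2
    rw [h] at this
    exact absurd this (not_le.2 hcon)
  have hgt : ∀ t, t₀ < t → t ≤ b → 1 < m t := fun t h1 h2 => by
    by_contra! h
    exact absurd (hmax ⟨⟨ht₀.1.1.trans h1.le, h2⟩, h⟩) (not_le.2 h1)
  have hnear : ∀ᶠ t in 𝓝[Set.Icc 0 b] t₀, m t < 4 :=
    (hcont t₀ ht₀.1).eventually (gt_mem_nhds (lt_of_le_of_lt ht₀.2 (by norm_num)))
  obtain ⟨δ, hδ, hball⟩ := Metric.mem_nhdsWithin_iff.1 hnear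
  obtain ⟨t₁, h1, h2⟩ : ∃ t₁, t₀ < t₁ ∧ t₁ < min b (t₀ + δ) :=
    exists_between (lt_min ht₀b (by linarith))
  have h2b : t₁ < b := h2.trans_le (min_le_left _ _)
  have h2d : t₁ < t₀ + δ := h2.trans_le (min_le_right _ _)
  have hint := (hm.mono (c := t₀) (d := t₁) (by
    rw [Set.uIcc_of_le hb, Set.uIcc_of_le h1.le]
    exact Set.Icc_subset_Icc ht₀.1.1 h2b.le)).integral_deriv_eq_sub
  have hneg : ∫ x in t₀..t₁, deriv m x ≤ 0 := by
    have : 0 ≤ ∫ x in t₀..t₁, - deriv m x := by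
      refine intervalIntegral.integral_nonneg_of_ae_restrict h1.le ?_
      rw [EventuallyLE, ae_restrict_iff' measurableSet_Icc]
      have hne : ∀ᵐ x : ℝ, x ≠ t₀ := by simp [ae_iff, measure_singleton]
      filter_upwards [hder, hne] with x hx hxne hxm
      have hx0 : x ∈ Set.Icc 0 b := ⟨ht₀.1.1.trans hxm.1, hxm.2.trans h2b.le⟩
      have hlt : t₀ < x := lt_of_le_of_ne hxm.1 hxne.symm
      have h4 : m x < 4 := hball ⟨by
        rw [Metric.mem_ball, Real.dist_eq, abs_lt]
        constructor <;> linarith [hxm.2], hx0⟩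
      have := hx hx0 (hgt x hlt hx0.2).le h4.le
      simpa using this
    rw [intervalIntegral.integral_neg] at this
    linarith
  have hm0 : m t₀ ≤ 1 := ht₀.2
  linarith [hgt t₁ h1 h2b.le]

end AbsolutelyContinuous

/-! ### A scalar estimate -/

/-- `ρ ^ (1 ± a)` is uniformly close to `ρ` on bounded sets, including near `ρ = 0`. -/
theorem mul_exp_abs_log_sub_one_le {ρ R a : ℝ} (hρ : 0 < ρ) (hρR : ρ ≤ R) (ha : 0 ≤ a)
    (ha' : a ≤ 1 / 2) :
    ρ * (Real.exp (a * |Real.log ρ|) - 1) ≤ (2 + R ^ 3) * a := by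
  have h1 : ∀ y : ℝ, 0 ≤ y → Real.exp y - 1 ≤ y * Real.exp y := fun y _ => by
    have := Real.add_one_le_exp (-y)
    have h2 : Real.exp (-y) * Real.exp y = 1 := by rw [← Real.exp_add]; simp
    nlinarith [Real.exp_pos y]
  have hl : 0 ≤ |Real.log ρ| := abs_nonneg _
  have h2 : Real.exp (a * |Real.log ρ|) ≤ Real.exp (1 / 2 * |Real.log ρ|) := by gcongr
  have key : ρ * |Real.log ρ| * Real.exp (1 / 2 * |Real.log ρ|) ≤ 2 + R ^ 3 := by
    have hR : 0 ≤ R := hρ.le.trans hρR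
    rcases le_total ρ 1 with h | h
    · have hlog : Real.log ρ ≤ 0 := Real.log_nonpos hρ.le h
      rw [abs_of_nonpos hlog]
      set w := Real.exp (1 / 2 * -Real.log ρ) with hw
      have hw2 : ρ * w * w = 1 := by
        rw [mul_assoc, hw, ← Real.exp_add]
        nth_rewrite 1 [← Real.exp_log hρ]
        rw [← Real.exp_add]; ring_nf; simp
      have hwpos : 0 < w := Real.exp_pos _
      have hle : 1 / 2 * -Real.log ρ + 1 ≤ w := Real.add_one_le_exp _
      have : ρ * -Real.log ρ * w ≤ ρ * (2 * w) * w := by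
        gcongr
        linarith
      nlinarith [pow_nonneg hR 3]
    · have hlog : 0 ≤ Real.log ρ := Real.log_nonneg h
      rw [abs_of_nonneg hlog]
      have h3 : Real.log ρ ≤ ρ := (Real.log_le_sub_one_of_pos hρ).trans (by linarith)
      have h4 : Real.exp (1 / 2 * Real.log ρ) ≤ ρ := by
        nth_rewrite 2 [← Real.exp_log hρ]
        exact Real.exp_le_exp.2 (by linarith)
      calc ρ * Real.log ρ * Real.exp (1 / 2 * Real.log ρ) ≤ R * R * R := by
            gcongr <;> linarith
        _ ≤ 2 + R ^ 3 := by ring_nf; linarith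
  calc ρ * (Real.exp (a * |Real.log ρ|) - 1)
      ≤ ρ * (a * |Real.log ρ| * Real.exp (a * |Real.log ρ|)) := by
        gcongr; exact h1 _ (by positivity)
    _ ≤ ρ * (a * |Real.log ρ| * Real.exp (1 / 2 * |Real.log ρ|)) := by gcongr
    _ = (ρ * |Real.log ρ| * Real.exp (1 / 2 * |Real.log ρ|)) * a := by ring
    _ ≤ _ := by gcongr

/-! ### Existence of Carathéodory solutions -/

section Existence

variable {E : Type*} [NormedAddCommGroup E] [NormedSpace ℝ E]

theorem timeInterval_subset {T : EReal} {t s : ℝ} (ht : t ∈ timeInterval T) (hs : 0 ≤ s)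
    (hst : s ≤ t) : s ∈ timeInterval T :=
  ⟨hs, lt_of_le_of_lt (EReal.coe_le_coe_iff.2 hst) ht.2⟩

/-- The nodes of the Euler polygon with step `1 / (k + 1)`. -/
noncomputable def eulerNode (F : ℝ → E → E) (e₀ : E) (k : ℕ) : ℕ → E
  | 0 => e₀
  | j + 1 => eulerNode F e₀ k j +
      ∫ s in ((j : ℝ) / (k + 1))..(((j + 1 : ℕ) : ℝ) / (k + 1)), F s (eulerNode F e₀ k j)

/-- The step function that on `(j / (k + 1), (j + 1) / (k + 1)]` takes the value of the `j`-th
Euler node. -/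
noncomputable def eulerStep (F : ℝ → E → E) (e₀ : E) (k : ℕ) (s : ℝ) : E :=
  eulerNode F e₀ k (⌈s * (k + 1)⌉₊ - 1)

/-- The Euler polygon: the primitive of the field frozen at the Euler nodes. -/
noncomputable def eulerPolygon (F : ℝ → E → E) (e₀ : E) (k : ℕ) (t : ℝ) : E :=
  e₀ + ∫ s in (0 : ℝ)..t, F s (eulerStep F e₀ k s)

theorem stronglyMeasurable_eulerStep (F : ℝ → E → E) (e₀ : E) (k : ℕ) :
    StronglyMeasurable (eulerStep F e₀ k) := by
  have h : Measurable fun s : ℝ => ⌈s * ((k : ℝ) + 1)⌉₊ - 1 :=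
    (measurable_from_nat (f := fun m : ℕ => m - 1)).comp
      (Nat.measurable_ceil.comp (measurable_id.mul_const _))
  exact (StronglyMeasurable.of_discrete (f := eulerNode F e₀ k)).comp_measurable h

/-- The data of a Carathéodory field on `[0, T)`: measurable in time along strongly measurable
curves, continuous in the state, and bounded on compact time intervals. -/
structure IsCaratheodoryField (F : ℝ → E → E) (T : EReal) : Prop where
  meas : ∀ t ∈ timeInterval T, ∀ Y : ℝ → E, StronglyMeasurable Y →
    AEStronglyMeasurable (fun s => F s (Y s)) (volume.restrict (Set.Ioc 0 t))
  cont : ∀ s, Continuous (F s)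
  bdd : ∀ t ∈ timeInterval T, ∃ M : ℝ, 0 ≤ M ∧
    ∀ᵐ s ∂volume.restrict (Set.Ioc 0 t), ∀ e, ‖F s e‖ ≤ M

variable {F : ℝ → E → E} {T : EReal}

omit [NormedSpace ℝ E] in
theorem IsCaratheodoryField.intervalIntegrable (hF : IsCaratheodoryField F T) {t : ℝ}
    (ht : t ∈ timeInterval T) {Y : ℝ → E}
    (hY : AEStronglyMeasurable (fun s => F s (Y s)) (volume.restrict (Set.Ioc 0 t))) :
    IntervalIntegrable (fun s => F s (Y s)) volume 0 t := by
  obtain ⟨M, _, hM⟩ := hF.bdd t ht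
  rw [intervalIntegrable_iff_integrableOn_Ioc_of_le ht.1]
  exact Integrable.of_bound hY M (by filter_upwards [hM] with s hs using hs _)

theorem IsCaratheodoryField.intervalIntegrable_eulerStep (hF : IsCaratheodoryField F T) (e₀ : E)
    (k : ℕ) {s t : ℝ} (hs : 0 ≤ s) (hst : s ≤ t) (ht : t ∈ timeInterval T) :
    IntervalIntegrable (fun s => F s (eulerStep F e₀ k s)) volume s t := by
  refine (hF.intervalIntegrable ht
    (hF.meas t ht _ (stronglyMeasurable_eulerStep F e₀ k))).mono_set ?_
  rw [Set.uIcc_of_le hst, Set.uIcc_of_le ht.1]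
  exact Set.Icc_subset_Icc_left hs

theorem IsCaratheodoryField.norm_eulerPolygon_sub_le (hF : IsCaratheodoryField F T) (e₀ : E)
    (k : ℕ) {r s t M : ℝ} (hr : r ∈ timeInterval T)
    (hM : ∀ᵐ s ∂volume.restrict (Set.Ioc 0 r), ∀ e, ‖F s e‖ ≤ M)
    (hs : 0 ≤ s) (hst : s ≤ t) (htr : t ≤ r) :
    ‖eulerPolygon F e₀ k t - eulerPolygon F e₀ k s‖ ≤ M * (t - s) := by
  have ht : t ∈ timeInterval T := timeInterval_subset hr (hs.trans hst) htr
  have h : eulerPolygon F e₀ k t - eulerPolygon F e₀ k s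
      = ∫ u in s..t, F u (eulerStep F e₀ k u) := by
    rw [eulerPolygon, eulerPolygon, add_sub_add_left_eq_sub,
      intervalIntegral.integral_interval_sub_left]
    · exact hF.intervalIntegrable_eulerStep e₀ k le_rfl ht.1 ht
    · exact hF.intervalIntegrable_eulerStep e₀ k le_rfl hs (timeInterval_subset ht hs hst)
  rw [h, ← abs_of_nonneg (sub_nonneg.2 hst)]
  refine intervalIntegral.norm_integral_le_of_norm_le_const_ae ?_
  rw [ae_restrict_iff' measurableSet_Ioc] at hM
  filter_upwards [hM] with u hu hu'
  rw [Set.uIoc_of_le hst] at hu'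
  exact hu ⟨hs.trans_lt hu'.1, hu'.2.trans htr⟩ _

theorem IsCaratheodoryField.eulerPolygon_node (hF : IsCaratheodoryField F T) (e₀ : E) (k j : ℕ)
    (hj : (j : ℝ) / (k + 1) ∈ timeInterval T) :
    eulerPolygon F e₀ k ((j : ℝ) / (k + 1)) = eulerNode F e₀ k j := by
  have hk : (0 : ℝ) < k + 1 := by positivity
  induction j with
  | zero => simp [eulerPolygon, eulerNode]
  | succ j ih =>
    have hle : (j : ℝ) / (k + 1) ≤ ((j + 1 : ℕ) : ℝ) / (k + 1) := by
      gcongr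
      exact_mod_cast Nat.le_succ j
    have hj' := timeInterval_subset hj (by positivity) hle
    rw [eulerNode, ← ih hj', eulerPolygon, eulerPolygon, add_assoc]
    congr 1
    rw [← intervalIntegral.integral_add_adjacent_intervals
      (hF.intervalIntegrable_eulerStep e₀ k le_rfl hj'.1 hj')
      (hF.intervalIntegrable_eulerStep e₀ k hj'.1 hle hj)]
    congr 1
    refine intervalIntegral.integral_congr_ae (Eventually.of_forall fun s hs => ?_)
    rw [Set.uIoc_of_le hle] at hs
    have hceil : ⌈s * ((k : ℝ) + 1)⌉₊ = j + 1 := by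
      rw [Nat.ceil_eq_iff (Nat.succ_ne_zero j)]
      constructor
      · have := (div_lt_iff₀ hk).1 hs.1
        simpa using this
      · exact (le_div_iff₀ hk).1 hs.2
    have hstep : eulerStep F e₀ k s = eulerPolygon F e₀ k ((j : ℝ) / (k + 1)) := by
      rw [ih hj', eulerStep, hceil, Nat.add_sub_cancel]
    simp only [hstep]
    rfl

theorem IsCaratheodoryField.norm_eulerStep_sub_le (hF : IsCaratheodoryField F T) (e₀ : E)
    (k : ℕ) {r s M : ℝ} (hr : r ∈ timeInterval T) (hM0 : 0 ≤ M)
    (hM : ∀ᵐ s ∂volume.restrict (Set.Ioc 0 r), ∀ e, ‖F s e‖ ≤ M)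
    (hs : 0 < s) (hsr : s ≤ r) :
    ‖eulerPolygon F e₀ k s - eulerStep F e₀ k s‖ ≤ M * (1 / (k + 1)) := by
  have hk : (0 : ℝ) < k + 1 := by positivity
  obtain ⟨j, hj⟩ : ∃ j, ⌈s * ((k : ℝ) + 1)⌉₊ = j + 1 :=
    Nat.exists_eq_succ_of_ne_zero (Nat.ceil_pos.2 (by positivity)).ne'
  have h := (Nat.ceil_eq_iff (Nat.succ_ne_zero j)).1 hj
  have h1 : (j : ℝ) / (k + 1) ≤ s := by
    rw [div_le_iff₀ hk]
    simpa using h.1.le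
  have h2 : s - (j : ℝ) / (k + 1) ≤ 1 / (k + 1) := by
    rw [sub_le_iff_le_add, ← add_div, le_div_iff₀ hk]
    have := h.2
    push_cast at this
    linarith
  have h0 : 0 ≤ (j : ℝ) / (k + 1) := by positivity
  rw [eulerStep, hj, Nat.add_sub_cancel,
    ← hF.eulerPolygon_node e₀ k j (timeInterval_subset hr h0 (h1.trans hsr))]
  refine (hF.norm_eulerPolygon_sub_le e₀ k hr hM h0 h1 hsr).trans ?_
  gcongr

/-- **Peano–Carathéodory**: a field that is continuous in the state, measurable in time and
bounded on compact time intervals has a solution on the whole interval. -/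
theorem IsCaratheodoryField.exists_isSolutionOn [FiniteDimensional ℝ E]
    (hF : IsCaratheodoryField F T) (e₀ : E) : ∃ e, IsSolutionOn F T e₀ e := by
  classical
  have : ProperSpace E := FiniteDimensional.proper_real E
  choose! M hM0 hM using hF.bdd
  -- a subsequence of the Euler polygons converges at all rational times
  let u : ℕ → ℚ → E := fun k q =>
    if (q : ℝ) ∈ timeInterval T then eulerPolygon F e₀ k q else e₀
  have hcomp : IsCompact (Set.pi Set.univ fun q : ℚ => Metric.closedBall e₀ |M q * q|) :=
    isCompact_univ_pi fun q => isCompact_closedBall _ _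
  have hu : ∀ k, u k ∈ Set.pi Set.univ fun q : ℚ => Metric.closedBall e₀ |M q * q| := by
    intro k q _
    by_cases hq : (q : ℝ) ∈ timeInterval T
    · have := hF.norm_eulerPolygon_sub_le e₀ k hq (hM q hq) le_rfl hq.1 le_rfl
      simp only [u, if_pos hq, Metric.mem_closedBall, dist_eq_norm]
      have h0 : eulerPolygon F e₀ k 0 = e₀ := by simp [eulerPolygon]
      rw [h0, sub_zero] at this
      exact this.trans (le_abs_self _)
    · simp only [u, if_neg hq]
      exact Metric.mem_closedBall_self (abs_nonneg _)
  obtain ⟨l, -, φ, hφ, hlim⟩ := hcomp.tendsto_subseq hu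
  have hrat : ∀ q : ℚ, (q : ℝ) ∈ timeInterval T →
      CauchySeq fun k => eulerPolygon F e₀ (φ k) q := fun q hq => by
    have := (tendsto_pi_nhds.1 hlim q).cauchySeq
    simpa [u, Function.comp_def, if_pos hq] using this
  -- by equicontinuity it converges at all times
  have hall : ∀ t ∈ timeInterval T, ∃ e, Tendsto (fun k => eulerPolygon F e₀ (φ k) t) atTop (𝓝 e)
      := fun t ht => by
    refine cauchySeq_tendsto_of_complete (Metric.cauchySeq_iff.2 fun ε hε => ?_)
    obtain ⟨q, hq0, hqt, hq⟩ : ∃ q : ℚ, 0 ≤ (q : ℝ) ∧ (q : ℝ) ≤ t ∧ M t * (t - q) < ε / 3 := by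
      rcases ht.1.eq_or_lt with h | h
      · exact ⟨0, by simp, by simpa using ht.1, by simp [← h]; positivity⟩
      · obtain ⟨q, hq1, hq2⟩ := exists_rat_btwn
          (show max 0 (t - ε / (3 * (M t + 1))) < t from
            max_lt h (by have := hM0 t ht; linarith [show 0 < ε / (3 * (M t + 1)) by positivity]))
        refine ⟨q, (le_max_left _ _).trans hq1.le, hq2.le, ?_⟩
        have h1 : t - q < ε / (3 * (M t + 1)) := by
          have := (le_max_right 0 (t - ε / (3 * (M t + 1)))).trans_lt hq1
          linarith
        have hMt := hM0 t ht
        rw [lt_div_iff₀ (by positivity)] at h1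
        nlinarith
    have hqT := timeInterval_subset ht hq0 hqt
    obtain ⟨K, hK⟩ := Metric.cauchySeq_iff.1 (hrat q hqT) (ε / 3) (by positivity)
    refine ⟨K, fun a ha b hb => ?_⟩
    have h1 := hF.norm_eulerPolygon_sub_le e₀ (φ a) ht (hM t ht) hq0 hqt le_rfl
    have h2 := hF.norm_eulerPolygon_sub_le e₀ (φ b) ht (hM t ht) hq0 hqt le_rfl
    have h3 := hK a ha b hb
    rw [← dist_eq_norm] at h1 h2
    calc dist (eulerPolygon F e₀ (φ a) t) (eulerPolygon F e₀ (φ b) t)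
        ≤ dist (eulerPolygon F e₀ (φ a) t) (eulerPolygon F e₀ (φ a) q)
          + dist (eulerPolygon F e₀ (φ a) q) (eulerPolygon F e₀ (φ b) q)
          + dist (eulerPolygon F e₀ (φ b) q) (eulerPolygon F e₀ (φ b) t) := dist_triangle4 _ _ _ _
      _ < ε := by rw [dist_comm (eulerPolygon F e₀ (φ b) q)]; linarith
  choose! X hX using hall
  refine ⟨X, fun t ht => ?_⟩
  have hstep : ∀ s ∈ Set.Ioc 0 t, Tendsto (fun k => F s (eulerStep F e₀ (φ k) s)) atTop
      (𝓝 (F s (X s))) := fun s hs => by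
    have h0 : Tendsto (fun k => eulerPolygon F e₀ (φ k) s - eulerStep F e₀ (φ k) s) atTop
        (𝓝 0) := by
      refine squeeze_zero_norm (fun k => hF.norm_eulerStep_sub_le e₀ (φ k) ht (hM0 t ht)
        (hM t ht) hs.1 hs.2) ?_
      have := (tendsto_one_div_add_atTop_nhds_zero_nat (𝕜 := ℝ)).comp hφ.tendsto_atTop
      simpa using this.const_mul (M t)
    have h1 := (hX s (timeInterval_subset ht hs.1.le hs.2)).sub h0
    simp only [sub_sub_cancel, sub_zero] at h1
    exact ((hF.cont s).tendsto _).comp h1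
  have hmeas : ∀ k, AEStronglyMeasurable (fun s => F s (eulerStep F e₀ k s))
      (volume.restrict (Set.Ioc 0 t)) := fun k =>
    hF.meas t ht _ (stronglyMeasurable_eulerStep F e₀ k)
  have hae : ∀ᵐ s ∂volume.restrict (Set.Ioc 0 t),
      Tendsto (fun k => F s (eulerStep F e₀ (φ k) s)) atTop (𝓝 (F s (X s))) := by
    rw [ae_restrict_iff' measurableSet_Ioc]
    exact Eventually.of_forall hstep
  refine ⟨hF.intervalIntegrable ht (aestronglyMeasurable_of_tendsto_ae _ (fun k => hmeas (φ k))
    hae), ?_⟩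
  have hint : Tendsto (fun k => ∫ s in (0 : ℝ)..t, F s (eulerStep F e₀ (φ k) s)) atTop
      (𝓝 (∫ s in (0 : ℝ)..t, F s (X s))) := by
    refine intervalIntegral.tendsto_integral_filter_of_dominated_convergence (fun _ => M t)
      (Eventually.of_forall fun k => ?_) (Eventually.of_forall fun k => ?_) ?_ ?_
    · rw [Set.uIoc_of_le ht.1]
      exact hmeas (φ k)
    · have := hM t ht
      rw [ae_restrict_iff' measurableSet_Ioc] at this
      filter_upwards [this] with s hs hs'
      rw [Set.uIoc_of_le ht.1] at hs'
      exact hs hs' _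
    · simp
    · refine Eventually.of_forall fun s hs => ?_
      rw [Set.uIoc_of_le ht.1] at hs
      exact hstep s hs
  exact tendsto_nhds_unique (hX t ht) (hint.const_add e₀)

theorem IsSolutionOn.continuousOn {e₀ : E} {e : ℝ → E} (h : IsSolutionOn F T e₀ e) {t : ℝ}
    (ht : t ∈ timeInterval T) : ContinuousOn e (Set.Icc 0 t) := by
  have h1 : ContinuousOn (fun x => e₀ + ∫ s in (0 : ℝ)..x, F s (e s)) (Set.Icc 0 t) := by
    refine continuousOn_const.add ?_
    have := intervalIntegral.continuousOn_primitive_interval (μ := volume) (a := 0) (b := t)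
      (f := fun s => F s (e s)) ?_
    · rwa [Set.uIcc_of_le ht.1] at this
    · rw [Set.uIcc_of_le ht.1, integrableOn_Icc_iff_integrableOn_Ioc]
      exact (intervalIntegrable_iff_integrableOn_Ioc_of_le ht.1).1 (h t ht).1
  exact h1.congr fun s hs => (h s (timeInterval_subset ht hs.1 hs.2)).2

theorem IsSolutionOn.apply_zero {e₀ : E} {e : ℝ → E} (h : IsSolutionOn F T e₀ e) {t : ℝ}
    (ht : t ∈ timeInterval T) : e 0 = e₀ := by
  simpa using (h 0 (timeInterval_subset ht le_rfl ht.1)).2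

end Existence

/-! ### Quadratic forms in finite dimension -/

section QuadraticForms

variable {E : Type*} [NormedAddCommGroup E] [NormedSpace ℝ E] [FiniteDimensional ℝ E]

theorem LinearMap.exists_norm_le_mul {F : Type*} [NormedAddCommGroup F] [NormedSpace ℝ F]
    (f : E →ₗ[ℝ] F) : ∃ c : ℝ, 0 ≤ c ∧ ∀ x, ‖f x‖ ≤ c * ‖x‖ :=
  ⟨‖LinearMap.toContinuousLinearMap f‖, norm_nonneg _,
    fun x => (LinearMap.toContinuousLinearMap f).le_opNorm x⟩

theorem LinearMap.BilinForm.exists_abs_le_mul (B : LinearMap.BilinForm ℝ E) :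
    ∃ c : ℝ, 0 ≤ c ∧ ∀ x y, |B x y| ≤ c * ‖x‖ * ‖y‖ :=
  ⟨‖LinearMap.toContinuousBilinearMap B‖, ContinuousLinearMap.opNorm_nonneg _,
    fun x y => (LinearMap.toContinuousBilinearMap B).le_opNorm₂ x y⟩

theorem LinearMap.BilinForm.continuous_self_apply (B : LinearMap.BilinForm ℝ E) :
    Continuous fun x => B x x :=
  (LinearMap.toContinuousBilinearMap B).continuous.clm_apply continuous_id

theorem LinearMap.BilinForm.exists_sq_norm_le (B : LinearMap.BilinForm ℝ E)
    (hB : ∀ x, x ≠ 0 → 0 < B x x) : ∃ c : ℝ, 0 < c ∧ ∀ x, c * ‖x‖ ^ 2 ≤ B x x := by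
  have : ProperSpace E := FiniteDimensional.proper_real E
  rcases subsingleton_or_nontrivial E with h | h
  · exact ⟨1, one_pos, fun x => by simp [Subsingleton.elim x 0]⟩
  · obtain ⟨x₀, hx₀, hmin⟩ := (isCompact_sphere (0 : E) 1).exists_isMinOn
      (NormedSpace.sphere_nonempty.2 zero_le_one) B.continuous_self_apply.continuousOn
    have hx₀' : ‖x₀‖ = 1 := by simpa using hx₀
    refine ⟨B x₀ x₀, hB x₀ (norm_pos_iff.1 (by rw [hx₀']; exact one_pos)), fun x => ?_⟩
    rcases eq_or_ne x 0 with rfl | hx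
    · simp
    · have hn : 0 < ‖x‖ := norm_pos_iff.2 hx
      have h1 : B x₀ x₀ ≤ B (‖x‖⁻¹ • x) (‖x‖⁻¹ • x) :=
        hmin (by simp [norm_smul, hn.ne'])
      simp only [map_smul, LinearMap.smul_apply, smul_eq_mul] at h1
      calc B x₀ x₀ * ‖x‖ ^ 2 ≤ (‖x‖⁻¹ * (‖x‖⁻¹ * B x x)) * ‖x‖ ^ 2 := by gcongr
        _ = B x x := by field_simp

variable {ι : Type*} [Fintype ι] [DecidableEq ι]

/-- The bilinear form `(x, y) ↦ xᵀ P y`. -/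
noncomputable def weightedInner (P : Matrix ι ι ℝ) : LinearMap.BilinForm ℝ (ι → ℝ) :=
  Matrix.toBilin' P

theorem weightedInner_apply (P : Matrix ι ι ℝ) (x y : ι → ℝ) :
    weightedInner P x y = x ⬝ᵥ (P *ᵥ y) := Matrix.toBilin'_apply' P x y

variable {P : Matrix ι ι ℝ}

theorem weightedInner_self_pos (hP : P.PosDef) {x : ι → ℝ} (hx : x ≠ 0) :
    0 < weightedInner P x x := by
  rw [weightedInner_apply]
  simpa using hP.dotProduct_mulVec_pos hx

theorem weightedInner_self_nonneg (hP : P.PosDef) (x : ι → ℝ) : 0 ≤ weightedInner P x x := by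
  rcases eq_or_ne x 0 with rfl | hx
  · simp
  · exact (weightedInner_self_pos hP hx).le

omit [Fintype ι] [DecidableEq ι] in
theorem Matrix.PosDef.transpose_eq (hP : P.PosDef) : Pᵀ = P := by
  simpa [Matrix.IsHermitian, Matrix.conjTranspose_eq_transpose_of_trivial] using hP.isHermitian

theorem weightedInner_comm (hP : P.PosDef) (x y : ι → ℝ) :
    weightedInner P x y = weightedInner P y x := by
  rw [weightedInner_apply, weightedInner_apply, Matrix.dotProduct_mulVec, ← Matrix.mulVec_transpose,
    hP.transpose_eq, dotProduct_comm]

omit [DecidableEq ι] in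
theorem weightedNorm_nonneg (P : Matrix ι ι ℝ) (x : ι → ℝ) : 0 ≤ weightedNorm P x :=
  Real.sqrt_nonneg _

theorem weightedNorm_sq (hP : P.PosDef) (x : ι → ℝ) :
    weightedNorm P x ^ 2 = weightedInner P x x := by
  rw [weightedNorm, ← weightedInner_apply, Real.sq_sqrt (weightedInner_self_nonneg hP x)]

theorem weightedInner_le_weightedNorm_mul (hP : P.PosDef) (x y : ι → ℝ) :
    weightedInner P x y ≤ weightedNorm P x * weightedNorm P y := by
  refine le_of_abs_le (abs_le_of_sq_le_sq ?_
    (mul_nonneg (weightedNorm_nonneg _ _) (weightedNorm_nonneg _ _)))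
  rw [mul_pow, weightedNorm_sq hP, weightedNorm_sq hP]
  exact LinearMap.BilinForm.apply_sq_le_of_symm _ (weightedInner_self_nonneg hP)
    ⟨fun x y => weightedInner_comm hP x y⟩ x y

theorem weightedNorm_add_le (hP : P.PosDef) (x y : ι → ℝ) :
    weightedNorm P (x + y) ≤ weightedNorm P x + weightedNorm P y := by
  refine (sq_le_sq₀ (weightedNorm_nonneg _ _)
    (add_nonneg (weightedNorm_nonneg _ _) (weightedNorm_nonneg _ _))).1 ?_
  rw [weightedNorm_sq hP, add_sq, weightedNorm_sq hP, weightedNorm_sq hP]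
  simp only [map_add, LinearMap.add_apply]
  have := weightedInner_le_weightedNorm_mul hP x y
  rw [weightedInner_comm hP y x]
  linarith

theorem weightedNorm_smul (P : Matrix ι ι ℝ) (c : ℝ) (x : ι → ℝ) :
    weightedNorm P (c • x) = |c| * weightedNorm P x := by
  rw [weightedNorm, weightedNorm, ← weightedInner_apply, ← weightedInner_apply]
  simp only [map_smul, LinearMap.smul_apply, smul_eq_mul]
  rw [← mul_assoc, Real.sqrt_mul (mul_self_nonneg c), Real.sqrt_mul_self_eq_abs]

omit [DecidableEq ι] in
@[simp] theorem weightedNorm_zero (P : Matrix ι ι ℝ) : weightedNorm P 0 = 0 := by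
  simp [weightedNorm]

omit [DecidableEq ι] in
theorem continuous_weightedNorm (P : Matrix ι ι ℝ) : Continuous (weightedNorm P) := by
  unfold weightedNorm
  fun_prop

/-- The weighted norm is equivalent to the maximum norm. -/
theorem exists_weightedNorm_equiv (hP : P.PosDef) :
    ∃ c : ℝ, 1 ≤ c ∧ ∀ x, weightedNorm P x ≤ c * ‖x‖ ∧ ‖x‖ ≤ c * weightedNorm P x := by
  obtain ⟨a, ha, hle⟩ := (weightedInner P).exists_abs_le_mul
  obtain ⟨b, hb, hge⟩ := (weightedInner P).exists_sq_norm_le fun x => weightedInner_self_pos hP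
  refine ⟨1 + a + b⁻¹, by have := inv_pos.2 hb; linarith, fun x => ?_⟩
  have hbi := inv_pos.2 hb
  have hbb : b⁻¹ * b = 1 := inv_mul_cancel₀ hb.ne'
  have h1 := weightedNorm_nonneg P x
  constructor
  · refine (sq_le_sq₀ (by positivity) (by positivity)).1 ?_
    rw [weightedNorm_sq hP, mul_pow]
    have h2 := (le_abs_self _).trans (hle x x)
    nlinarith [sq_nonneg ‖x‖, mul_nonneg ha hbi.le, sq_nonneg a, sq_nonneg b⁻¹]
  · refine (sq_le_sq₀ (by positivity) (by positivity)).1 ?_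
    rw [mul_pow, weightedNorm_sq hP]
    have h2 := hge x
    have h3 : ‖x‖ ^ 2 ≤ b⁻¹ * weightedInner P x x := by
      calc ‖x‖ ^ 2 = b⁻¹ * (b * ‖x‖ ^ 2) := by rw [← mul_assoc, hbb, one_mul]
        _ ≤ _ := by gcongr
    have h4 := weightedInner_self_nonneg hP x
    refine h3.trans ?_
    gcongr
    nlinarith [mul_nonneg ha hbi.le, sq_nonneg a, sq_nonneg b⁻¹]

end QuadraticForms

/-! ### Canonical homogeneous norms -/

section HomogeneousNorm

variable {ι : Type*} [Fintype ι] [DecidableEq ι] {G P : Matrix ι ι ℝ}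

theorem dilation_add_mulVec (G : Matrix ι ι ℝ) (s t : ℝ) (x : ι → ℝ) :
    dilation G (s + t) *ᵥ x = dilation G s *ᵥ (dilation G t *ᵥ x) :=
  exp_add_smul_mulVec G s t x

@[simp] theorem dilation_zero (G : Matrix ι ι ℝ) : dilation G 0 = 1 := by
  simp [dilation]

theorem dilation_neg_mulVec_cancel (G : Matrix ι ι ℝ) (s : ℝ) (x : ι → ℝ) :
    dilation G s *ᵥ (dilation G (-s) *ᵥ x) = x := by
  rw [← dilation_add_mulVec]; simp

theorem dilation_mulVec_neg_cancel (G : Matrix ι ι ℝ) (s : ℝ) (x : ι → ℝ) :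
    dilation G (-s) *ᵥ (dilation G s *ᵥ x) = x := by
  rw [← dilation_add_mulVec]; simp

theorem dilation_mulVec_ne_zero (G : Matrix ι ι ℝ) (s : ℝ) {x : ι → ℝ} (hx : x ≠ 0) :
    dilation G s *ᵥ x ≠ 0 := fun h => hx <| by
  rw [← dilation_mulVec_neg_cancel G s x, h, Matrix.mulVec_zero]

theorem continuous_dilation (G : Matrix ι ι ℝ) : Continuous (dilation G) :=
  continuous_exp_matrix.comp (continuous_id.smul continuous_const)

/-- The hypotheses under which the canonical homogeneous norm is well defined, together with the
contraction rate of the dilation for negative times. -/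
structure IsMonotoneDilation (G P : Matrix ι ι ℝ) : Prop where
  posDef : P.PosDef
  lyapunov : (P * G + Gᵀ * P).PosDef
  contract : ∀ s ≤ 0, ∀ x : ι → ℝ, ‖dilation G s *ᵥ x‖ ≤ Real.exp (s / 2) * ‖x‖

theorem weightedInner_mulVec_add (hP : P.PosDef) (x : ι → ℝ) :
    weightedInner P x (G *ᵥ x) + weightedInner P (G *ᵥ x) x
      = x ⬝ᵥ ((P * G + Gᵀ * P) *ᵥ x) := by
  rw [weightedInner_comm hP (G *ᵥ x) x, weightedInner_apply, Matrix.add_mulVec, dotProduct_add,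
    Matrix.mulVec_mulVec]
  congr 1
  have h : Gᵀ * P = (P * G)ᵀ := by rw [Matrix.transpose_mul, hP.transpose_eq]
  rw [h, Matrix.mulVec_transpose, dotProduct_comm x (x ᵥ* _), Matrix.dotProduct_mulVec]

theorem IsMonotoneDilation.strictAnti (h : IsMonotoneDilation G P) {x : ι → ℝ} (hx : x ≠ 0) :
    StrictAnti fun s => weightedNorm P (dilation G (-s) *ᵥ x) := by
  have hd : ∀ s, HasDerivAt (fun s => dilation G (-s) *ᵥ x)
      (-(G *ᵥ (dilation G (-s) *ᵥ x))) s := fun s => by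
    have := (hasDerivAt_exp_smul_mulVec G x (-s)).scomp s (hasDerivAt_neg s)
    simpa [dilation, Function.comp_def] using this
  have hder : ∀ s, HasDerivAt
      (fun s => weightedInner P (dilation G (-s) *ᵥ x) (dilation G (-s) *ᵥ x))
      (-((dilation G (-s) *ᵥ x) ⬝ᵥ ((P * G + Gᵀ * P) *ᵥ (dilation G (-s) *ᵥ x)))) s := fun s => by
    have := (LinearMap.toContinuousBilinearMap (weightedInner P)).hasDerivAt_of_bilinear
      (fun _ => hd s) (fun _ => hd s)
    refine this.congr_deriv ?_
    rw [← weightedInner_mulVec_add h.posDef]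
    simp [LinearMap.toContinuousBilinearMap_apply]
    ring
  have hanti : StrictAnti fun s =>
      weightedInner P (dilation G (-s) *ᵥ x) (dilation G (-s) *ᵥ x) := by
    refine strictAnti_of_deriv_neg fun s => ?_
    rw [(hder s).deriv, neg_lt_zero]
    simpa using h.lyapunov.dotProduct_mulVec_pos (dilation_mulVec_ne_zero G (-s) hx)
  intro s t hst
  refine lt_of_pow_lt_pow_left₀ 2 (weightedNorm_nonneg _ _) ?_
  rw [weightedNorm_sq h.posDef, weightedNorm_sq h.posDef]
  exact hanti hst

theorem IsMonotoneDilation.exists_eq_one (h : IsMonotoneDilation G P) {x : ι → ℝ} (hx : x ≠ 0) :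
    ∃ s, weightedNorm P (dilation G (-s) *ᵥ x) = 1 := by
  obtain ⟨c, hc, hequiv⟩ := exists_weightedNorm_equiv h.posDef
  have hcont : Continuous fun s => weightedNorm P (dilation G (-s) *ᵥ x) :=
    (continuous_weightedNorm P).comp
      (((continuous_dilation G).comp continuous_neg).matrix_mulVec continuous_const)
  have hxn : 0 < ‖x‖ := norm_pos_iff.2 hx
  refine mem_range_of_exists_le_of_exists_ge hcont ?_ ?_
  · obtain ⟨s, hs0, hs⟩ : ∃ s : ℝ, 0 ≤ s ∧ c * ‖x‖ ≤ Real.exp (s / 2) :=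
      ⟨2 * (c * ‖x‖), by positivity, by
        have := Real.add_one_le_exp (2 * (c * ‖x‖) / 2)
        linarith [this]⟩
    refine ⟨s, (hequiv _).1.trans ?_⟩
    have h1 := h.contract (-s) (by linarith) x
    have h2 : Real.exp (-s / 2) * Real.exp (s / 2) = 1 := by
      rw [← Real.exp_add]; ring_nf; simp
    calc c * ‖dilation G (-s) *ᵥ x‖ ≤ c * (Real.exp (-s / 2) * ‖x‖) := by gcongr
      _ = Real.exp (-s / 2) * (c * ‖x‖) := by ring
      _ ≤ Real.exp (-s / 2) * Real.exp (s / 2) := by gcongr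
      _ = 1 := h2
  · obtain ⟨s, hs0, hs⟩ : ∃ s : ℝ, 0 ≤ s ∧ c / ‖x‖ ≤ Real.exp (s / 2) :=
      ⟨2 * (c / ‖x‖), by positivity, by
        have := Real.add_one_le_exp (2 * (c / ‖x‖) / 2)
        linarith [this]⟩
    refine ⟨-s, ?_⟩
    rw [neg_neg]
    have h1 := h.contract (-s) (by linarith) (dilation G s *ᵥ x)
    rw [dilation_mulVec_neg_cancel] at h1
    have h2 : Real.exp (-s / 2) * Real.exp (s / 2) = 1 := by
      rw [← Real.exp_add]; ring_nf; simp
    have h3 := (hequiv (dilation G s *ᵥ x)).2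
    have h4 : c ≤ Real.exp (s / 2) * ‖x‖ := by rwa [div_le_iff₀ hxn] at hs
    have h5 : c ≤ c * weightedNorm P (dilation G s *ᵥ x) := by
      calc c ≤ Real.exp (s / 2) * ‖x‖ := h4
        _ ≤ Real.exp (s / 2) * (Real.exp (-s / 2) * ‖dilation G s *ᵥ x‖) := by gcongr
        _ = (Real.exp (-s / 2) * Real.exp (s / 2)) * ‖dilation G s *ᵥ x‖ := by ring
        _ ≤ _ := by rw [h2, one_mul]; exact h3
    exact le_of_mul_le_mul_left (by linarith) (by linarith : (0 : ℝ) < c)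

@[simp] theorem homNorm_zero (G P : Matrix ι ι ℝ) : homNorm G P 0 = 0 := by simp [homNorm]

theorem homNorm_nonneg (G P : Matrix ι ι ℝ) (x : ι → ℝ) : 0 ≤ homNorm G P x := by
  unfold homNorm
  split_ifs
  exacts [le_rfl, (Real.exp_pos _).le]

theorem homNorm_pos (G P : Matrix ι ι ℝ) {x : ι → ℝ} (hx : x ≠ 0) : 0 < homNorm G P x := by
  rw [homNorm, if_neg hx]
  exact Real.exp_pos _

theorem IsMonotoneDilation.weightedNorm_homNorm (h : IsMonotoneDilation G P) {x : ι → ℝ}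
    (hx : x ≠ 0) : weightedNorm P (dilation G (-Real.log (homNorm G P x)) *ᵥ x) = 1 := by
  rw [homNorm, if_neg hx, Real.log_exp]
  exact Classical.epsilon_spec (h.exists_eq_one hx)

theorem IsMonotoneDilation.homNorm_lt_iff (h : IsMonotoneDilation G P) {r : ℝ} (hr : 0 < r)
    (x : ι → ℝ) : homNorm G P x < r ↔ weightedNorm P (dilation G (-Real.log r) *ᵥ x) < 1 := by
  rcases eq_or_ne x 0 with rfl | hx
  · simp [hr]
  · rw [← h.weightedNorm_homNorm hx, (h.strictAnti hx).lt_iff_gt,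
      Real.log_lt_log_iff (homNorm_pos G P hx) hr]

theorem IsMonotoneDilation.lt_homNorm_iff (h : IsMonotoneDilation G P) {r : ℝ} (hr : 0 < r)
    (x : ι → ℝ) : r < homNorm G P x ↔ 1 < weightedNorm P (dilation G (-Real.log r) *ᵥ x) := by
  rcases eq_or_ne x 0 with rfl | hx
  · simp [hr.le, zero_le_one.not_gt]
  · have h1 := h.weightedNorm_homNorm hx
    conv_rhs => rw [← h1]
    rw [(h.strictAnti hx).lt_iff_gt, Real.log_lt_log_iff hr (homNorm_pos G P hx)]

theorem IsMonotoneDilation.homNorm_dilation (h : IsMonotoneDilation G P) (s : ℝ) (x : ι → ℝ) :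
    homNorm G P (dilation G s *ᵥ x) = Real.exp s * homNorm G P x := by
  rcases eq_or_ne x 0 with rfl | hx
  · simp
  · have hy := dilation_mulVec_ne_zero G s hx
    have h1 := h.weightedNorm_homNorm hy
    rw [← dilation_add_mulVec, ← h.weightedNorm_homNorm hx,
      show -Real.log (homNorm G P (dilation G s *ᵥ x)) + s
        = -(Real.log (homNorm G P (dilation G s *ᵥ x)) - s) by ring] at h1
    have h2 := (h.strictAnti hx).injective h1
    rw [← Real.exp_log (homNorm_pos G P hy), ← Real.exp_log (homNorm_pos G P hx), ← Real.exp_add,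
      ← h2]
    congr 1
    ring

theorem IsMonotoneDilation.continuous_homNorm (h : IsMonotoneDilation G P) :
    Continuous (homNorm G P) := by
  have hc : ∀ r, Continuous fun x : ι → ℝ => weightedNorm P (dilation G (-Real.log r) *ᵥ x) :=
    fun r => (continuous_weightedNorm P).comp (continuous_const.matrix_mulVec continuous_id)
  refine continuous_iff_continuousAt.2 fun x => tendsto_order.2 ⟨fun a ha => ?_, fun a ha => ?_⟩
  · rcases lt_or_ge a 0 with ha0 | ha0
    · exact Eventually.of_forall fun y => ha0.trans_le (homNorm_nonneg G P y)
    · obtain ⟨r, hr, hrx⟩ := exists_between ha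
      have hr0 : 0 < r := ha0.trans_lt hr
      filter_upwards [(hc r).continuousAt.eventually (lt_mem_nhds ((h.lt_homNorm_iff hr0 x).1 hrx))]
        with y hy using hr.trans ((h.lt_homNorm_iff hr0 y).2 hy)
  · have ha0 : 0 < a := (homNorm_nonneg G P x).trans_lt ha
    filter_upwards [(hc a).continuousAt.eventually (gt_mem_nhds ((h.homNorm_lt_iff ha0 x).1 ha))]
      with y hy using (h.homNorm_lt_iff ha0 y).2 hy

end HomogeneousNorm

/-! ### Block-diagonal dilations -/

section Blocks

variable {N n : ℕ}

theorem dilation_one_kronecker_mulVec (G : Matrix (Fin n) (Fin n) ℝ) (s : ℝ)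
    (z : Fin N → Fin n → ℝ) :
    dilation (1 ⊗ₖ G : Matrix (Fin N × Fin n) (Fin N × Fin n) ℝ) s *ᵥ (fun k => z k.1 k.2)
      = fun k => (dilation G s *ᵥ z k.1) k.2 := by
  funext k
  -- restriction to a block intertwines the two dilations
  let M : Matrix (Fin n) (Fin N × Fin n) ℝ := Matrix.of fun a l => if l = (k.1, a) then 1 else 0
  have hM : ∀ w : Fin N × Fin n → ℝ, M *ᵥ w = fun a => w (k.1, a) := fun w => by
    funext a
    simp [M, Matrix.mulVec, dotProduct]
  have hint : M * (1 ⊗ₖ G : Matrix (Fin N × Fin n) (Fin N × Fin n) ℝ) = G * M := by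
    ext a ⟨l₁, l₂⟩
    have h1 : (M * (1 ⊗ₖ G : Matrix (Fin N × Fin n) (Fin N × Fin n) ℝ)) a (l₁, l₂)
        = (1 ⊗ₖ G : Matrix (Fin N × Fin n) (Fin N × Fin n) ℝ) (k.1, a) (l₁, l₂) :=
      congrFun (hM fun r => (1 ⊗ₖ G : Matrix (Fin N × Fin n) (Fin N × Fin n) ℝ) r (l₁, l₂)) a
    rw [h1]
    by_cases hk : k.1 = l₁
    · simp [M, Matrix.mul_apply, hk]
    · simp [M, Matrix.mul_apply, hk, Ne.symm hk]
  have h := mul_exp_smul_of_intertwine M _ _ hint s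
  have h2 := congrArg (fun Q => (Q *ᵥ fun k : Fin N × Fin n => z k.1 k.2) k.2) h
  simp only [← Matrix.mulVec_mulVec, hM] at h2
  exact h2

theorem weightedNorm_one_kronecker_single (P : Matrix (Fin n) (Fin n) ℝ) (i : Fin N)
    (w : Fin n → ℝ) :
    weightedNorm (1 ⊗ₖ P : Matrix (Fin N × Fin n) (Fin N × Fin n) ℝ)
      (fun k => (Pi.single i w : Fin N → Fin n → ℝ) k.1 k.2) = weightedNorm P w := by
  unfold weightedNorm
  congr 1
  simp only [dotProduct, Matrix.mulVec, Fintype.sum_prod_type, Matrix.kroneckerMap_apply,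
    Matrix.one_apply, ite_mul, one_mul, zero_mul]
  rw [Finset.sum_eq_single i]
  · refine Finset.sum_congr rfl fun a _ => ?_
    simp
  · intro j _ hj
    simp [Pi.single_eq_of_ne hj]
  · simp

theorem single_eq_zero_iff' (i : Fin N) (w : Fin n → ℝ) :
    (fun k : Fin N × Fin n => (Pi.single i w : Fin N → Fin n → ℝ) k.1 k.2) = 0 ↔ w = 0 := by
  constructor
  · intro h
    funext a
    simpa using congrFun h (i, a)
  · rintro rfl
    funext k
    simp

theorem dilation_one_kronecker_single (G : Matrix (Fin n) (Fin n) ℝ) (s : ℝ) (i : Fin N)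
    (w : Fin n → ℝ) :
    dilation (1 ⊗ₖ G : Matrix (Fin N × Fin n) (Fin N × Fin n) ℝ) s *ᵥ
        (fun k => (Pi.single i w : Fin N → Fin n → ℝ) k.1 k.2)
      = fun k => (Pi.single i (dilation G s *ᵥ w) : Fin N → Fin n → ℝ) k.1 k.2 := by
  rw [dilation_one_kronecker_mulVec]
  funext k
  by_cases hk : k.1 = i
  · rw [hk]; simp
  · simp [Pi.single_eq_of_ne hk]

theorem homNorm_one_kronecker_single (G P : Matrix (Fin n) (Fin n) ℝ) (i : Fin N)
    (w : Fin n → ℝ) :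
    homNorm (1 ⊗ₖ G : Matrix (Fin N × Fin n) (Fin N × Fin n) ℝ) (1 ⊗ₖ P)
      (fun k => (Pi.single i w : Fin N → Fin n → ℝ) k.1 k.2) = homNorm G P w := by
  unfold homNorm
  simp only [single_eq_zero_iff', dilation_one_kronecker_single, weightedNorm_one_kronecker_single]

/-- The growth constraint, specialized to observers that differ from the plant in one block
only, is a growth constraint for the homogeneous norm of a single block. -/
theorem SatisfiesGrowth.block (hN : 0 < N) {G P : Matrix (Fin n) (Fin n) ℝ} {μ τ : ℝ}
    {γ : ℝ → (Fin n → ℝ) → Fin n → ℝ} (h : SatisfiesGrowth N G P μ τ γ) {t : ℝ} (ht : 0 < t)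
    (x : Fin n → ℝ) {w : Fin n → ℝ} (hw : w ≠ 0) :
    weightedNorm P (dilation G (-Real.log (homNorm G P w)) *ᵥ (γ t (x + w) - γ t x))
      ≤ τ * homNorm G P w ^ μ := by
  let i : Fin N := ⟨0, hN⟩
  have h1 := h t ht (fun j => x + (Pi.single i w : Fin N → Fin n → ℝ) j) x (fun hc => hw <| by
    have := congrFun hc i
    simpa using this)
  have e1 : (fun k : Fin N × Fin n => (x + (Pi.single i w : Fin N → Fin n → ℝ) k.1) k.2 - x k.2)
      = fun k => (Pi.single i w : Fin N → Fin n → ℝ) k.1 k.2 := by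
    funext k; simp
  have e2 : (fun k : Fin N × Fin n =>
        γ t (x + (Pi.single i w : Fin N → Fin n → ℝ) k.1) k.2 - γ t x k.2)
      = fun k => (Pi.single i (γ t (x + w) - γ t x) : Fin N → Fin n → ℝ) k.1 k.2 := by
    funext k
    by_cases hk : k.1 = i
    · rw [hk]; simp
    · simp [Pi.single_eq_of_ne hk]
  simpa only [e1, e2, homNorm_one_kronecker_single, dilation_one_kronecker_single,
    weightedNorm_one_kronecker_single] using h1

end Blocks

/-! ### The left Perron vector of the Laplacian -/

section Graph

theorem vecMul_laplacianMatrix_apply {V : Type*} [Fintype V] {𝒢 : Digraph V}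
    (hloop : ∀ i, ¬ 𝒢.Adj i i) (ζ : V → ℝ) (j : V) :
    (ζ ᵥ* laplacianMatrix 𝒢) j
      = ζ j * ∑ k, adjacencyMatrix 𝒢 j k - ∑ i, ζ i * adjacencyMatrix 𝒢 i j := by
  classical
  have h : ∀ i, laplacianMatrix 𝒢 i j
      = (if i = j then ∑ k, adjacencyMatrix 𝒢 j k else 0) - adjacencyMatrix 𝒢 i j := fun i => by
    by_cases hij : i = j
    · subst hij
      simp [laplacianMatrix, adjacencyMatrix, hloop]
    · simp [laplacianMatrix, hij]
  simp [Matrix.vecMul, dotProduct, h, mul_sub, Finset.sum_sub_distrib]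

/-- The left null vector of the Laplacian of a strongly connected digraph, normalized to sum `1`,
is positive. Its positive part is again a left null vector, and the zeros of a nonnegative left
null vector spread backwards along the edges. -/
theorem pos_of_vecMul_laplacianMatrix_eq_zero {V : Type*} [Fintype V] {𝒢 : Digraph V}
    (hloop : ∀ i, ¬ 𝒢.Adj i i) (hconn : IsStronglyConnectedDigraph 𝒢) {ζ : V → ℝ}
    (hζ : ζ ᵥ* laplacianMatrix 𝒢 = 0) (hsum : ∑ i, ζ i = 1) (i : V) : 0 < ζ i := by
  have ha : ∀ i j, 0 ≤ adjacencyMatrix 𝒢 i j := fun i j => by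
    simp only [adjacencyMatrix, Matrix.of_apply]; split_ifs <;> norm_num
  have hbal : ∀ j, ζ j * ∑ k, adjacencyMatrix 𝒢 j k = ∑ i, ζ i * adjacencyMatrix 𝒢 i j :=
    fun j => sub_eq_zero.1 (by rw [← vecMul_laplacianMatrix_apply hloop, hζ]; rfl)
  let w : V → ℝ := fun i => max (ζ i) 0
  have hw0 : ∀ i, 0 ≤ w i := fun i => le_max_right _ _
  have hle : ∀ j, w j * ∑ k, adjacencyMatrix 𝒢 j k ≤ ∑ i, w i * adjacencyMatrix 𝒢 i j := by
    intro j
    rcases le_total (ζ j) 0 with h | h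
    · simp only [w, max_eq_right h, zero_mul]
      exact Finset.sum_nonneg fun i _ => mul_nonneg (hw0 i) (ha i j)
    · rw [show w j = ζ j from max_eq_left h, hbal]
      exact Finset.sum_le_sum fun i _ => mul_le_mul_of_nonneg_right (le_max_left _ _) (ha i j)
  have htot : ∑ j, w j * ∑ k, adjacencyMatrix 𝒢 j k
      = ∑ j, ∑ i, w i * adjacencyMatrix 𝒢 i j := by
    rw [Finset.sum_comm]
    exact Finset.sum_congr rfl fun j _ => Finset.mul_sum _ _ _
  have heq : ∀ j, w j * ∑ k, adjacencyMatrix 𝒢 j k = ∑ i, w i * adjacencyMatrix 𝒢 i j :=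
    fun j => (Finset.sum_eq_sum_iff_of_le fun j _ => hle j).1 htot j (Finset.mem_univ j)
  have hstep : ∀ i j, 𝒢.Adj i j → w j = 0 → w i = 0 := fun i j hij hj => by
    have h1 := heq j
    rw [hj, zero_mul] at h1
    have h2 := (Finset.sum_eq_zero_iff_of_nonneg fun i _ => mul_nonneg (hw0 i) (ha i j)).1 h1.symm
      i (Finset.mem_univ i)
    simpa [adjacencyMatrix, hij] using h2
  by_contra! hi
  have hall : ∀ j, w j = 0 := fun j => by
    induction hconn j i using Relation.ReflTransGen.head_induction_on with
    | refl => exact max_eq_right hi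
    | head hab _ ih => exact hstep _ _ hab ih
  have : ∑ j, ζ j ≤ 0 := Finset.sum_nonpos fun j _ => by
    rw [← hall j]; exact le_max_left _ _
  linarith

end Graph

/-! ### Average and disagreement coordinates -/

section Coordinates

variable {N n : ℕ}

/-- The average `∑ i, ζ i • z i` of the blocks. -/
noncomputable def blockAverage (n : ℕ) (ζ : Fin N → ℝ) : (Fin N → Fin n → ℝ) →ₗ[ℝ] (Fin n → ℝ) :=
  ∑ i, ζ i • LinearMap.proj i

/-- The disagreement coordinates `(Y₂ᵀ ⊗ I) z`. -/
noncomputable def blockDisagreement (n : ℕ) {M : ℕ} (Y₂ : Matrix (Fin N) (Fin M) ℝ) :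
    (Fin N → Fin n → ℝ) →ₗ[ℝ] (Fin M → Fin n → ℝ) :=
  LinearMap.pi fun k => ∑ i, Y₂ i k • LinearMap.proj i

/-- The bilinear form `(u, v) ↦ ∑ k, u kᵀ P v k` on families of vectors. -/
noncomputable def blockInner (M : ℕ) (P : Matrix (Fin n) (Fin n) ℝ) :
    LinearMap.BilinForm ℝ (Fin M → Fin n → ℝ) :=
  ∑ k, (weightedInner P).compl₁₂ (LinearMap.proj k) (LinearMap.proj k)

/-- The action of `Δ ⊗ I` on families of vectors. -/
noncomputable def blockMatrixAction (n : ℕ) {M : ℕ} (Δ : Matrix (Fin M) (Fin M) ℝ) :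
    (Fin M → Fin n → ℝ) →ₗ[ℝ] (Fin M → Fin n → ℝ) :=
  LinearMap.pi fun k => ∑ l, Δ k l • LinearMap.proj l

/-- The inner product that makes average and disagreement coordinates orthogonal; its quadratic
form is the Lyapunov function of the linear error dynamics. -/
noncomputable def lyapunovForm {M : ℕ} (P : Matrix (Fin n) (Fin n) ℝ) (ζ : Fin N → ℝ)
    (Y₂ : Matrix (Fin N) (Fin M) ℝ) : LinearMap.BilinForm ℝ (Fin N → Fin n → ℝ) :=
  (weightedInner P).compl₁₂ (blockAverage n ζ) (blockAverage n ζ)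
    + (blockInner M P).compl₁₂ (blockDisagreement n Y₂) (blockDisagreement n Y₂)

theorem blockAverage_apply (ζ : Fin N → ℝ) (z : Fin N → Fin n → ℝ) :
    blockAverage n ζ z = ∑ i, ζ i • z i := by
  simp [blockAverage, LinearMap.sum_apply]

theorem blockDisagreement_apply {M : ℕ} (Y₂ : Matrix (Fin N) (Fin M) ℝ) (z : Fin N → Fin n → ℝ)
    (k : Fin M) : blockDisagreement n Y₂ z k = ∑ i, Y₂ i k • z i := by
  simp [blockDisagreement, LinearMap.sum_apply]

theorem blockMatrixAction_apply {M : ℕ} (Δ : Matrix (Fin M) (Fin M) ℝ) (u : Fin M → Fin n → ℝ)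
    (k : Fin M) : blockMatrixAction n Δ u k = ∑ l, Δ k l • u l := by
  simp [blockMatrixAction, LinearMap.sum_apply]

theorem blockInner_apply (M : ℕ) (P : Matrix (Fin n) (Fin n) ℝ) (u v : Fin M → Fin n → ℝ) :
    blockInner M P u v = ∑ k, weightedInner P (u k) (v k) := by
  simp [blockInner, LinearMap.sum_apply]

theorem lyapunovForm_apply {M : ℕ} (P : Matrix (Fin n) (Fin n) ℝ) (ζ : Fin N → ℝ)
    (Y₂ : Matrix (Fin N) (Fin M) ℝ) (z w : Fin N → Fin n → ℝ) :
    lyapunovForm P ζ Y₂ z w = weightedInner P (blockAverage n ζ z) (blockAverage n ζ w)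
      + blockInner M P (blockDisagreement n Y₂ z) (blockDisagreement n Y₂ w) := rfl

theorem lyapunovForm_comm {M : ℕ} {P : Matrix (Fin n) (Fin n) ℝ} (hP : P.PosDef)
    (ζ : Fin N → ℝ) (Y₂ : Matrix (Fin N) (Fin M) ℝ) (z w : Fin N → Fin n → ℝ) :
    lyapunovForm P ζ Y₂ z w = lyapunovForm P ζ Y₂ w z := by
  simp only [lyapunovForm_apply, blockInner_apply, weightedInner_comm hP (blockAverage n ζ z),
    fun k => weightedInner_comm hP (blockDisagreement n Y₂ z k)]

variable {M : ℕ} {P : Matrix (Fin n) (Fin n) ℝ} {ζ : Fin N → ℝ}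
  {Y₁ Y₂ : Matrix (Fin N) (Fin M) ℝ} {𝓛 : Matrix (Fin N) (Fin N) ℝ} {Δ : Matrix (Fin M) (Fin M) ℝ}

/-- The entrywise content of the reduction `T⁻¹ 𝓛 T = diag(0, Δ)`. -/
structure IsReductionPair (ζ : Fin N → ℝ) (Y₁ Y₂ : Matrix (Fin N) (Fin M) ℝ)
    (𝓛 : Matrix (Fin N) (Fin N) ℝ) (Δ : Matrix (Fin M) (Fin M) ℝ) : Prop where
  decomp : ∀ i j, ζ j + ∑ k, Y₁ i k * Y₂ j k = if i = j then 1 else 0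
  average : ∀ j, ∑ i, ζ i * 𝓛 i j = 0
  disagreement : ∀ k j, ∑ i, Y₂ i k * 𝓛 i j = ∑ l, Δ k l * Y₂ j l

theorem IsLaplacianReduction.exists_isReductionPair
    {Δ : Matrix (Fin (N - 1)) (Fin (N - 1)) ℝ} (h : IsLaplacianReduction 𝓛 ζ Δ) :
    ∃ Y₁ Y₂ : Matrix (Fin N) (Fin (N - 1)) ℝ, IsReductionPair ζ Y₁ Y₂ 𝓛 Δ := by
  obtain ⟨T, S, Y₁, Y₂, rfl, rfl, hTS, -, hred⟩ := h
  have hS := congrArg (· * Matrix.fromRows (Matrix.replicateRow Unit ζ) Y₂ᵀ) hred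
  simp only [Matrix.mul_assoc] at hS
  rw [hTS, Matrix.mul_one] at hS
  refine ⟨Y₁, Y₂, fun i j => ?_, fun j => ?_, fun k j => ?_⟩
  · have := congrFun (congrFun hTS i) j
    rw [Matrix.one_apply] at this
    rw [← this]
    simp [Matrix.mul_apply, Fintype.sum_sum_type]
  · have := congrFun (congrFun hS (Sum.inl ())) j
    simpa [Matrix.mul_apply, Fintype.sum_sum_type] using this
  · have := congrFun (congrFun hS (Sum.inr k)) j
    simpa [Matrix.mul_apply, Fintype.sum_sum_type] using this

theorem IsReductionPair.apply_eq (h : IsReductionPair ζ Y₁ Y₂ 𝓛 Δ) (z : Fin N → Fin n → ℝ)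
    (i : Fin N) :
    z i = blockAverage n ζ z + ∑ k, Y₁ i k • blockDisagreement n Y₂ z k := by
  simp only [blockAverage_apply, blockDisagreement_apply, Finset.smul_sum, smul_smul]
  rw [Finset.sum_comm, ← Finset.sum_add_distrib]
  simp only [← Finset.sum_smul, ← add_smul, h.decomp]
  simp

theorem IsReductionPair.blockAverage_coupling (h : IsReductionPair ζ Y₁ Y₂ 𝓛 Δ)
    (z : Fin N → Fin n → ℝ) : blockAverage n ζ (fun i => ∑ j, 𝓛 i j • z j) = 0 := by
  simp only [blockAverage_apply, Finset.smul_sum, smul_smul]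
  rw [Finset.sum_comm]
  simp only [← Finset.sum_smul, h.average, zero_smul, Finset.sum_const_zero]

theorem IsReductionPair.blockDisagreement_coupling (h : IsReductionPair ζ Y₁ Y₂ 𝓛 Δ)
    (z : Fin N → Fin n → ℝ) : blockDisagreement n Y₂ (fun i => ∑ j, 𝓛 i j • z j)
      = blockMatrixAction n Δ (blockDisagreement n Y₂ z) := by
  funext k
  simp only [blockDisagreement_apply, blockMatrixAction_apply, Finset.smul_sum, smul_smul]
  rw [Finset.sum_comm]
  simp only [← Finset.sum_smul, h.disagreement]
  rw [Finset.sum_comm]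
  simp only [← Finset.sum_smul]

theorem IsReductionPair.lyapunovForm_self_pos (h : IsReductionPair ζ Y₁ Y₂ 𝓛 Δ) (hP : P.PosDef)
    {z : Fin N → Fin n → ℝ} (hz : z ≠ 0) : 0 < lyapunovForm P ζ Y₂ z z := by
  rw [lyapunovForm_apply, blockInner_apply]
  have h1 := weightedInner_self_nonneg hP (blockAverage n ζ z)
  have h2 : ∀ k ∈ Finset.univ, 0 ≤ weightedInner P (blockDisagreement n Y₂ z k)
    (blockDisagreement n Y₂ z k) := fun k _ => weightedInner_self_nonneg hP _
  refine (add_nonneg h1 (Finset.sum_nonneg h2)).lt_of_ne fun h0 => hz ?_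
  have h3 := (add_eq_zero_iff_of_nonneg h1 (Finset.sum_nonneg h2)).1 h0.symm
  have hzero : ∀ x : Fin n → ℝ, weightedInner P x x = 0 → x = 0 := fun x hx => by
    by_contra hne
    exact (weightedInner_self_pos hP hne).ne' hx
  have h4 := (Finset.sum_eq_zero_iff_of_nonneg h2).1 h3.2
  funext i
  rw [h.apply_eq z i, hzero _ h3.1]
  simp [fun k => hzero _ (h4 k (Finset.mem_univ k))]

theorem two_mul_blockInner_blockMatrixAction (hP : P.PosDef) (u : Fin M → Fin n → ℝ) :
    2 * blockInner M P u (blockMatrixAction n Δ u)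
      = (fun k : Fin M × Fin n => u k.1 k.2) ⬝ᵥ
          (((Δᵀ + Δ) ⊗ₖ P) *ᵥ fun k : Fin M × Fin n => u k.1 k.2) := by
  have h1 : ∀ D : Matrix (Fin M) (Fin M) ℝ, (fun k : Fin M × Fin n => u k.1 k.2) ⬝ᵥ
      ((D ⊗ₖ P) *ᵥ fun k : Fin M × Fin n => u k.1 k.2)
        = ∑ l, ∑ m, D l m * weightedInner P (u l) (u m) := fun D => by
    simp only [weightedInner_apply, dotProduct, Matrix.mulVec, Fintype.sum_prod_type,
      Matrix.kroneckerMap_apply, Finset.mul_sum]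
    refine Finset.sum_congr rfl fun l _ => ?_
    rw [Finset.sum_comm]
    refine Finset.sum_congr rfl fun m _ => Finset.sum_congr rfl fun a _ =>
      Finset.sum_congr rfl fun b _ => by ring
  rw [h1]
  simp only [blockInner_apply, blockMatrixAction_apply, map_sum, map_smul, smul_eq_mul,
    Matrix.add_apply, Matrix.transpose_apply, add_mul, Finset.sum_add_distrib]
  rw [two_mul]
  congr 1
  rw [Finset.sum_comm]
  simp only [weightedInner_comm hP]

theorem exists_blockInner_blockMatrixAction_ge (hP : P.PosDef) (hΔP : ((Δᵀ + Δ) ⊗ₖ P).PosDef) :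
    ∃ c : ℝ, 0 < c ∧ ∀ u : Fin M → Fin n → ℝ,
      c * ‖u‖ ^ 2 ≤ blockInner M P u (blockMatrixAction n Δ u) := by
  refine LinearMap.BilinForm.exists_sq_norm_le
    ((blockInner M P).compl₁₂ LinearMap.id (blockMatrixAction n Δ)) fun u hu => ?_
  have hne : (fun k : Fin M × Fin n => u k.1 k.2) ≠ 0 := fun h => hu <| by
    funext i a
    exact congrFun h (i, a)
  have := hΔP.dotProduct_mulVec_pos hne
  rw [star_trivial, ← two_mul_blockInner_blockMatrixAction hP] at this
  simpa using this

/-- **Dissipation of the linear error dynamics.** For a large coupling gain `ν` the Lyapunov form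
decays along the linear dynamics, uniformly over all perturbations `Γ` bounded blockwise by
`(ρ / 3) ‖z i‖_P`: the average decays by the matrix inequality, the disagreement by the coupling. -/
theorem IsReductionPair.exists_couplingGain (h : IsReductionPair ζ Y₁ Y₂ 𝓛 Δ) (hP : P.PosDef)
    (hΔP : ((Δᵀ + Δ) ⊗ₖ P).PosDef) (hζ : ∀ i, 0 < ζ i) (hsum : ∑ i, ζ i = 1) {ρ : ℝ} (hρ : 0 < ρ)
    (A : (Fin n → ℝ) →ₗ[ℝ] (Fin n → ℝ)) (K : Fin N → (Fin n → ℝ) →ₗ[ℝ] (Fin n → ℝ)) :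
    ∃ ν₀ : ℝ, 0 < ν₀ ∧ ∀ ν ≥ ν₀,
      (∀ x, weightedInner P x (A x + ∑ i, ζ i • K i x) ≤ -(11 / 12 * ρ) * weightedInner P x x) →
      ∀ z Γ : Fin N → Fin n → ℝ, (∀ i, weightedNorm P (Γ i) ≤ ρ / 3 * weightedNorm P (z i)) →
        lyapunovForm P ζ Y₂ z (fun i => A (z i) + K i (z i) - ν • ∑ j, 𝓛 i j • z j + Γ i)
          ≤ -(ρ / 4) * lyapunovForm P ζ Y₂ z z := by
  obtain ⟨cP, hcP, hequiv⟩ := exists_weightedNorm_equiv hP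
  obtain ⟨cΔ, hcΔ, hΔ⟩ := exists_blockInner_blockMatrixAction_ge (n := n) hP hΔP
  obtain ⟨cS, hcS, hS⟩ := (blockInner (n := n) M P).exists_abs_le_mul
  -- the deviation of the blocks from their average, in terms of the disagreement coordinates
  let dev : (Fin M → Fin n → ℝ) →ₗ[ℝ] (Fin N → Fin n → ℝ) :=
    LinearMap.pi fun i => ∑ k, Y₁ i k • LinearMap.proj k
  have hdev : ∀ z i, z i = blockAverage n ζ z + dev (blockDisagreement n Y₂ z) i := fun z i => by
    have e : dev (blockDisagreement n Y₂ z) i = ∑ k, Y₁ i k • blockDisagreement n Y₂ z k := by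
      simp [dev, LinearMap.sum_apply]
    rw [e]
    exact h.apply_eq z i
  obtain ⟨cD, hcD, hD⟩ := dev.exists_norm_le_mul
  obtain ⟨cY, hcY, hY⟩ := (blockDisagreement n Y₂).exists_norm_le_mul
  obtain ⟨cK, hcK, hK⟩ := ((∑ i, ζ i • (K i).comp (LinearMap.proj i)).comp dev :
    (Fin M → Fin n → ℝ) →ₗ[ℝ] (Fin n → ℝ)).exists_norm_le_mul
  let F : (Fin N → Fin n → ℝ) →ₗ[ℝ] (Fin N → Fin n → ℝ) :=
    LinearMap.pi fun i => (A + K i).comp (LinearMap.proj i)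
  obtain ⟨cF, hcF, hF⟩ := F.exists_norm_le_mul
  have hcP0 : 0 ≤ cP := by linarith
  -- the constant of the mixed terms
  set κ₁ : ℝ := cS * cY * (cF + cP * (ρ / 3) * cP) with hκ₁
  set κ : ℝ := cP * cK + ρ / 3 * (cP * cD) + κ₁ * (cP + cD) with hκ
  have hκ₁0 : 0 ≤ κ₁ := by positivity
  have hκ0 : 0 ≤ κ := by positivity
  refine ⟨(3 * κ ^ 2 / (4 * ρ) + κ + ρ / 4 * cS) / cΔ + 1, by positivity,
    fun ν hν hA z Γ hΓ => ?_⟩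
  set zb := blockAverage n ζ z with hzb
  set u := blockDisagreement n Y₂ z with hu
  set a := weightedNorm P zb with ha
  set b := ‖u‖ with hb
  have ha0 : 0 ≤ a := weightedNorm_nonneg _ _
  have hb0 : 0 ≤ b := norm_nonneg _
  have hzi : ∀ i, weightedNorm P (z i) ≤ a + cP * cD * b := fun i => by
    rw [hdev z i]
    refine (weightedNorm_add_le hP _ _).trans ?_
    gcongr
    refine (hequiv _).1.trans ?_
    rw [mul_assoc]
    gcongr
    exact (norm_le_pi_norm _ i).trans (hD u)
  have hzn : ‖z‖ ≤ cP * a + cD * b := by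
    refine (pi_norm_le_iff_of_nonneg (by positivity)).2 fun i => ?_
    rw [hdev z i]
    refine (norm_add_le _ _).trans (add_le_add (hequiv _).2 ?_)
    exact (norm_le_pi_norm _ i).trans (hD u)
  have hΓn : ‖Γ‖ ≤ cP * (ρ / 3) * cP * ‖z‖ := by
    refine (pi_norm_le_iff_of_nonneg (by positivity)).2 fun i => ?_
    calc ‖Γ i‖ ≤ cP * weightedNorm P (Γ i) := (hequiv _).2
      _ ≤ cP * (ρ / 3 * (cP * ‖z i‖)) := by
        gcongr
        refine (hΓ i).trans ?_
        gcongr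
        exact (hequiv _).1
      _ ≤ cP * (ρ / 3 * (cP * ‖z‖)) := by
        gcongr
        exact norm_le_pi_norm z i
      _ = _ := by ring
  have hsplit : (fun i => A (z i) + K i (z i) - ν • ∑ j, 𝓛 i j • z j + Γ i)
      = (F z + Γ) - ν • (fun i => ∑ j, 𝓛 i j • z j) := by
    funext i
    simp only [F, LinearMap.pi_apply, LinearMap.comp_apply, LinearMap.add_apply,
      LinearMap.proj_apply, Pi.add_apply, Pi.sub_apply, Pi.smul_apply]
    abel
  -- the coupling does not act on the average
  have havg : blockAverage n ζ ((F z + Γ) - ν • fun i => ∑ j, 𝓛 i j • z j)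
      = (A zb + ∑ i, ζ i • K i zb)
        + ((∑ i, ζ i • (K i).comp (LinearMap.proj i)).comp dev :
            (Fin M → Fin n → ℝ) →ₗ[ℝ] (Fin n → ℝ)) u
        + ∑ i, ζ i • Γ i := by
    rw [map_sub, map_smul, h.blockAverage_coupling, smul_zero, sub_zero, map_add,
      blockAverage_apply ζ Γ]
    congr 1
    have e1 : blockAverage n ζ (F z) = ∑ i, ζ i • A (z i) + ∑ i, ζ i • K i (z i) := by
      simp [blockAverage_apply, F, smul_add, Finset.sum_add_distrib]
    have e2 : ∑ i, ζ i • A (z i) = A zb := by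
      rw [hzb, blockAverage_apply, map_sum]
      simp only [map_smul]
    have e3 : ∑ i, ζ i • K i (z i) = ∑ i, ζ i • K i zb
        + ((∑ i, ζ i • (K i).comp (LinearMap.proj i)).comp dev :
            (Fin M → Fin n → ℝ) →ₗ[ℝ] (Fin n → ℝ)) u := by
      simp only [LinearMap.comp_apply, LinearMap.sum_apply, LinearMap.smul_apply,
        LinearMap.proj_apply]
      rw [← Finset.sum_add_distrib]
      refine Finset.sum_congr rfl fun i _ => ?_
      nth_rewrite 1 [hdev z i]
      rw [map_add, smul_add]
    rw [e1, e2, e3]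
    abel
  have t1 := hA zb
  have t2 : weightedInner P zb (((∑ i, ζ i • (K i).comp (LinearMap.proj i)).comp dev :
      (Fin M → Fin n → ℝ) →ₗ[ℝ] (Fin n → ℝ)) u) ≤ cP * cK * (a * b) := by
    refine (weightedInner_le_weightedNorm_mul hP _ _).trans ?_
    calc a * weightedNorm P _ ≤ a * (cP * (cK * b)) := by
          gcongr
          refine (hequiv _).1.trans ?_
          gcongr
          exact hK u
      _ = _ := by ring
  have t3 : weightedInner P zb (∑ i, ζ i • Γ i)
      ≤ ρ / 3 * a ^ 2 + ρ / 3 * (cP * cD) * (a * b) := by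
    rw [map_sum]
    calc ∑ i, weightedInner P zb (ζ i • Γ i)
        ≤ ∑ i, ζ i * (a * (ρ / 3 * (a + cP * cD * b))) := by
          refine Finset.sum_le_sum fun i _ => ?_
          rw [map_smul, smul_eq_mul]
          have hi := hζ i
          gcongr
          refine (weightedInner_le_weightedNorm_mul hP _ _).trans ?_
          gcongr
          refine (hΓ i).trans ?_
          gcongr
          exact hzi i
      _ = _ := by rw [← Finset.sum_mul, hsum]; ring
  -- on the disagreement the coupling acts as `Δ ⊗ I`
  have hdis : blockDisagreement n Y₂ ((F z + Γ) - ν • fun i => ∑ j, 𝓛 i j • z j)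
      = blockDisagreement n Y₂ (F z + Γ) - ν • blockMatrixAction n Δ u := by
    rw [map_sub, map_smul, h.blockDisagreement_coupling]
  have t4 : blockInner M P u (blockDisagreement n Y₂ (F z + Γ)) ≤ κ₁ * (cP + cD) * (a * b + b ^ 2)
      := by
    calc blockInner M P u (blockDisagreement n Y₂ (F z + Γ))
        ≤ cS * b * ‖blockDisagreement n Y₂ (F z + Γ)‖ := (le_abs_self _).trans (hS _ _)
      _ ≤ cS * b * (cY * (cF * ‖z‖ + cP * (ρ / 3) * cP * ‖z‖)) := by
        gcongr
        refine (hY _).trans ?_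
        gcongr
        exact (norm_add_le _ _).trans (add_le_add (hF z) hΓn)
      _ = κ₁ * (b * ‖z‖) := by rw [hκ₁]; ring
      _ ≤ κ₁ * (b * (cP * a + cD * b)) := by gcongr
      _ ≤ κ₁ * (cP + cD) * (a * b + b ^ 2) := by
        rw [mul_assoc κ₁]
        refine mul_le_mul_of_nonneg_left ?_ hκ₁0
        have h1 := mul_nonneg (mul_nonneg hcP0 hb0) hb0
        have h2 := mul_nonneg (mul_nonneg hcD ha0) hb0
        linarith only [h1, h2]
  have t5 := hΔ u
  have t6 : blockInner M P u u ≤ cS * b ^ 2 := by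
    refine (le_abs_self _).trans ((hS u u).trans (le_of_eq ?_))
    ring
  have haa : weightedInner P zb zb = a ^ 2 := (weightedNorm_sq hP zb).symm
  rw [hsplit, lyapunovForm_apply, lyapunovForm_apply, havg, hdis]
  rw [map_add (weightedInner P zb), map_add (weightedInner P zb), map_sub (blockInner M P u),
    map_smul (blockInner M P u), smul_eq_mul, haa]
  rw [haa] at t1
  have hν1 : 3 * κ ^ 2 / (4 * ρ) + κ + ρ / 4 * cS ≤ ν * cΔ := by
    rw [ge_iff_le, ← le_sub_iff_add_le, div_le_iff₀ hcΔ] at hν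
    linarith only [hν, hcΔ]
  have hν0 : 0 ≤ ν := le_trans (by positivity) hν
  have t5' : ν * (cΔ * b ^ 2) ≤ ν * blockInner M P u (blockMatrixAction n Δ u) := by gcongr
  have hν2 : (3 * κ ^ 2 / (4 * ρ) + κ + ρ / 4 * cS) * b ^ 2 ≤ ν * cΔ * b ^ 2 := by gcongr
  -- Young's inequality for the mixed term
  have hyoung : κ * (a * b) ≤ ρ / 3 * a ^ 2 + 3 * κ ^ 2 / (4 * ρ) * b ^ 2 := by
    have e : ρ / 3 * a ^ 2 + 3 * κ ^ 2 / (4 * ρ) * b ^ 2 - κ * (a * b)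
        = ρ / 3 * (a - 3 * κ / (2 * ρ) * b) ^ 2 := by
      field_simp
      ring
    have : 0 ≤ ρ / 3 * (a - 3 * κ / (2 * ρ) * b) ^ 2 := by positivity
    linarith only [e, this]
  have hmix : κ₁ * (cP + cD) * b ^ 2 ≤ κ * b ^ 2 := by
    gcongr
    rw [hκ]
    have : 0 ≤ cP * cK + ρ / 3 * (cP * cD) := by positivity
    linarith only [this]
  have e4 : κ * (a * b) = cP * cK * (a * b) + ρ / 3 * (cP * cD) * (a * b)
      + κ₁ * (cP + cD) * (a * b) := by rw [hκ]; ring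
  have t6' : ρ / 4 * blockInner M P u u ≤ ρ / 4 * (cS * b ^ 2) := by gcongr
  linarith only [t1, t2, t3, t4, t5', t6', hν2, hyoung, hmix, e4]

end Coordinates

/-! ### Dilations with generator near the identity -/

section NearIdentity

variable {ι : Type*} [Fintype ι] [DecidableEq ι]

/-- The constant `k` controls the distance of `exp (σ G₀)` and of `exp (σ (G₀ + 1))` from the
identity in the maximum norm. It is at least `1`, so that `|μ| k ≤ 1 / 4` also bounds `|μ|`. -/
structure IsExpBound (G₀ : Matrix ι ι ℝ) (k : ℝ) : Prop where
  one_le : 1 ≤ k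
  left : ∀ (σ : ℝ) (x : ι → ℝ),
    ‖NormedSpace.exp (σ • G₀) *ᵥ x - x‖ ≤ (Real.exp (k * |σ|) - 1) * ‖x‖
  right : ∀ (σ : ℝ) (x : ι → ℝ),
    ‖NormedSpace.exp (σ • (G₀ + 1)) *ᵥ x - x‖ ≤ (Real.exp (k * |σ|) - 1) * ‖x‖

theorem exists_isExpBound (G₀ : Matrix ι ι ℝ) : ∃ k, IsExpBound G₀ k := by
  obtain ⟨k₁, h₁, hk₁⟩ := exists_exp_smul_mulVec_bound G₀
  obtain ⟨k₂, h₂, hk₂⟩ := exists_exp_smul_mulVec_bound (G₀ + 1)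
  refine ⟨1 + k₁ + k₂, by linarith, fun σ x => (hk₁ σ x).trans ?_, fun σ x => (hk₂ σ x).trans ?_⟩
  · gcongr; linarith
  · gcongr; linarith

theorem exp_smul_add_one_mulVec (G₀ : Matrix ι ι ℝ) (σ : ℝ) (x : ι → ℝ) :
    NormedSpace.exp (σ • (G₀ + 1)) *ᵥ x
      = Real.exp σ • (NormedSpace.exp (σ • G₀) *ᵥ x) := by
  have := exp_smul_add_one G₀ σ 1 1
  rw [one_smul, one_smul, mul_one] at this
  rw [this, Matrix.smul_mulVec]

theorem dilation_dilationGenerator_mulVec {n : ℕ} (G₀ : Matrix (Fin n) (Fin n) ℝ) (μ s : ℝ)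
    (x : Fin n → ℝ) : dilation (dilationGenerator G₀ μ) s *ᵥ x
      = Real.exp s • (NormedSpace.exp ((μ * s) • G₀) *ᵥ x) := by
  have := exp_smul_add_one G₀ s μ 1
  rw [one_smul, mul_one] at this
  rw [dilation, dilationGenerator, this, Matrix.smul_mulVec, mul_comm s]

variable {n : ℕ} {G₀ : Matrix (Fin n) (Fin n) ℝ} {k μ : ℝ}

theorem norm_exp_smul_mulVec_le {K : Matrix (Fin n) (Fin n) ℝ}
    (hK : ∀ (σ : ℝ) (x : Fin n → ℝ),
      ‖NormedSpace.exp (σ • K) *ᵥ x - x‖ ≤ (Real.exp (k * |σ|) - 1) * ‖x‖)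
    (hμ : |μ| * k ≤ 1 / 4) (s : ℝ) (x : Fin n → ℝ) :
    ‖NormedSpace.exp ((μ * s) • K) *ᵥ x‖ ≤ Real.exp (|s| / 4) * ‖x‖ := by
  have h1 := hK (μ * s) x
  have h2 : ‖NormedSpace.exp ((μ * s) • K) *ᵥ x‖
      ≤ ‖NormedSpace.exp ((μ * s) • K) *ᵥ x - x‖ + ‖x‖ := by
    simpa using norm_add_le (NormedSpace.exp ((μ * s) • K) *ᵥ x - x) x
  have h3 : Real.exp (k * |μ * s|) ≤ Real.exp (|s| / 4) := by
    refine Real.exp_le_exp.2 ?_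
    rw [abs_mul]
    nlinarith [abs_nonneg s]
  nlinarith [norm_nonneg x]

theorem IsExpBound.norm_dilation_mulVec_le (h : IsExpBound G₀ k) (hμ : |μ| * k ≤ 1 / 4) (s : ℝ)
    (x : Fin n → ℝ) :
    ‖dilation (dilationGenerator G₀ μ) s *ᵥ x‖ ≤ Real.exp (s + |s| / 4) * ‖x‖ := by
  rw [dilation_dilationGenerator_mulVec, norm_smul, Real.norm_of_nonneg (Real.exp_pos s).le,
    Real.exp_add, mul_assoc]
  gcongr
  exact norm_exp_smul_mulVec_le h.left hμ s x

theorem IsExpBound.isMonotoneDilation (h : IsExpBound G₀ k) (hμ : |μ| * k ≤ 1 / 4)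
    {P : Matrix (Fin n) (Fin n) ℝ} (hP : P.PosDef)
    (hPG : (P * dilationGenerator G₀ μ + (dilationGenerator G₀ μ)ᵀ * P).PosDef) :
    IsMonotoneDilation (dilationGenerator G₀ μ) P where
  posDef := hP
  lyapunov := hPG
  contract s hs x := by
    refine (h.norm_dilation_mulVec_le hμ s x).trans ?_
    gcongr
    rw [abs_of_nonpos hs]
    linarith

/-- On bounded sets `ρ exp (μ ln ρ K)` is within `O(μ)` of `ρ`, uniformly as `ρ → 0`. -/
theorem norm_smul_exp_log_smul_sub_le {K : Matrix (Fin n) (Fin n) ℝ}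
    (hK : ∀ (σ : ℝ) (x : Fin n → ℝ),
      ‖NormedSpace.exp (σ • K) *ᵥ x - x‖ ≤ (Real.exp (k * |σ|) - 1) * ‖x‖)
    (hk : 0 ≤ k) (hμ : |μ| * k ≤ 1 / 4) {r R : ℝ} (hr : 0 < r) (hrR : r ≤ R) (w : Fin n → ℝ) :
    ‖r • (NormedSpace.exp ((μ * Real.log r) • K) *ᵥ w) - r • w‖
      ≤ (2 + R ^ 3) * k * |μ| * ‖w‖ := by
  rw [← smul_sub, norm_smul, Real.norm_of_nonneg hr.le]
  calc r * ‖NormedSpace.exp ((μ * Real.log r) • K) *ᵥ w - w‖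
      ≤ r * ((Real.exp (k * |μ * Real.log r|) - 1) * ‖w‖) := by gcongr; exact hK _ _
    _ = r * (Real.exp (|μ| * k * |Real.log r|) - 1) * ‖w‖ := by rw [abs_mul]; ring_nf
    _ ≤ (2 + R ^ 3) * (|μ| * k) * ‖w‖ := mul_le_mul_of_nonneg_right
      (mul_exp_abs_log_sub_one_le hr hrR (by positivity) (by linarith)) (norm_nonneg _)
    _ = _ := by ring

theorem norm_le_euclNorm {κ : Type*} [Fintype κ] (x : κ → ℝ) : ‖x‖ ≤ euclNorm x := by
  refine (pi_norm_le_iff_of_nonneg (norm_nonneg _)).2 fun i => ?_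
  exact PiLp.norm_apply_le (WithLp.toLp 2 x) i

theorem euclNorm_smul {κ : Type*} [Fintype κ] (c : ℝ) (x : κ → ℝ) :
    euclNorm (c • x) = |c| * euclNorm x := by
  rw [euclNorm, WithLp.toLp_smul, norm_smul, Real.norm_eq_abs, euclNorm]

theorem euclNorm_pos {κ : Type*} [Fintype κ] {x : κ → ℝ} (hx : x ≠ 0) : 0 < euclNorm x :=
  (norm_pos_iff.2 hx).trans_le (norm_le_euclNorm x)

theorem exists_euclNorm_le (κ : Type*) [Fintype κ] :
    ∃ c : ℝ, 0 ≤ c ∧ ∀ x : κ → ℝ, euclNorm x ≤ c * ‖x‖ :=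
  LinearMap.exists_norm_le_mul (WithLp.linearEquiv 2 ℝ (κ → ℝ)).symm.toLinearMap

/-- The nonlinear output injection is `O(μ + |q|)`-close to the linear one on bounded sets. -/
theorem IsExpBound.exists_injection_close (h : IsExpBound G₀ k) {κ : ℕ}
    (C : Matrix (Fin κ) (Fin n) ℝ) (H : Matrix (Fin n) (Fin κ) ℝ) (R₀ : ℝ) :
    ∃ c : ℝ, 0 ≤ c ∧ ∀ μ : ℝ, |μ| * k ≤ 1 / 4 → ∀ (z : Fin n → ℝ) (q : Fin κ → ℝ),
      ‖z‖ ≤ R₀ → ‖q‖ ≤ 1 →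
      ‖NormedSpace.exp ((μ * Real.log (euclNorm (C *ᵥ z - q))) • (G₀ + 1)) *ᵥ (H *ᵥ (C *ᵥ z - q))
        - H *ᵥ (C *ᵥ z)‖ ≤ c * (|μ| + ‖q‖) := by
  obtain ⟨cH, hcH, hH⟩ := (Matrix.mulVecLin H).exists_norm_le_mul
  obtain ⟨cC, hcC, hC⟩ := (Matrix.mulVecLin C).exists_norm_le_mul
  obtain ⟨cE, hcE, hE⟩ := exists_euclNorm_le (Fin κ)
  simp only [Matrix.mulVecLin_apply] at hH hC
  have hk := h.one_le
  set R := cE * (cC * |R₀| + 1) with hR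
  have hR0 : 0 ≤ R := by positivity
  refine ⟨(2 + R ^ 3) * k * cH + cH, by positivity, fun μ hμ z q hz hq => ?_⟩
  set ω := C *ᵥ z - q with hω
  have hωR : euclNorm ω ≤ R := by
    refine (hE ω).trans ?_
    rw [hR]
    gcongr
    refine (norm_sub_le _ _).trans (add_le_add ((hC z).trans ?_) hq)
    gcongr
    exact hz.trans (le_abs_self _)
  have hclose : ‖NormedSpace.exp ((μ * Real.log (euclNorm ω)) • (G₀ + 1)) *ᵥ (H *ᵥ ω) - H *ᵥ ω‖
      ≤ (2 + R ^ 3) * k * |μ| * cH := by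
    rcases eq_or_ne ω 0 with h0 | h0
    · rw [h0, Matrix.mulVec_zero, Matrix.mulVec_zero, sub_zero, norm_zero]
      positivity
    · have hp := euclNorm_pos h0
      have e1 : H *ᵥ ω = euclNorm ω • (H *ᵥ ((euclNorm ω)⁻¹ • ω)) := by
        rw [Matrix.mulVec_smul, smul_smul, mul_inv_cancel₀ hp.ne', one_smul]
      have hw : ‖H *ᵥ ((euclNorm ω)⁻¹ • ω)‖ ≤ cH := by
        refine (hH _).trans ?_
        rw [norm_smul, Real.norm_of_nonneg (by positivity), inv_mul_eq_div]
        exact mul_le_of_le_one_right hcH ((div_le_one hp).2 (norm_le_euclNorm ω))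
      rw [e1, Matrix.mulVec_smul]
      refine (norm_smul_exp_log_smul_sub_le h.right (by linarith) hμ hp hωR _).trans ?_
      gcongr
  have e2 : H *ᵥ (C *ᵥ z) = H *ᵥ ω + H *ᵥ q := by
    rw [← Matrix.mulVec_add, hω, sub_add_cancel]
  rw [e2, ← sub_sub]
  refine (norm_sub_le _ _).trans ((add_le_add hclose (hH q)).trans ?_)
  have h1 : 0 ≤ (2 + R ^ 3) * k * cH * ‖q‖ := by positivity
  have h2 : 0 ≤ cH * |μ| := by positivity
  linarith only [h1, h2]

variable {P : Matrix (Fin n) (Fin n) ℝ}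

/-- Polar decomposition with respect to the dilation. -/
theorem IsMonotoneDilation.eq_smul_exp (h : IsMonotoneDilation (dilationGenerator G₀ μ) P)
    {z : Fin n → ℝ} (hz : z ≠ 0) : ∃ w : Fin n → ℝ, weightedNorm P w = 1 ∧
      z = homNorm (dilationGenerator G₀ μ) P z •
        (NormedSpace.exp ((μ * Real.log (homNorm (dilationGenerator G₀ μ) P z)) • G₀) *ᵥ w) := by
  refine ⟨_, h.weightedNorm_homNorm hz, ?_⟩
  have := dilation_neg_mulVec_cancel (dilationGenerator G₀ μ)
    (Real.log (homNorm (dilationGenerator G₀ μ) P z)) z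
  rw [dilation_dilationGenerator_mulVec, Real.exp_log (homNorm_pos _ _ hz)] at this
  exact this.symm

theorem IsMonotoneDilation.homNorm_le {G P : Matrix (Fin n) (Fin n) ℝ}
    (h : IsMonotoneDilation G P) {c R₀ : ℝ} (hc : 0 ≤ c)
    (hle : ∀ x, weightedNorm P x ≤ c * ‖x‖) {z : Fin n → ℝ} (hz : ‖z‖ ≤ R₀) :
    homNorm G P z ≤ 1 + (c * R₀) ^ 2 := by
  rcases eq_or_ne z 0 with rfl | hz0
  · rw [homNorm_zero]; positivity
  · set r := homNorm G P z with hr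
    have hr0 : 0 < r := homNorm_pos G P hz0
    rcases le_total r 1 with h1 | h1
    · nlinarith [sq_nonneg (c * R₀)]
    · have h2 := h.weightedNorm_homNorm hz0
      have h3 := h.contract (-Real.log r) (by linarith [Real.log_nonneg h1]) z
      have h4 : 1 ≤ c * (Real.exp (-Real.log r / 2) * R₀) := by
        rw [← h2]
        refine (hle _).trans ?_
        gcongr
        exact h3.trans (by gcongr)
      have h5 : Real.exp (-Real.log r / 2) ^ 2 * r = 1 := by
        nth_rewrite 2 [← Real.exp_log hr0]
        rw [← Real.exp_nat_mul, ← Real.exp_add]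
        push_cast
        ring_nf
        simp
      have h6 : 1 ≤ (c * (Real.exp (-Real.log r / 2) * R₀)) ^ 2 := one_le_pow₀ h4
      calc r ≤ (c * (Real.exp (-Real.log r / 2) * R₀)) ^ 2 * r := by nlinarith
        _ = (c * R₀) ^ 2 * (Real.exp (-Real.log r / 2) ^ 2 * r) := by ring
        _ ≤ _ := by rw [h5]; linarith

/-- The nonlinear coupling `‖θ‖_𝐝 ^ μ θ` is `O(μ)`-close to `θ` on bounded sets. -/
theorem IsExpBound.exists_coupling_close (h : IsExpBound G₀ k) (hP : P.PosDef) (R₀ : ℝ) :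
    ∃ c : ℝ, 0 ≤ c ∧ ∀ μ : ℝ, |μ| * k ≤ 1 / 4 →
      IsMonotoneDilation (dilationGenerator G₀ μ) P → ∀ θ : Fin n → ℝ, ‖θ‖ ≤ R₀ →
      ‖homNorm (dilationGenerator G₀ μ) P θ ^ μ • θ - θ‖ ≤ c * |μ| := by
  obtain ⟨cP, hcP, hequiv⟩ := exists_weightedNorm_equiv hP
  have hk := h.one_le
  set R := 1 + (cP * R₀) ^ 2 with hR
  refine ⟨2 * ((2 + R ^ 3) * k * cP), by positivity, fun μ hμ hmon θ hθ => ?_⟩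
  rcases eq_or_ne θ 0 with rfl | h0
  · simp only [smul_zero, sub_zero, norm_zero]; positivity
  · obtain ⟨w, hw, hdec⟩ := hmon.eq_smul_exp h0
    have hrR := hmon.homNorm_le (by linarith) (fun x => (hequiv x).1) hθ
    set r := homNorm (dilationGenerator G₀ μ) P θ with hr
    have hr0 : 0 < r := homNorm_pos _ _ h0
    have hwn : ‖w‖ ≤ cP := by simpa [hw] using (hequiv w).2
    have e1 : r ^ μ • θ = r • (NormedSpace.exp ((μ * Real.log r) • (G₀ + 1)) *ᵥ w) := by
      nth_rewrite 1 [hdec]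
      rw [exp_smul_add_one_mulVec, Real.rpow_def_of_pos hr0, smul_comm, mul_comm μ]
    have h1 := norm_smul_exp_log_smul_sub_le h.right (by linarith) hμ hr0 hrR w
    have h2 := norm_smul_exp_log_smul_sub_le h.left (by linarith) hμ hr0 hrR w
    rw [← e1] at h1
    rw [← hdec] at h2
    calc ‖r ^ μ • θ - θ‖ = ‖(r ^ μ • θ - r • w) - (θ - r • w)‖ := by congr 1; abel
      _ ≤ (2 + R ^ 3) * k * |μ| * ‖w‖ + (2 + R ^ 3) * k * |μ| * ‖w‖ :=
        (norm_sub_le _ _).trans (add_le_add h1 h2)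
      _ ≤ (2 + R ^ 3) * k * |μ| * cP + (2 + R ^ 3) * k * |μ| * cP := by gcongr
      _ = _ := by ring

/-- After rescaling, a nonlinearity obeying the homogeneous growth bound is `O(μ)`-close, on
bounded sets, to a vector of weighted norm at most `τ ‖z‖_P`. -/
theorem IsExpBound.exists_growth_close (h : IsExpBound G₀ k) (hP : P.PosDef) (R₀ T : ℝ) :
    ∃ c : ℝ, 0 ≤ c ∧ ∀ μ : ℝ, |μ| * k ≤ 1 / 4 →
      IsMonotoneDilation (dilationGenerator G₀ μ) P → ∀ τ, 0 ≤ τ → τ ≤ T →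
      ∀ (z Γ : Fin n → ℝ) (v : ℝ), ‖z‖ ≤ R₀ → 0 < v → (z = 0 → Γ = 0) →
      (z ≠ 0 → weightedNorm P (dilation (dilationGenerator G₀ μ)
          (-Real.log (v * homNorm (dilationGenerator G₀ μ) P z)) *ᵥ Γ)
        ≤ τ * (v * homNorm (dilationGenerator G₀ μ) P z) ^ μ) →
      ∃ Γ₁ : Fin n → ℝ, weightedNorm P Γ₁ ≤ τ * weightedNorm P z ∧
        ‖v ^ (-μ) • (dilation (dilationGenerator G₀ μ) (-Real.log v) *ᵥ Γ) - Γ₁‖ ≤ c * |μ| := by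
  obtain ⟨cP, hcP, hequiv⟩ := exists_weightedNorm_equiv hP
  have hk := h.one_le
  set R := 1 + (cP * R₀) ^ 2 with hR
  set d := (2 + R ^ 3) * k * (cP * |T|) + cP * ((2 + R ^ 3) * k * cP) * (cP * |T|) with hd
  refine ⟨d, by positivity, fun μ hμ hmon τ hτ hτT z Γ v hz hv hz0 hΓ => ?_⟩
  rcases eq_or_ne z 0 with h0 | h0
  · refine ⟨0, by simp [h0], ?_⟩
    rw [hz0 h0, Matrix.mulVec_zero, smul_zero, sub_zero, norm_zero]
    positivity
  · obtain ⟨w, hw, hdec⟩ := hmon.eq_smul_exp h0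
    have hrR := hmon.homNorm_le (by linarith) (fun x => (hequiv x).1) hz
    specialize hΓ h0
    set r := homNorm (dilationGenerator G₀ μ) P z with hr
    have hr0 : 0 < r := homNorm_pos _ _ h0
    have hvr : 0 < v * r := by positivity
    have hwn : ‖w‖ ≤ cP := by simpa [hw] using (hequiv w).2
    -- the increment, normalized at the homogeneous norm of the error
    set u := (v * r) ^ (-μ) • (dilation (dilationGenerator G₀ μ) (-Real.log (v * r)) *ᵥ Γ) with hu
    have huτ : weightedNorm P u ≤ τ := by
      rw [hu, weightedNorm_smul, abs_of_pos (Real.rpow_pos_of_pos hvr _)]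
      calc (v * r) ^ (-μ) * _ ≤ (v * r) ^ (-μ) * (τ * (v * r) ^ μ) := by gcongr
        _ = τ := by
          rw [Real.rpow_neg hvr.le]
          have := (Real.rpow_pos_of_pos hvr μ).ne'
          field_simp
    have hun : ‖u‖ ≤ cP * |T| := by
      refine (hequiv u).2.trans ?_
      gcongr
      exact huτ.trans (hτT.trans (le_abs_self T))
    have e1 : v ^ (-μ) • (dilation (dilationGenerator G₀ μ) (-Real.log v) *ᵥ Γ)
        = r • (NormedSpace.exp ((μ * Real.log r) • (G₀ + 1)) *ᵥ u) := by
      have e2 : -Real.log v = Real.log r + -Real.log (v * r) := by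
        rw [Real.log_mul hv.ne' hr0.ne']; ring
      rw [e2, dilation_add_mulVec, hu, exp_smul_add_one_mulVec,
        dilation_dilationGenerator_mulVec G₀ μ (Real.log r), Real.exp_log hr0,
        Matrix.mulVec_smul, smul_smul, smul_smul, smul_smul]
      congr 1
      rw [Real.mul_rpow hv.le hr0.le, mul_comm μ, ← Real.rpow_def_of_pos hr0, Real.rpow_neg hr0.le]
      have := (Real.rpow_pos_of_pos hr0 μ).ne'
      field_simp
    refine ⟨weightedNorm P z • u, ?_, ?_⟩
    · rw [weightedNorm_smul, abs_of_nonneg (weightedNorm_nonneg _ _), mul_comm]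
      gcongr
      exact weightedNorm_nonneg _ _
    · have h1 := norm_smul_exp_log_smul_sub_le h.right (by linarith) hμ hr0 hrR u
      have h2 := norm_smul_exp_log_smul_sub_le h.left (by linarith) hμ hr0 hrR w
      rw [← e1] at h1
      rw [← hdec] at h2
      have hzr : |r - weightedNorm P z| ≤ cP * ((2 + R ^ 3) * k * |μ| * cP) := by
        have h3 : weightedNorm P (z - r • w) ≤ cP * ((2 + R ^ 3) * k * |μ| * cP) := by
          refine (hequiv _).1.trans ?_
          gcongr
          exact h2.trans (by gcongr)
        have h4 : weightedNorm P (r • w) = r := by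
          rw [weightedNorm_smul, hw, abs_of_pos hr0, mul_one]
        have h5 := weightedNorm_add_le hP (z - r • w) (r • w)
        have h6 := weightedNorm_add_le hP (-(z - r • w)) z
        have h7 : weightedNorm P (-(z - r • w)) = weightedNorm P (z - r • w) := by
          simpa using weightedNorm_smul P (-1) (z - r • w)
        rw [h7, show -(z - r • w) + z = r • w by abel, h4] at h6
        rw [sub_add_cancel, h4] at h5
        rw [abs_le]
        constructor <;> linarith
      calc ‖v ^ (-μ) • (dilation (dilationGenerator G₀ μ) (-Real.log v) *ᵥ Γ)
            - weightedNorm P z • u‖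
          = ‖(v ^ (-μ) • (dilation (dilationGenerator G₀ μ) (-Real.log v) *ᵥ Γ) - r • u)
              + (r - weightedNorm P z) • u‖ := by congr 1; rw [sub_smul]; abel
        _ ≤ (2 + R ^ 3) * k * |μ| * ‖u‖ + |r - weightedNorm P z| * ‖u‖ := by
          refine (norm_add_le _ _).trans (add_le_add h1 ?_)
          rw [norm_smul, Real.norm_eq_abs]
        _ ≤ (2 + R ^ 3) * k * |μ| * (cP * |T|)
            + cP * ((2 + R ^ 3) * k * |μ| * cP) * (cP * |T|) := by gcongr
        _ = d * |μ| := by rw [hd]; ring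

end NearIdentity

/-! ### Homogeneity of the error field -/

section Homogeneity

variable {N n : ℕ} {p : Fin N → ℕ} {A : Matrix (Fin n) (Fin n) ℝ}
  {C : ∀ i, Matrix (Fin (p i)) (Fin n) ℝ} {G₀ Pa : Matrix (Fin n) (Fin n) ℝ}

/-- If `L₀ = 0` the homogenizing equation says that `A` is homogeneous with respect to `G₀`. -/
theorem IsHomogenizingPair.commutator_eq {κ : Type*} [Fintype κ] {C : Matrix κ (Fin n) ℝ}
    {Y₀ : Matrix (Fin n) κ ℝ} (h : IsHomogenizingPair A C Y₀ G₀) (hL : injectionGain G₀ Y₀ = 0) :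
    A * G₀ = (G₀ + 1) * A := by
  have hdet : IsUnit (1 + G₀).det := (Matrix.isUnit_iff_isUnit_det _).1 h.isUnit
  have hY : Y₀ = 0 := by
    have := congrArg ((1 + G₀) * ·) hL
    simpa [injectionGain, ← Matrix.mul_assoc, Matrix.mul_nonsing_inv _ hdet] using this
  have h1 := h.eq_A
  rw [hY, Matrix.zero_mul, sub_zero, sub_eq_iff_eq_add] at h1
  rw [h1, Matrix.add_mul, Matrix.one_mul, add_comm]

theorem mul_eq_zero_of_stackedOutput_mul_eq_zero (h : stackedOutput C * G₀ = 0) (i : Fin N) :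
    C i * G₀ = 0 := by
  ext a b
  exact congrFun (congrFun h ⟨i, a⟩) b

theorem mulVec_dilation (hA : A * G₀ = (G₀ + 1) * A) (μ s : ℝ) (x : Fin n → ℝ) :
    A *ᵥ (dilation (dilationGenerator G₀ μ) s *ᵥ x)
      = Real.exp (μ * s) • (dilation (dilationGenerator G₀ μ) s *ᵥ (A *ᵥ x)) := by
  have h := mul_exp_smul_of_intertwine A G₀ (G₀ + 1) hA (μ * s)
  rw [dilation_dilationGenerator_mulVec, dilation_dilationGenerator_mulVec, Matrix.mulVec_smul,
    Matrix.mulVec_mulVec, h, ← Matrix.mulVec_mulVec, exp_smul_add_one_mulVec, smul_comm]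

theorem mulVec_dilation_of_mul_eq_zero {κ : Type*} [Fintype κ] [DecidableEq κ]
    {C : Matrix κ (Fin n) ℝ} (hC : C * G₀ = 0) (μ s : ℝ) (x : Fin n → ℝ) :
    C *ᵥ (dilation (dilationGenerator G₀ μ) s *ᵥ x) = Real.exp s • (C *ᵥ x) := by
  have h := mul_exp_smul_of_intertwine C G₀ 0 (by rw [hC, Matrix.zero_mul]) (μ * s)
  rw [smul_zero, NormedSpace.exp_zero, Matrix.one_mul] at h
  rw [dilation_dilationGenerator_mulVec, Matrix.mulVec_smul, Matrix.mulVec_mulVec, h]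

/-- The error field is homogeneous of degree `μ` up to a rescaling of the measurement noise, of the
increment of the nonlinearity, and of the disturbance. -/
theorem dilation_neg_mulVec_errorField (hA : A * G₀ = (G₀ + 1) * A) (hC : ∀ i, C i * G₀ = 0)
    {μ : ℝ} (hmon : IsMonotoneDilation (dilationGenerator G₀ μ) Pa)
    (H : ∀ i, Matrix (Fin n) (Fin (p i)) ℝ) (𝓛 : Matrix (Fin N) (Fin N) ℝ) (ν : ℝ)
    (γ : ℝ → (Fin n → ℝ) → Fin n → ℝ) (x : ℝ → Fin n → ℝ) (qx : ℝ → Fin n → ℝ)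
    (qy : ℝ → ∀ i, Fin (p i) → ℝ) (t : ℝ) {v : ℝ} (hv : 0 < v) (z : Fin N → Fin n → ℝ)
    (i : Fin N) :
    dilation (dilationGenerator G₀ μ) (-Real.log v) *ᵥ
        errorField A C G₀ Pa H 𝓛 ν μ γ x qx qy t
          (fun i => dilation (dilationGenerator G₀ μ) (Real.log v) *ᵥ z i) i
      = v ^ μ • (A *ᵥ z i
        + NormedSpace.exp ((μ * Real.log (euclNorm (C i *ᵥ z i - v⁻¹ • qy t i))) • (G₀ + 1)) *ᵥ
            (H i *ᵥ (C i *ᵥ z i - v⁻¹ • qy t i))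
        + (ν * homNorm (dilationGenerator G₀ μ) Pa (-∑ j, 𝓛 i j • z j) ^ μ) • (-∑ j, 𝓛 i j • z j)
        + v ^ (-μ) • (dilation (dilationGenerator G₀ μ) (-Real.log v) *ᵥ
            (γ t (x t + dilation (dilationGenerator G₀ μ) (Real.log v) *ᵥ z i) - γ t (x t)))
        - v ^ (-μ) • (dilation (dilationGenerator G₀ μ) (-Real.log v) *ᵥ qx t)) := by
  set G := dilationGenerator G₀ μ with hG
  set s := Real.log v with hs
  have hvμ : Real.exp (μ * s) = v ^ μ := by rw [Real.rpow_def_of_pos hv, mul_comm]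
  have hexp : Real.exp s = v := Real.exp_log hv
  have hcancel : v ^ μ * v ^ (-μ) = 1 := by
    rw [← Real.rpow_add hv]; simp
  have hω : C i *ᵥ (dilation G s *ᵥ z i) - qy t i = v • (C i *ᵥ z i - v⁻¹ • qy t i) := by
    rw [mulVec_dilation_of_mul_eq_zero (hC i), hexp, smul_sub, smul_smul, mul_inv_cancel₀ hv.ne',
      one_smul]
  have hθ : -∑ j, 𝓛 i j • (dilation G s *ᵥ z j) = dilation G s *ᵥ (-∑ j, 𝓛 i j • z j) := by
    simp only [Matrix.mulVec_neg, Matrix.mulVec_sum, Matrix.mulVec_smul]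
  have h1 : dilation G (-s) *ᵥ (A *ᵥ (dilation G s *ᵥ z i)) = v ^ μ • (A *ᵥ z i) := by
    rw [hG, mulVec_dilation hA, Matrix.mulVec_smul, dilation_mulVec_neg_cancel, hvμ]
  have h2 : ∀ ω : Fin (p i) → ℝ, dilation G (-s) *ᵥ
      (NormedSpace.exp ((μ * Real.log (euclNorm (v • ω))) • (G₀ + 1)) *ᵥ (H i *ᵥ (v • ω)))
      = v ^ μ • (NormedSpace.exp ((μ * Real.log (euclNorm ω)) • (G₀ + 1)) *ᵥ (H i *ᵥ ω)) := by
    intro ω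
    rcases eq_or_ne ω 0 with rfl | hω0
    · simp
    · rw [euclNorm_smul, abs_of_pos hv, Real.log_mul hv.ne' (euclNorm_pos hω0).ne', ← hs,
        exp_smul_add_one_mulVec, exp_smul_add_one_mulVec, hG, dilation_dilationGenerator_mulVec,
        Matrix.mulVec_smul, Matrix.mulVec_smul, Matrix.mulVec_smul, Matrix.mulVec_smul,
        ← exp_add_smul_mulVec, smul_smul, smul_smul, smul_smul]
      have e1 : μ * -s + μ * (s + Real.log (euclNorm ω)) = μ * Real.log (euclNorm ω) := by ring
      rw [e1, mul_add, Real.exp_add, Real.exp_neg, hvμ, hexp]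
      congr 1
      field_simp
  have h3 : ∀ θ : Fin n → ℝ, dilation G (-s) *ᵥ
      ((ν * homNorm G Pa (dilation G s *ᵥ θ) ^ μ) • (dilation G s *ᵥ θ))
      = v ^ μ • ((ν * homNorm G Pa θ ^ μ) • θ) := by
    intro θ
    rw [Matrix.mulVec_smul, dilation_mulVec_neg_cancel, hmon.homNorm_dilation, hexp,
      Real.mul_rpow hv.le (homNorm_nonneg _ _ _), smul_smul]
    congr 1
    ring
  have h4 : ∀ ξ : Fin n → ℝ, ξ = v ^ μ • (v ^ (-μ) • ξ) := fun ξ => by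
    rw [smul_smul, hcancel, one_smul]
  simp only [errorField]
  rw [hω, hθ, Matrix.mulVec_sub, Matrix.mulVec_add, Matrix.mulVec_add, Matrix.mulVec_add, h1, h2,
    h3]
  simp only [smul_add, smul_sub]
  rw [← h4, ← h4]

end Homogeneity

/-! ### The dissipation inequality -/

section Dissipation

variable {N n : ℕ} {p : Fin N → ℕ} {A : Matrix (Fin n) (Fin n) ℝ}
  {C : ∀ i, Matrix (Fin (p i)) (Fin n) ℝ} {G₀ Pa : Matrix (Fin n) (Fin n) ℝ}
  {Y : Matrix (Fin n) (Σ i, Fin (p i)) ℝ} {ζ : Fin N → ℝ} {𝓛 : Matrix (Fin N) (Fin N) ℝ} {M : ℕ}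
  {Y₁ Y₂ : Matrix (Fin N) (Fin M) ℝ} {Δ : Matrix (Fin M) (Fin M) ℝ} {ρ k : ℝ}

theorem sum_smul_observerGain_mulVec (hζ : ∀ i, ζ i ≠ 0) (x : Fin n → ℝ) :
    ∑ i, ζ i • (observerGain Pa Y ζ i *ᵥ (C i *ᵥ x)) = Pa⁻¹ *ᵥ (Y *ᵥ (stackedOutput C *ᵥ x)) := by
  funext a
  rw [Matrix.mulVec_mulVec, Finset.sum_apply]
  rw [Matrix.mulVec, dotProduct, Fintype.sum_sigma]
  refine Finset.sum_congr rfl fun i _ => ?_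
  simp only [Pi.smul_apply, smul_eq_mul, Matrix.mulVec, dotProduct, Finset.mul_sum, observerGain,
    Matrix.of_apply, stackedOutput]
  refine Finset.sum_congr rfl fun b _ => Finset.sum_congr rfl fun c _ => ?_
  have := hζ i
  field_simp

/-- The matrix inequality, read as a dissipation inequality for the averaged error. -/
theorem SatisfiesLMI.weightedInner_le {κ : Type*} [Fintype κ] {C : Matrix κ (Fin n) ℝ}
    {Y : Matrix (Fin n) κ ℝ} {μ : ℝ} (hPa : Pa.PosDef)
    (h : SatisfiesLMI A C (dilationGenerator G₀ μ) Pa Y ρ) (x : Fin n → ℝ) :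
    weightedInner Pa x (A *ᵥ x + Pa⁻¹ *ᵥ (Y *ᵥ (C *ᵥ x)))
      ≤ -ρ * (weightedInner Pa x x + μ * weightedInner Pa x (G₀ *ᵥ x)) := by
  have hdet : IsUnit Pa.det := (Matrix.isUnit_iff_isUnit_det _).1 hPa.isUnit
  have hflip : ∀ Q : Matrix (Fin n) (Fin n) ℝ, x ⬝ᵥ (Qᵀ *ᵥ x) = x ⬝ᵥ (Q *ᵥ x) := fun Q => by
    rw [Matrix.mulVec_transpose, dotProduct_comm, ← Matrix.dotProduct_mulVec]
  have h1 := h.2.posSemidef.dotProduct_mulVec_nonneg x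
  rw [star_trivial] at h1
  have e1 : Aᵀ * Pa = (Pa * A)ᵀ := by rw [Matrix.transpose_mul, hPa.transpose_eq]
  have e2 : Cᵀ * Yᵀ = (Y * C)ᵀ := by rw [Matrix.transpose_mul]
  have e3 : (dilationGenerator G₀ μ)ᵀ * Pa = (Pa * dilationGenerator G₀ μ)ᵀ := by
    rw [Matrix.transpose_mul, hPa.transpose_eq]
  have e4 : x ⬝ᵥ ((Pa * dilationGenerator G₀ μ) *ᵥ x)
      = weightedInner Pa x x + μ * weightedInner Pa x (G₀ *ᵥ x) := by
    rw [← Matrix.mulVec_mulVec, ← weightedInner_apply, dilationGenerator, Matrix.add_mulVec,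
      Matrix.smul_mulVec, Matrix.one_mulVec, map_add, map_smul, smul_eq_mul, add_comm]
  have e5 : weightedInner Pa x (Pa⁻¹ *ᵥ (Y *ᵥ (C *ᵥ x))) = x ⬝ᵥ ((Y * C) *ᵥ x) := by
    rw [weightedInner_apply, Matrix.mulVec_mulVec, Matrix.mul_nonsing_inv _ hdet, Matrix.one_mulVec,
      Matrix.mulVec_mulVec]
  have e6 : weightedInner Pa x (A *ᵥ x) = x ⬝ᵥ ((Pa * A) *ᵥ x) := by
    rw [weightedInner_apply, Matrix.mulVec_mulVec]
  rw [e1, e2, e3] at h1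
  simp only [Matrix.neg_mulVec, Matrix.add_mulVec, Matrix.smul_mulVec, dotProduct_neg,
    dotProduct_add, dotProduct_smul, hflip, smul_eq_mul, e4] at h1
  rw [map_add, e5, e6]
  linarith

/-- **Dissipation.** For large `ν` and small `μ` the Lyapunov form of the rescaled error field is
uniformly negative on the shell `1 ≤ Q ≤ 4` if the rescaled disturbances are small. -/
theorem IsReductionPair.exists_dissipation (hred : IsReductionPair ζ Y₁ Y₂ 𝓛 Δ) (hN : 0 < N)
    (hζ : ∀ i, 0 < ζ i) (hsum : ∑ i, ζ i = 1) (hPa : Pa.PosDef)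
    (hΔP : ((Δᵀ + Δ) ⊗ₖ Pa).PosDef) (hρ : 0 < ρ) (hk : IsExpBound G₀ k)
    (hA : A * G₀ = (G₀ + 1) * A) (hC : ∀ i, C i * G₀ = 0) :
    ∃ ν₀ : ℝ, 0 < ν₀ ∧ ∀ ν ≥ ν₀, ∃ ε : ℝ, 0 < ε ∧ ∃ δ : ℝ, 0 < δ ∧ ∀ μ : ℝ, |μ| < ε →
      SatisfiesLMI A (stackedOutput C) (dilationGenerator G₀ μ) Pa Y ρ →
      |μ| * k ≤ 1 / 4 ∧ IsMonotoneDilation (dilationGenerator G₀ μ) Pa ∧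
      ∀ τ : ℝ, 0 < τ → τ < ρ / 3 → ∀ γ : ℝ → (Fin n → ℝ) → Fin n → ℝ,
        SatisfiesGrowth N (dilationGenerator G₀ μ) Pa μ τ γ →
        ∀ (x : ℝ → Fin n → ℝ) (qx : ℝ → Fin n → ℝ) (qy : ℝ → ∀ i, Fin (p i) → ℝ) (t v : ℝ)
          (z : Fin N → Fin n → ℝ), 0 < t → 0 < v →
          1 ≤ lyapunovForm Pa ζ Y₂ z z → lyapunovForm Pa ζ Y₂ z z ≤ 4 →
          (∀ i, ‖qy t i‖ ≤ δ * v) →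
          v ^ (-μ) * ‖dilation (dilationGenerator G₀ μ) (-Real.log v) *ᵥ qx t‖ ≤ δ →
          lyapunovForm Pa ζ Y₂ z (fun i => dilation (dilationGenerator G₀ μ) (-Real.log v) *ᵥ
            errorField A C G₀ Pa (observerGain Pa Y ζ) 𝓛 ν μ γ x qx qy t
              (fun i => dilation (dilationGenerator G₀ μ) (Real.log v) *ᵥ z i) i)
            ≤ -(ρ / 8) * v ^ μ := by
  obtain ⟨ν₀, hν₀, hgain⟩ := hred.exists_couplingGain hPa hΔP hζ hsum hρ (Matrix.mulVecLin A)
    fun i => (Matrix.mulVecLin (observerGain Pa Y ζ i)).comp (Matrix.mulVecLin (C i))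
  refine ⟨ν₀, hν₀, fun ν hν => ?_⟩
  have hν0 : 0 < ν := hν₀.trans_le hν
  have hk1 := hk.one_le
  obtain ⟨cQ, hcQ, hQ⟩ := (lyapunovForm Pa ζ Y₂).exists_sq_norm_le
    fun z hz => hred.lyapunovForm_self_pos hPa hz
  obtain ⟨cL, hcL, hL⟩ := (lyapunovForm Pa ζ Y₂).exists_abs_le_mul
  obtain ⟨cP, hcP, hequiv⟩ := exists_weightedNorm_equiv hPa
  obtain ⟨cG, hcG, hG⟩ := LinearMap.BilinForm.exists_abs_le_mul
    ((weightedInner Pa).compl₁₂ LinearMap.id (Matrix.mulVecLin G₀))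
  obtain ⟨cθ, hcθ, hθ⟩ := (blockMatrixAction n 𝓛).exists_norm_le_mul
  set R₀ : ℝ := 1 + 4 / cQ with hR₀
  have hR₀pos : 0 < R₀ := by positivity
  have hinj := fun i => hk.exists_injection_close (C i) (observerGain Pa Y ζ i) R₀
  choose cI hcI hI using hinj
  obtain ⟨cC, hcC, hCpl⟩ := hk.exists_coupling_close hPa (cθ * R₀)
  obtain ⟨cΓ, hcΓ, hΓ⟩ := hk.exists_growth_close hPa R₀ (ρ / 3)
  set c : ℝ := ∑ i, cI i + ν * cC + cΓ + 1 with hc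
  have hcI0 : 0 ≤ ∑ i, cI i := Finset.sum_nonneg fun i _ => hcI i
  have hc1 : 1 ≤ c := by
    have : 0 ≤ ν * cC := by positivity
    linarith
  set κ : ℝ := 16 * (cL * R₀ * c + 1) with hκ
  have hκ0 : 0 < κ := by positivity
  refine ⟨min (1 / (4 * k)) (min (1 / (12 * (cG * cP ^ 2 + 1))) (ρ / κ)), by positivity,
    min 1 (ρ / κ), by positivity, fun μ hμ hLMI => ?_⟩
  have hμ1 : |μ| * k ≤ 1 / 4 := by
    have h1 := (hμ.trans_le (min_le_left _ _)).le
    rw [le_div_iff₀ (by positivity)] at h1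
    linarith
  have hμ2 : |μ| * (cG * cP ^ 2) ≤ 1 / 12 := by
    have h1 := (hμ.trans_le ((min_le_right _ _).trans (min_le_left _ _))).le
    rw [le_div_iff₀ (by positivity)] at h1
    nlinarith [abs_nonneg μ]
  have hμ3 : |μ| ≤ ρ / κ := (hμ.trans_le ((min_le_right _ _).trans (min_le_right _ _))).le
  have hmon := hk.isMonotoneDilation hμ1 hPa hLMI.1
  refine ⟨hμ1, hmon, fun τ hτ hτρ γ hγ x qx qy t v z ht hv hz1 hz4 hqy hqx => ?_⟩
  have hlin : ∀ x, weightedInner Pa x (Matrix.mulVecLin A x + ∑ i, ζ i •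
      ((Matrix.mulVecLin (observerGain Pa Y ζ i)).comp (Matrix.mulVecLin (C i))) x)
      ≤ -(11 / 12 * ρ) * weightedInner Pa x x := by
    intro x
    simp only [LinearMap.comp_apply, Matrix.mulVecLin_apply]
    rw [sum_smul_observerGain_mulVec fun i => (hζ i).ne']
    refine (hLMI.weightedInner_le hPa x).trans ?_
    have h1 : |weightedInner Pa x (G₀ *ᵥ x)| ≤ cG * cP ^ 2 * weightedInner Pa x x := by
      refine (hG x x).trans ?_
      rw [← weightedNorm_sq hPa]
      calc cG * ‖x‖ * ‖x‖ ≤ cG * (cP * weightedNorm Pa x) * (cP * weightedNorm Pa x) := by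
            have := (hequiv x).2
            have := weightedNorm_nonneg Pa x
            gcongr
        _ = _ := by ring
    have h2 : -(1 / 12 * weightedInner Pa x x) ≤ μ * weightedInner Pa x (G₀ *ᵥ x) := by
      refine le_trans ?_ (neg_abs_le _)
      rw [abs_mul, neg_le_neg_iff]
      calc |μ| * |weightedInner Pa x (G₀ *ᵥ x)| ≤ |μ| * (cG * cP ^ 2 * weightedInner Pa x x) := by
            gcongr
        _ = |μ| * (cG * cP ^ 2) * weightedInner Pa x x := by ring
        _ ≤ _ := by
          gcongr
          exact weightedInner_self_nonneg hPa x
    nlinarith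
  have hzR : ‖z‖ ≤ R₀ := by
    have h1 : ‖z‖ ^ 2 ≤ 4 / cQ := by
      rw [le_div_iff₀ hcQ, mul_comm]
      exact (hQ z).trans hz4
    nlinarith [norm_nonneg z]
  have hziR : ∀ i, ‖z i‖ ≤ R₀ := fun i => (norm_le_pi_norm z i).trans hzR
  -- the rescaled nonlinearity
  have hΓ' : ∀ i, ∃ Γ₁ : Fin n → ℝ, weightedNorm Pa Γ₁ ≤ τ * weightedNorm Pa (z i) ∧
      ‖v ^ (-μ) • (dilation (dilationGenerator G₀ μ) (-Real.log v) *ᵥ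
        (γ t (x t + dilation (dilationGenerator G₀ μ) (Real.log v) *ᵥ z i) - γ t (x t))) - Γ₁‖
          ≤ cΓ * |μ| := by
    intro i
    refine hΓ μ hμ1 hmon τ hτ.le hτρ.le (z i) _ v (hziR i) hv (fun h0 => ?_) fun h0 => ?_
    · rw [h0, Matrix.mulVec_zero, add_zero, sub_self]
    · have := hγ.block hN ht (x t) (dilation_mulVec_ne_zero (dilationGenerator G₀ μ)
        (Real.log v) h0)
      rwa [hmon.homNorm_dilation, Real.exp_log hv] at this
  choose Γ₁ hΓ₁ hΓ₂ using hΓ'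
  have hmain := hgain ν hν hlin z Γ₁ fun i => (hΓ₁ i).trans (by
    have := weightedNorm_nonneg Pa (z i)
    gcongr)
  have hvμ : 0 < v ^ μ := Real.rpow_pos_of_pos hv μ
  -- the remaining error terms
  set ω : ∀ i, Fin (p i) → ℝ := fun i => C i *ᵥ z i - v⁻¹ • qy t i with hω
  set W : Fin N → Fin n → ℝ := fun i => A *ᵥ z i
    + NormedSpace.exp ((μ * Real.log (euclNorm (ω i))) • (G₀ + 1)) *ᵥ
        (observerGain Pa Y ζ i *ᵥ ω i)
    + (ν * homNorm (dilationGenerator G₀ μ) Pa (-∑ j, 𝓛 i j • z j) ^ μ) • (-∑ j, 𝓛 i j • z j)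
    + v ^ (-μ) • (dilation (dilationGenerator G₀ μ) (-Real.log v) *ᵥ
        (γ t (x t + dilation (dilationGenerator G₀ μ) (Real.log v) *ᵥ z i) - γ t (x t)))
    - v ^ (-μ) • (dilation (dilationGenerator G₀ μ) (-Real.log v) *ᵥ qx t) with hW
  set W₀ : Fin N → Fin n → ℝ := fun i => Matrix.mulVecLin A (z i)
    + ((Matrix.mulVecLin (observerGain Pa Y ζ i)).comp (Matrix.mulVecLin (C i))) (z i)
    - ν • ∑ j, 𝓛 i j • z j + Γ₁ i with hW₀
  have hfield : (fun i => dilation (dilationGenerator G₀ μ) (-Real.log v) *ᵥ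
      errorField A C G₀ Pa (observerGain Pa Y ζ) 𝓛 ν μ γ x qx qy t
        (fun i => dilation (dilationGenerator G₀ μ) (Real.log v) *ᵥ z i) i) = v ^ μ • W := by
    funext i
    exact dilation_neg_mulVec_errorField hA hC hmon _ 𝓛 ν γ x qx qy t hv z i
  have herr : ‖W - W₀‖ ≤ c * (|μ| + min 1 (ρ / κ)) := by
    have hδ0 : 0 ≤ min 1 (ρ / κ) := by positivity
    refine (pi_norm_le_iff_of_nonneg (by positivity)).2 fun i => ?_
    have hq : ‖v⁻¹ • qy t i‖ ≤ min 1 (ρ / κ) := by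
      rw [norm_smul, Real.norm_of_nonneg (by positivity), inv_mul_eq_div, div_le_iff₀ hv]
      exact hqy i
    have b1 := hI i μ hμ1 (z i) (v⁻¹ • qy t i) (hziR i) (hq.trans (min_le_left _ _))
    have hθi : ‖-∑ j, 𝓛 i j • z j‖ ≤ cθ * R₀ := by
      rw [norm_neg, ← blockMatrixAction_apply]
      refine (norm_le_pi_norm _ i).trans ((hθ z).trans ?_)
      gcongr
    have b2 := hCpl μ hμ1 hmon _ hθi
    have b3 := hΓ₂ i
    have b4 : ‖v ^ (-μ) • (dilation (dilationGenerator G₀ μ) (-Real.log v) *ᵥ qx t)‖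
        ≤ min 1 (ρ / κ) := by
      rw [norm_smul, Real.norm_of_nonneg (Real.rpow_pos_of_pos hv _).le]
      exact hqx
    have hsplit : (W - W₀) i
        = (NormedSpace.exp ((μ * Real.log (euclNorm (ω i))) • (G₀ + 1)) *ᵥ
            (observerGain Pa Y ζ i *ᵥ ω i) - observerGain Pa Y ζ i *ᵥ (C i *ᵥ z i))
          + ν • (homNorm (dilationGenerator G₀ μ) Pa (-∑ j, 𝓛 i j • z j) ^ μ
              • (-∑ j, 𝓛 i j • z j) - (-∑ j, 𝓛 i j • z j))
          + (v ^ (-μ) • (dilation (dilationGenerator G₀ μ) (-Real.log v) *ᵥ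
              (γ t (x t + dilation (dilationGenerator G₀ μ) (Real.log v) *ᵥ z i) - γ t (x t)))
            - Γ₁ i)
          - v ^ (-μ) • (dilation (dilationGenerator G₀ μ) (-Real.log v) *ᵥ qx t) := by
      simp only [hW, hW₀, Pi.sub_apply, LinearMap.comp_apply, Matrix.mulVecLin_apply, smul_sub,
        smul_smul, smul_neg]
      abel
    rw [hsplit]
    have b2' := mul_le_mul_of_nonneg_left b2 hν0.le
    rw [← Real.norm_of_nonneg hν0.le, ← norm_smul, Real.norm_of_nonneg hν0.le] at b2'
    refine (norm_sub_le _ _).trans ((add_le_add ((norm_add_le _ _).trans (add_le_add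
      ((norm_add_le _ _).trans (add_le_add b1 b2')) b3)) b4).trans ?_)
    · have b5 : cI i * (|μ| + ‖v⁻¹ • qy t i‖) ≤ (∑ i, cI i) * (|μ| + min 1 (ρ / κ)) := by
        gcongr
        exact Finset.single_le_sum (fun j _ => hcI j) (Finset.mem_univ i)
      have b6 : 0 ≤ (ν * cC + cΓ) * min 1 (ρ / κ) := by positivity
      have b7 := abs_nonneg μ
      rw [hc]
      linarith only [b5, b6, b7]
  have hsmall : cL * ‖z‖ * ‖W - W₀‖ ≤ ρ / 8 := by
    calc cL * ‖z‖ * ‖W - W₀‖ ≤ cL * R₀ * (c * (ρ / κ + ρ / κ)) := by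
          gcongr
          refine herr.trans ?_
          gcongr
          exact min_le_right _ _
      _ = (16 * (cL * R₀ * c)) / κ * (ρ / 8) := by ring
      _ ≤ 1 * (ρ / 8) := by
        gcongr
        rw [div_le_one hκ0, hκ]
        linarith
      _ = _ := one_mul _
  rw [hfield, map_smul, smul_eq_mul, mul_comm (-(ρ / 8))]
  refine mul_le_mul_of_nonneg_left ?_ hvμ.le
  have hdecomp : lyapunovForm Pa ζ Y₂ z W
      = lyapunovForm Pa ζ Y₂ z W₀ + lyapunovForm Pa ζ Y₂ z (W - W₀) := by
    rw [← map_add, add_sub_cancel]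
  rw [hdecomp]
  have h1 := (le_abs_self _).trans ((hL z (W - W₀)).trans hsmall)
  have h2 : ρ / 4 ≤ ρ / 4 * lyapunovForm Pa ζ Y₂ z z := by
    have : 0 < ρ / 4 := by positivity
    exact le_mul_of_one_le_right this.le hz1
  linarith only [hmain, h1, h2]

end Dissipation

/-! ### The barrier estimate along dilated trajectories -/

section Barrier

theorem contDiff_dilation_mulVec {ι : Type*} [Fintype ι] [DecidableEq ι] (G : Matrix ι ι ℝ)
    (x : ι → ℝ) : ContDiff ℝ 1 fun s : ℝ => dilation G s *ᵥ x := by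
  have hd : ∀ s, HasDerivAt (fun s => dilation G s *ᵥ x) (G *ᵥ (dilation G s *ᵥ x)) s :=
    fun s => hasDerivAt_exp_smul_mulVec G x s
  refine contDiff_one_iff_deriv.2 ⟨fun s => (hd s).differentiableAt, ?_⟩
  have : deriv (fun s => dilation G s *ᵥ x) = fun s => G *ᵥ (dilation G s *ᵥ x) :=
    funext fun s => (hd s).deriv
  rw [this]
  exact continuous_const.matrix_mulVec ((continuous_dilation G).matrix_mulVec continuous_const)

/-- Reduces the regularity of `t ↦ Q(t) w(t)` to that of the columns of `Q` and the entries of `w`,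
which needs no norm on matrices. -/
theorem mulVec_eq_sum_smul_single {ι : Type*} [Fintype ι] [DecidableEq ι] (Q : Matrix ι ι ℝ)
    (w : ι → ℝ) : Q *ᵥ w = ∑ j, w j • (Q *ᵥ Pi.single j 1) := by
  nth_rewrite 1 [pi_eq_sum_univ' w]
  simp only [Matrix.mulVec_sum, Matrix.mulVec_smul]

theorem hasDerivAt_dilation_neg_mulVec {ι : Type*} [Fintype ι] [DecidableEq ι] (G : Matrix ι ι ℝ)
    {σ : ℝ → ℝ} {σ' t : ℝ} {w : ℝ → ι → ℝ} {w' : ι → ℝ} (hσ : HasDerivAt σ σ' t)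
    (hw : HasDerivAt w w' t) :
    HasDerivAt (fun t => dilation G (-σ t) *ᵥ w t)
      (-σ' • (G *ᵥ (dilation G (-σ t) *ᵥ w t)) + dilation G (-σ t) *ᵥ w') t := by
  have h1 : ∀ x : ι → ℝ, HasDerivAt (fun t => dilation G (-σ t) *ᵥ x)
      (-σ' • (G *ᵥ (dilation G (-σ t) *ᵥ x))) t := fun x =>
    HasDerivAt.scomp (h := fun t => -σ t) t (hasDerivAt_exp_smul_mulVec G x (-σ t)) hσ.fun_neg
  have h2 := HasDerivAt.fun_sum (u := Finset.univ) fun j _ =>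
    ((hasDerivAt_pi.1 hw j).smul (h1 (Pi.single j 1)))
  have e1 : (fun t => dilation G (-σ t) *ᵥ w t)
      = fun t => ∑ j, w t j • (dilation G (-σ t) *ᵥ Pi.single j 1) :=
    funext fun t => mulVec_eq_sum_smul_single _ _
  rw [e1]
  refine h2.congr_deriv ?_
  rw [Finset.sum_add_distrib, ← mulVec_eq_sum_smul_single]
  congr 1
  rw [mulVec_eq_sum_smul_single (dilation G (-σ t)) (w t), Matrix.mulVec_sum, Finset.smul_sum]
  refine Finset.sum_congr rfl fun j _ => ?_
  rw [Matrix.mulVec_smul, smul_comm]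

variable {N n : ℕ}

theorem absolutelyContinuousOnInterval_primitive {f : ℝ → Fin N → Fin n → ℝ} {b : ℝ}
    (hf : IntervalIntegrable f volume 0 b) (e₀ : Fin N → Fin n → ℝ) :
    AbsolutelyContinuousOnInterval (fun t => e₀ + ∫ s in (0 : ℝ)..t, f s) 0 b := by
  refine absolutelyContinuousOnInterval_pi fun i => absolutelyContinuousOnInterval_pi fun j => ?_
  have hmeas : ∀ t ∈ Set.uIcc 0 b, (e₀ + ∫ s in (0 : ℝ)..t, f s) i j
      = e₀ i j + ∫ s in (0 : ℝ)..t, f s i j := fun t ht => by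
    have hft : IntervalIntegrable f volume 0 t :=
      hf.mono_set (Set.uIcc_subset_uIcc Set.left_mem_uIcc ht)
    have := ((ContinuousLinearMap.proj (R := ℝ) (φ := fun _ : Fin n => ℝ) j).comp
      (ContinuousLinearMap.proj (R := ℝ) (φ := fun _ : Fin N => Fin n → ℝ) i)
        ).intervalIntegral_comp_comm hft
    simp only [ContinuousLinearMap.comp_apply, ContinuousLinearMap.proj_apply] at this
    rw [Pi.add_apply, Pi.add_apply, this]
  have hij : IntervalIntegrable (fun s => f s i j) volume 0 b :=
    ⟨((ContinuousLinearMap.proj (R := ℝ) (φ := fun _ : Fin n => ℝ) j).comp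
      (ContinuousLinearMap.proj (R := ℝ) (φ := fun _ : Fin N => Fin n → ℝ) i)).integrable_comp hf.1,
    ((ContinuousLinearMap.proj (R := ℝ) (φ := fun _ : Fin n => ℝ) j).comp
      (ContinuousLinearMap.proj (R := ℝ) (φ := fun _ : Fin N => Fin n → ℝ) i)).integrable_comp hf.2⟩
  have hac := hij.absolutelyContinuousOnInterval_intervalIntegral Set.left_mem_uIcc
  have hconst : AbsolutelyContinuousOnInterval (fun _ : ℝ => e₀ i j) 0 b :=
    (LipschitzWith.const (e₀ i j)).lipschitzOnWith.absolutelyContinuousOnInterval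
  refine Tendsto.congr' ?_ (hconst.add hac)
  have : ∀ᶠ E in AbsolutelyContinuousOnInterval.totalLengthFilter ⊓
      𝓟 (AbsolutelyContinuousOnInterval.disjWithin 0 b),
      E ∈ AbsolutelyContinuousOnInterval.disjWithin 0 b :=
    eventually_inf_principal.2 (Eventually.of_forall fun E hE => hE)
  filter_upwards [this] with E hE
  refine Finset.sum_congr rfl fun i hi => ?_
  rw [hmeas _ (hE.1 i hi).1, hmeas _ (hE.1 i hi).2]
  rfl

theorem contDiff_blockwise_dilation_neg_mulVec (G : Matrix (Fin n) (Fin n) ℝ) :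
    ContDiff ℝ 1 fun q : ℝ × (Fin N → Fin n → ℝ) =>
      (fun i => dilation G (-q.1) *ᵥ q.2 i : Fin N → Fin n → ℝ) := by
  refine contDiff_pi.2 fun i => ?_
  have e : (fun q : ℝ × (Fin N → Fin n → ℝ) => dilation G (-q.1) *ᵥ q.2 i)
      = fun q => ∑ j, q.2 i j • (dilation G (-q.1) *ᵥ Pi.single j 1) :=
    funext fun q => mulVec_eq_sum_smul_single _ _
  rw [e]
  refine ContDiff.sum fun j _ => ?_
  have h1 : ContDiff ℝ 1 fun q : ℝ × (Fin N → Fin n → ℝ) => q.2 i j := by fun_prop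
  have h2 : ContDiff ℝ 1 fun q : ℝ × (Fin N → Fin n → ℝ) =>
      dilation G (-q.1) *ᵥ Pi.single j 1 :=
    (contDiff_dilation_mulVec G (Pi.single j 1)).comp contDiff_fst.neg
  exact h1.smul h2

set_option maxHeartbeats 1000000 in
/-- **Barrier.** Let `z(t) = 𝐝(-ln v(t)) e(t)` be a trajectory rescaled by a comparison function
`v`. If the quadratic form of `z` starts at or below `1` and cannot increase in the shell
`1 ≤ Q ≤ 4`, then it stays at or below `1`. -/
theorem le_one_of_dilated_trajectory (G : Matrix (Fin n) (Fin n) ℝ)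
    {B : LinearMap.BilinForm ℝ (Fin N → Fin n → ℝ)} (hB : ∀ x y, B x y = B y x) {b : ℝ}
    (hb : 0 ≤ b) {f : ℝ → Fin N → Fin n → ℝ} (hf : IntervalIntegrable f volume 0 b)
    {e₀ : Fin N → Fin n → ℝ} {e : ℝ → Fin N → Fin n → ℝ}
    (he : ∀ t ∈ Set.Icc 0 b, e t = e₀ + ∫ s in (0 : ℝ)..t, f s)
    {v v' : ℝ → ℝ} (hv : ∀ t ∈ Set.Icc 0 b, 0 < v t) (hvc : ContDiffOn ℝ 1 v (Set.Icc 0 b))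
    (hv' : ∀ t ∈ Set.Icc 0 b, HasDerivAt v (v' t) t)
    (h0 : B (fun i => dilation G (-Real.log (v 0)) *ᵥ e₀ i)
      (fun i => dilation G (-Real.log (v 0)) *ᵥ e₀ i) ≤ 1)
    (hdiss : ∀ᵐ t, t ∈ Set.Icc 0 b → ∀ z : Fin N → Fin n → ℝ,
      z = (fun i => dilation G (-Real.log (v t)) *ᵥ e t i) → 1 ≤ B z z → B z z ≤ 4 →
      -(v' t / v t) * B z (fun i => G *ᵥ z i)
        + B z (fun i => dilation G (-Real.log (v t)) *ᵥ f t i) ≤ 0) :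
    B (fun i => dilation G (-Real.log (v b)) *ᵥ e b i)
      (fun i => dilation G (-Real.log (v b)) *ᵥ e b i) ≤ 1 := by
  set E : ℝ → Fin N → Fin n → ℝ := fun t => e₀ + ∫ s in (0 : ℝ)..t, f s with hE
  set z : ℝ → Fin N → Fin n → ℝ := fun t i => dilation G (-Real.log (v t)) *ᵥ E t i with hz
  have hEb : e b = E b := he b ⟨hb, le_rfl⟩
  have hE0 : E 0 = e₀ := by simp [hE]
  have hσ : AbsolutelyContinuousOnInterval (fun t => Real.log (v t)) 0 b := by
    refine ContDiffOn.absolutelyContinuousOnInterval ?_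
    rw [Set.uIcc_of_le hb]
    exact hvc.log fun t ht => (hv t ht).ne'
  have hsmooth := contDiff_blockwise_dilation_neg_mulVec (N := N) G
  have hm : AbsolutelyContinuousOnInterval (fun t => B (z t) (z t)) 0 b :=
    (hσ.prodMk (absolutelyContinuousOnInterval_primitive hf e₀)).comp_contDiff
      (((LinearMap.toContinuousBilinearMap B).contDiff.comp hsmooth).clm_apply hsmooth)
  have key := hm.le_one_of_deriv_nonpos hb (by simpa only [hz, hE0] using h0) ?_
  · simpa only [hz, ← hEb] using key
  filter_upwards [hf.ae_hasDerivAt_integral, hdiss] with t ht hdt htb hm1 hm4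
  have htb' : t ∈ Set.uIcc 0 b := by rwa [Set.uIcc_of_le hb]
  have hder : HasDerivAt E (f t) t := (ht htb' 0 Set.left_mem_uIcc).const_add e₀
  have hσ' := (hv' t htb).log (hv t htb).ne'
  have hz' : HasDerivAt z (fun i => -(v' t / v t) • (G *ᵥ z t i)
      + dilation G (-Real.log (v t)) *ᵥ f t i) t :=
    hasDerivAt_pi.2 fun i => hasDerivAt_dilation_neg_mulVec G hσ' (hasDerivAt_pi.1 hder i)
  have hmd := (LinearMap.toContinuousBilinearMap B).hasDerivAt_of_bilinear
    (fun _ => hz') (fun _ => hz')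
  have hsplit : (fun i => -(v' t / v t) • (G *ᵥ z t i) + dilation G (-Real.log (v t)) *ᵥ f t i)
      = -(v' t / v t) • (fun i => G *ᵥ z t i) + fun i => dilation G (-Real.log (v t)) *ᵥ f t i :=
    rfl
  have hval := hmd.deriv
  simp only [LinearMap.toContinuousBilinearMap_apply] at hval
  rw [hB _ (z t), hsplit, map_add, map_smul, smul_eq_mul] at hval
  have h := hdt htb (z t) (by rw [he t htb]) hm1 hm4
  rw [hval]
  linarith

end Barrier

/-! ### Comparison functions -/

section Comparison

theorem ClassK.nonneg {α : ℝ → ℝ} (h : ClassK α) {r : ℝ} (hr : 0 ≤ r) : 0 ≤ α r := by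
  rw [← h.2.2]
  exact h.2.1.monotoneOn Set.self_mem_Ici hr hr

theorem ClassK.comp {α₁ α₂ : ℝ → ℝ} (h₁ : ClassK α₁) (h₂ : ClassK α₂) :
    ClassK fun r => α₁ (α₂ r) :=
  ⟨h₁.1.comp h₂.1 fun _ hr => h₂.nonneg hr,
    fun _ hr _ hs hrs => h₁.2.1 (h₂.nonneg hr) (h₂.nonneg hs) (h₂.2.1 hr hs hrs),
    (congrArg α₁ h₂.2.2).trans h₁.2.2⟩

theorem ClassK.mono {α : ℝ → ℝ} (h : ClassK α) {r s : ℝ} (hr : 0 ≤ r) (hrs : r ≤ s) :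
    α r ≤ α s :=
  h.2.1.monotoneOn hr (hr.trans hrs) hrs

theorem ClassKL.comp {β : ℝ → ℝ → ℝ} {Ξ Λ : ℝ → ℝ} (hβ : ClassKL β) (hΞ : ClassK Ξ)
    (hΛ : ClassK Λ) : ClassKL fun r t => Ξ (β (Λ r) t) := by
  have hpos : ∀ r, 0 < r → 0 < Λ r := fun r hr => by
    rw [← hΛ.2.2]
    exact hΛ.2.1 Set.self_mem_Ici hr.le hr
  refine ⟨?_, fun t ht => hΞ.comp ((hβ.2.1 t ht).comp hΛ), fun r hr s hs t ht hst => ?_,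
    fun r hr => ?_⟩
  · have h1 : ContinuousOn (fun q : ℝ × ℝ => (Λ q.1, q.2)) (Set.Ici 0 ×ˢ Set.Ici 0) :=
      (hΛ.1.comp continuousOn_fst fun q hq => hq.1).prodMk continuousOn_snd
    have h2 := hβ.1.comp h1 fun q hq => ⟨hΛ.nonneg hq.1, hq.2⟩
    exact hΞ.1.comp h2 fun q hq => (hβ.2.1 q.2 hq.2).nonneg (hΛ.nonneg hq.1)
  · exact hΞ.2.1 ((hβ.2.1 t ht).nonneg (hΛ.nonneg hr.le))
      ((hβ.2.1 s hs).nonneg (hΛ.nonneg hr.le)) (hβ.2.2.1 _ (hpos r hr) hs ht hst)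
  · have h1 := hβ.2.2.2 (Λ r) (hΛ.nonneg hr)
    have h2 : Tendsto (β (Λ r)) atTop (𝓝[Set.Ici 0] 0) :=
      tendsto_nhdsWithin_iff.2 ⟨h1, (eventually_ge_atTop 0).mono fun t ht =>
        (hβ.2.1 t ht).nonneg (hΛ.nonneg hr)⟩
    have h3 := (hΞ.1 0 Set.self_mem_Ici).tendsto.comp h2
    rwa [hΞ.2.2] at h3

theorem classK_const_mul {c : ℝ} (hc : 0 < c) : ClassK fun r => c * r :=
  ⟨by fun_prop, fun _ _ _ _ h => mul_lt_mul_of_pos_left h hc, mul_zero c⟩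

theorem classK_rpow_add_rpow {R a b : ℝ} (hR : 0 < R) (ha : 0 < a) (hb : 0 < b) :
    ClassK fun r : ℝ => R * (r ^ a + r ^ b) := by
  refine ⟨Continuous.continuousOn ?_, fun r hr s hs hrs => ?_, ?_⟩
  · exact continuous_const.mul ((Real.continuous_rpow_const ha.le).add
      (Real.continuous_rpow_const hb.le))
  · have h1 := Real.rpow_lt_rpow hr hrs ha
    have h2 := Real.rpow_lt_rpow hr hrs hb
    exact mul_lt_mul_of_pos_left (add_lt_add h1 h2) hR
  · simp [ha.ne', hb.ne']

/-- The comparison function `β(r, t) = (1 / r + c t / (1 + r²))⁻¹`, written without division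
by `r`. For fixed `r` it solves `v' = - c v² / (1 + r²)`, `v(0) = r`. -/
noncomputable def decayFunction (c r t : ℝ) : ℝ := r * (1 + r ^ 2) / (1 + r ^ 2 + c * r * t)

theorem decayFunction_denom_pos {c r t : ℝ} (hc : 0 < c) (hr : 0 ≤ r) (ht : 0 ≤ t) :
    0 < 1 + r ^ 2 + c * r * t := by positivity

theorem classKL_decayFunction {c : ℝ} (hc : 0 < c) : ClassKL (decayFunction c) := by
  refine ⟨?_, fun t ht => ⟨?_, fun r hr s hs hrs => ?_, by simp [decayFunction]⟩,
    fun r hr s hs t ht hst => ?_, fun r hr => ?_⟩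
  · refine ContinuousOn.div (by fun_prop) (by fun_prop) fun q hq => ?_
    exact (decayFunction_denom_pos hc hq.1 hq.2).ne'
  · refine ContinuousOn.div (by fun_prop) (by fun_prop) fun r hr => ?_
    exact (decayFunction_denom_pos hc hr ht).ne'
  · have hr0 : 0 ≤ r := hr
    have hs0 : 0 ≤ s := hs
    have ht0 : 0 ≤ t := ht
    simp only [decayFunction]
    rw [div_lt_div_iff₀ (decayFunction_denom_pos hc hr0 ht0) (decayFunction_denom_pos hc hs0 ht0)]
    have h1 : r * ((1 + r ^ 2) * (1 + s ^ 2)) < s * ((1 + r ^ 2) * (1 + s ^ 2)) := by gcongr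
    have h2 : c * r * s * t * (1 + r ^ 2) ≤ c * r * s * t * (1 + s ^ 2) := by gcongr
    linarith
  · have hs0 : 0 ≤ s := hs
    have := decayFunction_denom_pos hc hr.le hs0
    change r * (1 + r ^ 2) / (1 + r ^ 2 + c * r * t) < r * (1 + r ^ 2) / (1 + r ^ 2 + c * r * s)
    gcongr
  · rcases hr.eq_or_lt with rfl | hr
    · have e : decayFunction c 0 = fun _ => 0 := funext fun t => by simp [decayFunction]
      rw [e]
      exact tendsto_const_nhds
    · refine Tendsto.div_atTop tendsto_const_nhds ?_
      exact tendsto_atTop_add_const_left _ _ (tendsto_id.const_mul_atTop (by positivity))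

theorem hasDerivAt_decayFunction {c r t : ℝ} (hc : 0 < c) (hr : 0 ≤ r) (ht : 0 ≤ t) :
    HasDerivAt (decayFunction c r) (-(c * decayFunction c r t ^ 2 / (1 + r ^ 2))) t := by
  have hpos := decayFunction_denom_pos hc hr ht
  have h1 : HasDerivAt (fun t => 1 + r ^ 2 + c * r * t) (c * r) t := by
    simpa using ((hasDerivAt_id t).const_mul (c * r)).const_add (1 + r ^ 2)
  have h2 := (hasDerivAt_const t (r * (1 + r ^ 2))).div h1 hpos.ne'
  refine h2.congr_deriv ?_
  have : 0 < 1 + r ^ 2 := by positivity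
  simp only [decayFunction]
  field_simp
  ring

theorem contDiffOn_decayFunction {c r b : ℝ} (hc : 0 < c) (hr : 0 ≤ r) :
    ContDiffOn ℝ 1 (decayFunction c r) (Set.Icc 0 b) := by
  refine ContDiffOn.div (by fun_prop) (by fun_prop) fun t ht => ?_
  exact (decayFunction_denom_pos hc hr ht.1).ne'

theorem decayFunction_le {c r t : ℝ} (hc : 0 < c) (hr : 0 ≤ r) (ht : 0 ≤ t) :
    decayFunction c r t ≤ r := by
  rw [decayFunction, div_le_iff₀ (decayFunction_denom_pos hc hr ht)]
  have : 0 ≤ r * (c * r * t) := by positivity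
  linarith

@[simp] theorem decayFunction_zero_right (c r : ℝ) : decayFunction c r 0 = r := by
  have : 1 + r ^ 2 ≠ 0 := by positivity
  simp [decayFunction, this]

theorem decayFunction_pos {c r t : ℝ} (hc : 0 < c) (hr : 0 < r) (ht : 0 ≤ t) :
    0 < decayFunction c r t := by
  have := decayFunction_denom_pos hc hr.le ht
  unfold decayFunction
  positivity

/-- The rate `v² / (1 + v²)` is slower than `v ^ (1 + μ)` for small and for large `v`, so it serves
positive and negative degrees of homogeneity alike. -/
theorem sq_div_one_add_sq_le_rpow {v μ : ℝ} (hv : 0 < v) (hμ : |μ| ≤ 1) :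
    v ^ 2 / (1 + v ^ 2) ≤ v * v ^ μ := by
  rw [abs_le] at hμ
  have e : v * v ^ μ = v ^ (1 + μ) := by rw [Real.rpow_add hv, Real.rpow_one]
  rw [e]
  rcases le_total v 1 with h | h
  · calc v ^ 2 / (1 + v ^ 2) ≤ v ^ 2 := div_le_self (by positivity) (by nlinarith [sq_nonneg v])
      _ = v ^ (2 : ℝ) := by norm_cast
      _ ≤ v ^ (1 + μ) := Real.rpow_le_rpow_of_exponent_ge hv h (by linarith)
  · calc v ^ 2 / (1 + v ^ 2) ≤ 1 := (div_le_one (by positivity)).2 (by linarith)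
      _ ≤ v ^ (1 + μ) := Real.one_le_rpow h (by linarith)

/-- The decay rate of `decayFunction c r t + l` is at most `c v ^ μ`, whatever `μ ∈ [-1, 1]`. -/
theorem neg_logDeriv_decayFunction_add_le {c r t l μ : ℝ} (hc : 0 < c) (hr : 0 < r) (ht : 0 ≤ t)
    (hl : 0 ≤ l) (hμ : |μ| ≤ 1) :
    -(-(c * decayFunction c r t ^ 2 / (1 + r ^ 2)) / (decayFunction c r t + l))
      ≤ c * (decayFunction c r t + l) ^ μ := by
  set d := decayFunction c r t with hd
  have hd0 : 0 < d := decayFunction_pos hc hr ht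
  have hdr : d ≤ r := decayFunction_le hc hr.le ht
  have hv : 0 < d + l := by positivity
  rw [neg_div, neg_neg, div_le_iff₀ hv]
  have h1 : d ^ 2 / (1 + r ^ 2) ≤ (d + l) ^ 2 / (1 + (d + l) ^ 2) := by
    rw [div_le_div_iff₀ (by positivity) (by positivity)]
    have h2 : d ^ 2 ≤ (d + l) ^ 2 := by gcongr; linarith
    have h3 : d ^ 2 ≤ r ^ 2 := by gcongr
    nlinarith [mul_le_mul_of_nonneg_left h3 (sq_nonneg (d + l))]
  calc c * d ^ 2 / (1 + r ^ 2) = c * (d ^ 2 / (1 + r ^ 2)) := by ring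
    _ ≤ c * ((d + l) * (d + l) ^ μ) := by
      gcongr
      exact h1.trans (sq_div_one_add_sq_le_rpow hv hμ)
    _ = _ := by ring

/-- The scale of a vector of norm `a`: for `v ≥ scaleFunction a` the dilation `𝐝(-ln v)` with a
generator near the identity contracts the vector to norm at most `1`. Both powers are needed, as
`𝐝(-ln v)` acts like `v ^ (-1)` only up to a factor `exp (|ln v| / 4)`. -/
noncomputable def scaleFunction (a : ℝ) : ℝ := a ^ (2 : ℝ) + a ^ (2 / 3 : ℝ)

theorem classK_scaleFunction : ClassK scaleFunction := by
  have h := classK_rpow_add_rpow (a := 2) (b := 2 / 3) one_pos (by norm_num) (by norm_num)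
  simp only [one_mul] at h
  exact h

theorem le_rpow_half_of_scaleFunction_le {a v : ℝ} (ha : 0 ≤ a) (hv : scaleFunction a ≤ v) :
    a ≤ v ^ (1 / 2 : ℝ) ∧ a ≤ v ^ (3 / 2 : ℝ) := by
  rw [scaleFunction] at hv
  have h1 : 0 ≤ a ^ (2 : ℝ) := by positivity
  have h2 : 0 ≤ a ^ (2 / 3 : ℝ) := by positivity
  constructor
  · calc a = (a ^ (2 : ℝ)) ^ (1 / 2 : ℝ) := by rw [← Real.rpow_mul ha]; norm_num
      _ ≤ v ^ (1 / 2 : ℝ) := by gcongr; linarith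
  · calc a = (a ^ (2 / 3 : ℝ)) ^ (3 / 2 : ℝ) := by rw [← Real.rpow_mul ha]; norm_num
      _ ≤ v ^ (3 / 2 : ℝ) := by gcongr; linarith

theorem le_of_scaleFunction_le {a v : ℝ} (ha : 0 ≤ a) (hv : 0 < v) (h : scaleFunction a ≤ v) :
    a ≤ v := by
  obtain ⟨h1, h2⟩ := le_rpow_half_of_scaleFunction_le ha h
  rcases le_total v 1 with hv1 | hv1
  · have := Real.rpow_le_rpow_of_exponent_ge hv hv1 (show (1 : ℝ) ≤ 3 / 2 by norm_num)
    rw [Real.rpow_one] at this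
    exact h2.trans this
  · have := Real.rpow_le_rpow_of_exponent_le hv1 (show (1 / 2 : ℝ) ≤ 1 by norm_num)
    rw [Real.rpow_one] at this
    exact h1.trans this

variable {n : ℕ} {G₀ : Matrix (Fin n) (Fin n) ℝ} {k μ : ℝ}

theorem abs_le_of_isExpBound (h : IsExpBound G₀ k) (hμ : |μ| * k ≤ 1 / 4) : |μ| ≤ 1 / 4 := by
  nlinarith [h.one_le, abs_nonneg μ]

/-- A disturbance of norm at most `a` is negligible, relative to the degree `s` of homogeneity, at
every scale `v ≥ scaleFunction a`. -/
theorem IsExpBound.rpow_mul_norm_dilation_neg_le (h : IsExpBound G₀ k) (hμ : |μ| * k ≤ 1 / 4)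
    {a v s : ℝ} (hs : |s| ≤ 1 / 4) (ha : 0 ≤ a) (hv : 0 < v) (hav : scaleFunction a ≤ v)
    {x : Fin n → ℝ} (hx : ‖x‖ ≤ a) :
    v ^ (-s) * ‖dilation (dilationGenerator G₀ μ) (-Real.log v) *ᵥ x‖ ≤ 1 := by
  obtain ⟨h1, h2⟩ := le_rpow_half_of_scaleFunction_le ha hav
  have hle := h.norm_dilation_mulVec_le hμ (-Real.log v) x
  rw [abs_le] at hs
  rw [abs_neg] at hle
  rcases le_total v 1 with hv1 | hv1
  · have hlog := Real.log_nonpos hv.le hv1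
    rw [abs_of_nonpos hlog, show -Real.log v + -Real.log v / 4 = Real.log v * (-(5 / 4)) by ring,
      ← Real.rpow_def_of_pos hv] at hle
    calc v ^ (-s) * _ ≤ v ^ (-s) * (v ^ (-(5 / 4) : ℝ) * v ^ (3 / 2 : ℝ)) := by
          gcongr
          exact hle.trans (by gcongr; exact hx.trans h2)
      _ = v ^ (-s + (-(5 / 4) + 3 / 2)) := by rw [← Real.rpow_add hv, ← Real.rpow_add hv]
      _ ≤ 1 := Real.rpow_le_one hv.le hv1 (by linarith)
  · have hlog := Real.log_nonneg hv1
    rw [abs_of_nonneg hlog, show -Real.log v + Real.log v / 4 = Real.log v * (-(3 / 4)) by ring,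
      ← Real.rpow_def_of_pos hv] at hle
    calc v ^ (-s) * _ ≤ v ^ (-s) * (v ^ (-(3 / 4) : ℝ) * v ^ (1 / 2 : ℝ)) := by
          gcongr
          exact hle.trans (by gcongr; exact hx.trans h1)
      _ = v ^ (-s + (-(3 / 4) + 1 / 2)) := by rw [← Real.rpow_add hv, ← Real.rpow_add hv]
      _ ≤ 1 := Real.rpow_le_one_of_one_le_of_nonpos hv1 (by linarith)

theorem IsExpBound.norm_dilation_log_le (h : IsExpBound G₀ k) (hμ : |μ| * k ≤ 1 / 4)
    {v : ℝ} (hv : 0 < v) (x : Fin n → ℝ) :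
    ‖dilation (dilationGenerator G₀ μ) (Real.log v) *ᵥ x‖
      ≤ (v ^ (1 / 2 : ℝ) + v ^ (3 / 2 : ℝ)) * ‖x‖ := by
  refine (h.norm_dilation_mulVec_le hμ _ x).trans ?_
  gcongr
  have h1 := Real.rpow_pos_of_pos hv (1 / 2 : ℝ)
  have h2 := Real.rpow_pos_of_pos hv (3 / 2 : ℝ)
  rcases le_total v 1 with hv1 | hv1
  · rw [abs_of_nonpos (Real.log_nonpos hv.le hv1),
      show Real.log v + -Real.log v / 4 = Real.log v * (3 / 4) by ring, ← Real.rpow_def_of_pos hv]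
    have := Real.rpow_le_rpow_of_exponent_ge hv hv1 (by norm_num : (1 / 2 : ℝ) ≤ 3 / 4)
    linarith
  · rw [abs_of_nonneg (Real.log_nonneg hv1),
      show Real.log v + Real.log v / 4 = Real.log v * (5 / 4) by ring, ← Real.rpow_def_of_pos hv]
    have := Real.rpow_le_rpow_of_exponent_le hv1 (by norm_num : (5 / 4 : ℝ) ≤ 3 / 2)
    linarith

end Comparison

/-! ### The input-to-state estimate -/

section Estimate

theorem ClassK.add_le {Ξ : ℝ → ℝ} (h : ClassK Ξ) {a b : ℝ} (ha : 0 ≤ a) (hb : 0 ≤ b) :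
    Ξ (a + b) ≤ Ξ (2 * a) + Ξ (2 * b) := by
  rcases le_total a b with hab | hab
  · have h1 := h.mono (add_nonneg ha hb) (show a + b ≤ 2 * b by linarith)
    have h2 := h.nonneg (mul_nonneg zero_le_two ha)
    linarith
  · have h1 := h.mono (add_nonneg ha hb) (show a + b ≤ 2 * a by linarith)
    have h2 := h.nonneg (mul_nonneg zero_le_two hb)
    linarith

theorem ae_norm_le_supNormUpTo {Q : Type*} [NormedAddCommGroup Q] {q : ℝ → Q}
    (hq : MemLp q ∞ (volume.restrict (Set.Ici 0))) (b : ℝ) :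
    ∀ᵐ t, t ∈ Set.Icc 0 b → ‖q t‖ ≤ supNormUpTo q b := by
  have hle : volume.restrict (Set.Ico (0 : ℝ) b) ≤ volume.restrict (Set.Ici 0) :=
    Measure.restrict_mono Set.Ico_subset_Ici_self le_rfl
  have hfin := ((eLpNorm_mono_measure q hle).trans_lt hq.2).ne
  have h1 : ∀ᵐ t ∂volume.restrict (Set.Icc (0 : ℝ) b), ‖q t‖ ≤ supNormUpTo q b := by
    rw [← Measure.restrict_congr_set Ico_ae_eq_Icc]
    filter_upwards [enorm_ae_le_eLpNormEssSup q (volume.restrict (Set.Ico (0 : ℝ) b))] with t ht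
    rw [← eLpNorm_exponent_top] at ht
    rw [← toReal_enorm]
    exact ENNReal.toReal_mono hfin ht
  exact (ae_restrict_iff' measurableSet_Icc).1 h1

variable {N n : ℕ} {G₀ : Matrix (Fin n) (Fin n) ℝ} {k μ : ℝ}

/-- **Decay along trajectories.** A trajectory whose velocity dissipates the quadratic form at every
scale `v ≥ l` stays in the image of the unit sublevel set under `𝐝(ln v(t))`, where
`v(t) = decayFunction c v₀ t + l`. -/
theorem le_one_of_dissipation (G : Matrix (Fin n) (Fin n) ℝ)
    {Q : LinearMap.BilinForm ℝ (Fin N → Fin n → ℝ)} (hQ : ∀ x y, Q x y = Q y x)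
    {c c₀ : ℝ} (hc : 0 < c)
    (hcG : ∀ z : Fin N → Fin n → ℝ, Q z z ≤ 4 → c * |Q z (fun i => G *ᵥ z i)| ≤ c₀)
    (hμ : |μ| ≤ 1) {b l v₀ : ℝ} (hb : 0 ≤ b) (hl : 0 ≤ l) (hv₀ : 0 < v₀)
    {f : ℝ → Fin N → Fin n → ℝ} (hf : IntervalIntegrable f volume 0 b)
    {e₀ : Fin N → Fin n → ℝ} {e : ℝ → Fin N → Fin n → ℝ}
    (he : ∀ t ∈ Set.Icc 0 b, e t = e₀ + ∫ s in (0 : ℝ)..t, f s)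
    (h0 : Q (fun i => dilation G (-Real.log (v₀ + l)) *ᵥ e₀ i)
      (fun i => dilation G (-Real.log (v₀ + l)) *ᵥ e₀ i) ≤ 1)
    (hdiss : ∀ᵐ t, t ∈ Set.Icc 0 b → ∀ v, 0 < v → l ≤ v → ∀ z : Fin N → Fin n → ℝ,
      z = (fun i => dilation G (-Real.log v) *ᵥ e t i) → 1 ≤ Q z z → Q z z ≤ 4 →
      Q z (fun i => dilation G (-Real.log v) *ᵥ f t i) ≤ -c₀ * v ^ μ) :
    Q (fun i => dilation G (-Real.log (decayFunction c v₀ b + l)) *ᵥ e b i)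
      (fun i => dilation G (-Real.log (decayFunction c v₀ b + l)) *ᵥ e b i) ≤ 1 := by
  have hv : ∀ t ∈ Set.Icc 0 b, 0 < decayFunction c v₀ t + l := fun t ht =>
    add_pos_of_pos_of_nonneg (decayFunction_pos hc hv₀ ht.1) hl
  refine le_one_of_dilated_trajectory G hQ hb hf he (v := fun t => decayFunction c v₀ t + l)
    (v' := fun t => -(c * decayFunction c v₀ t ^ 2 / (1 + v₀ ^ 2))) hv
    ((contDiffOn_decayFunction hc hv₀.le).add contDiffOn_const)
    (fun t ht => (hasDerivAt_decayFunction hc hv₀.le ht.1).add_const l)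
    (by simpa using h0) ?_
  filter_upwards [hdiss] with t ht htb z hz h1 h4
  have hvt := hv t htb
  have hd := ht htb _ hvt (le_add_of_nonneg_left (decayFunction_pos hc hv₀ htb.1).le) z hz h1 h4
  have hrate := neg_logDeriv_decayFunction_add_le hc hv₀ htb.1 hl hμ
  have hrate0 : 0 ≤
      -(-(c * decayFunction c v₀ t ^ 2 / (1 + v₀ ^ 2)) / (decayFunction c v₀ t + l)) := by
    rw [neg_div, neg_neg]
    positivity
  have hrpow := Real.rpow_pos_of_pos hvt μ
  calc _ ≤ c * (decayFunction c v₀ t + l) ^ μ * |Q z (fun i => G *ᵥ z i)|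
        + -c₀ * (decayFunction c v₀ t + l) ^ μ := by
        refine add_le_add ?_ hd
        exact (mul_le_mul_of_nonneg_left (le_abs_self _) hrate0).trans
          (mul_le_mul_of_nonneg_right hrate (abs_nonneg _))
    _ = (decayFunction c v₀ t + l) ^ μ * (c * |Q z (fun i => G *ᵥ z i)| - c₀) := by ring
    _ ≤ 0 := mul_nonpos_of_nonneg_of_nonpos hrpow.le (by linarith [hcG z h4])

/-- **From dissipation to input-to-state stability.** If a field, at every scale `v` dominating the
disturbance, dissipates a positive definite quadratic form in the coordinates rescaled by
`𝐝(-ln v)`, then its solutions satisfy a uniform input-to-state estimate. -/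
theorem IsExpBound.exists_iss_estimate (h : IsExpBound G₀ k) (hμ : |μ| * k ≤ 1 / 4)
    {Q : LinearMap.BilinForm ℝ (Fin N → Fin n → ℝ)} (hQ : ∀ x y, Q x y = Q y x)
    (hQpos : ∀ x, x ≠ 0 → 0 < Q x x) {c₀ δ : ℝ} (hc₀ : 0 < c₀) (hδ : 0 < δ) {p : Fin N → ℕ}
    {F : (ℝ → Fin n → ℝ) → (ℝ → Fin n → ℝ) → (ℝ → ∀ i, Fin (p i) → ℝ) → ℝ →
      (Fin N → Fin n → ℝ) → Fin N → Fin n → ℝ}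
    (hF : ∀ (x qx : ℝ → Fin n → ℝ) (qy : ℝ → ∀ i, Fin (p i) → ℝ) (t v : ℝ)
      (z : Fin N → Fin n → ℝ), 0 < t → 0 < v → 1 ≤ Q z z → Q z z ≤ 4 →
      (∀ i, ‖qy t i‖ ≤ δ * v) →
      v ^ (-μ) * ‖dilation (dilationGenerator G₀ μ) (-Real.log v) *ᵥ qx t‖ ≤ δ →
      Q z (fun i => dilation (dilationGenerator G₀ μ) (-Real.log v) *ᵥ
        F x qx qy t (fun i => dilation (dilationGenerator G₀ μ) (Real.log v) *ᵥ z i) i)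
        ≤ -c₀ * v ^ μ) :
    ∃ (β : ℝ → ℝ → ℝ) (α : ℝ → ℝ), ClassKL β ∧ ClassK α ∧
      ∀ (x qx : ℝ → Fin n → ℝ) (qy : ℝ → ∀ i, Fin (p i) → ℝ),
        MemLp (fun t => (qx t, qy t)) ∞ (volume.restrict (Set.Ici 0)) →
        ∀ (S : EReal) (e₀ : Fin N → Fin n → ℝ) (e : ℝ → Fin N → Fin n → ℝ),
          IsSolutionOn (F x qx qy) S e₀ e → ∀ t ∈ timeInterval S,
            ‖e t‖ ≤ β ‖e₀‖ t + α (supNormUpTo (fun s => (qx s, qy s)) t) := by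
  set G := dilationGenerator G₀ μ with hG
  have hμ1 : |μ| ≤ 1 / 4 := abs_le_of_isExpBound h hμ
  obtain ⟨cQ, hcQ, hQlow⟩ := Q.exists_sq_norm_le hQpos
  obtain ⟨cL, hcL, hQup⟩ := Q.exists_abs_le_mul
  obtain ⟨cG, hcG, hQG⟩ := LinearMap.BilinForm.exists_abs_le_mul
    (Q.compl₁₂ LinearMap.id (LinearMap.pi fun i => (Matrix.mulVecLin G).comp (LinearMap.proj i)))
  -- the decay rate `c` is chosen so that the drift of the scale is dominated on the shell
  set c : ℝ := c₀ / (cG * (4 / cQ) + 1) with hc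
  have hc0 : 0 < c := by positivity
  have hrate : ∀ z : Fin N → Fin n → ℝ, Q z z ≤ 4 → c * |Q z (fun i => G *ᵥ z i)| ≤ c₀ := by
    intro z hz
    have h1 : |Q z (fun i => G *ᵥ z i)| ≤ cG * ‖z‖ * ‖z‖ := hQG z z
    have h2 : ‖z‖ ^ 2 ≤ 4 / cQ := by
      rw [le_div_iff₀ hcQ]
      linarith [hQlow z]
    have h3 : |Q z (fun i => G *ᵥ z i)| ≤ cG * (4 / cQ) + 1 := by
      have : cG * ‖z‖ ^ 2 ≤ cG * (4 / cQ) := by gcongr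
      nlinarith
    calc c * |Q z (fun i => G *ᵥ z i)| ≤ c * (cG * (4 / cQ) + 1) := by gcongr
      _ = c₀ := by rw [hc]; field_simp
  -- `R` bounds the norm on the unit sublevel set of `Q`
  set R : ℝ := 1 + 1 / cQ with hR
  have hR0 : 0 < R := by positivity
  have hnorm : ∀ z : Fin N → Fin n → ℝ, Q z z ≤ 1 → ‖z‖ ≤ R := by
    intro z hz
    have h1 : ‖z‖ ^ 2 ≤ 1 / cQ := by
      rw [le_div_iff₀ hcQ]
      linarith [hQlow z]
    refine abs_le_of_sq_le_sq' ?_ hR0.le |>.2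
    have : 0 ≤ 1 / cQ := by positivity
    rw [hR]
    nlinarith
  set Ξ : ℝ → ℝ := fun r => R * (r ^ (1 / 2 : ℝ) + r ^ (3 / 2 : ℝ)) with hΞ
  have hΞK : ClassK Ξ := classK_rpow_add_rpow hR0 (by norm_num) (by norm_num)
  have hΞ2 : ClassK fun r => Ξ (2 * r) := hΞK.comp (classK_const_mul two_pos)
  have hΛ : ClassK fun r => scaleFunction ((cL + 1) * r) :=
    classK_scaleFunction.comp (classK_const_mul (by positivity))
  have hΛq : ClassK fun r => scaleFunction (δ⁻¹ * r) :=
    classK_scaleFunction.comp (classK_const_mul (by positivity))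
  have hβ := (classKL_decayFunction hc0).comp hΞ2 hΛ
  refine ⟨_, _, hβ, hΞ2.comp hΛq, fun x qx qy hq S e₀ e he t ht => ?_⟩
  have hsub : ∀ s ∈ Set.Icc 0 t, s ∈ timeInterval S := fun s hs =>
    timeInterval_subset ht hs.1 hs.2
  set K := supNormUpTo (fun s => (qx s, qy s)) t with hK
  have hK0 : 0 ≤ K := ENNReal.toReal_nonneg
  set l := scaleFunction (δ⁻¹ * K) with hl
  have hl0 : 0 ≤ l := hΛq.nonneg hK0
  set a := scaleFunction ((cL + 1) * ‖e₀‖) with ha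
  have ha0 : 0 ≤ a := hΛ.nonneg (norm_nonneg _)
  have hdiss : ∀ᵐ s, s ∈ Set.Icc 0 t → ∀ v, 0 < v → l ≤ v → ∀ z : Fin N → Fin n → ℝ,
      z = (fun i => dilation G (-Real.log v) *ᵥ e s i) → 1 ≤ Q z z → Q z z ≤ 4 →
      Q z (fun i => dilation G (-Real.log v) *ᵥ F x qx qy s (e s) i) ≤ -c₀ * v ^ μ := by
    have hne : ∀ᵐ s : ℝ, s ≠ 0 := by simp [ae_iff]
    filter_upwards [ae_norm_le_supNormUpTo hq t, hne] with s hs hs0 hst v hv hlv z hz h1 h4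
    have hqs := hs hst
    have hK' : 0 ≤ δ⁻¹ * K := by positivity
    have hes : e s = fun i => dilation G (Real.log v) *ᵥ z i := by
      funext i
      rw [hz, dilation_neg_mulVec_cancel]
    have hd := hF x qx qy s v z (lt_of_le_of_ne hst.1 (Ne.symm hs0)) hv h1 h4 (fun i => ?_) ?_
    · rwa [← hes] at hd
    · have hqi : ‖qy s i‖ ≤ K :=
        (norm_le_pi_norm (qy s) i).trans ((le_max_right _ _).trans hqs)
      have := le_of_scaleFunction_le hK' hv hlv
      calc ‖qy s i‖ ≤ δ * (δ⁻¹ * K) := by rwa [mul_inv_cancel_left₀ hδ.ne']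
        _ ≤ δ * v := by gcongr
    · have hqx : ‖δ⁻¹ • qx s‖ ≤ δ⁻¹ * K := by
        rw [norm_smul, Real.norm_of_nonneg (by positivity)]
        gcongr
        exact (le_max_left _ _).trans hqs
      have h5 := h.rpow_mul_norm_dilation_neg_le hμ hμ1 hK' hv hlv hqx
      rw [Matrix.mulVec_smul, norm_smul, Real.norm_of_nonneg (by positivity)] at h5
      have h6 := mul_le_mul_of_nonneg_left h5 hδ.le
      calc _ = δ * (v ^ (-μ) * (δ⁻¹ * ‖dilation G (-Real.log v) *ᵥ qx s‖)) := by field_simp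
        _ ≤ δ := by simpa using h6
  -- the estimate for every initial scale above the scale of `e₀`
  have key : ∀ v₀, a < v₀ → ‖e t‖ ≤ Ξ (2 * decayFunction c v₀ t) + Ξ (2 * l) := by
    intro v₀ hav
    have hv₀ : 0 < v₀ := ha0.trans_lt hav
    have hvl : 0 < v₀ + l := by positivity
    have h0 : Q (fun i => dilation G (-Real.log (v₀ + l)) *ᵥ e₀ i)
        (fun i => dilation G (-Real.log (v₀ + l)) *ᵥ e₀ i) ≤ 1 := by
      set w : Fin N → Fin n → ℝ := fun i => dilation G (-Real.log (v₀ + l)) *ᵥ e₀ i with hw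
      have hw1 : (cL + 1) * ‖w‖ ≤ 1 := by
        rw [← Real.norm_of_nonneg (show 0 ≤ cL + 1 by positivity), ← norm_smul]
        refine (pi_norm_le_iff_of_nonneg zero_le_one).2 fun i => ?_
        have hei : ‖(cL + 1) • e₀ i‖ ≤ (cL + 1) * ‖e₀‖ := by
          rw [norm_smul, Real.norm_of_nonneg (by positivity)]
          gcongr
          exact norm_le_pi_norm e₀ i
        have := h.rpow_mul_norm_dilation_neg_le hμ (s := 0) (by norm_num)
          (by positivity) hvl (show scaleFunction ((cL + 1) * ‖e₀‖) ≤ v₀ + l by linarith) hei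
        simpa [Matrix.mulVec_smul] using this
      have h1 := (le_abs_self _).trans (hQup w w)
      have h2 : 0 ≤ ‖w‖ := norm_nonneg w
      have h3 : ‖w‖ ≤ 1 := by nlinarith
      nlinarith
    have hfin := le_one_of_dissipation G hQ hc0 hrate (hμ1.trans (by norm_num)) ht.1 hl0 hv₀
      (he t ht).1 (fun s hs => (he s (hsub s hs)).2) h0 hdiss
    have hd0 : 0 < decayFunction c v₀ t := decayFunction_pos hc0 hv₀ ht.1
    have hvt : 0 < decayFunction c v₀ t + l := by positivity
    have hz := hnorm _ hfin
    refine le_trans ?_ (hΞK.add_le hd0.le hl0)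
    refine (pi_norm_le_iff_of_nonneg (hΞK.nonneg hvt.le)).2 fun i => ?_
    have hei := h.norm_dilation_log_le hμ hvt
      (dilation G (-Real.log (decayFunction c v₀ t + l)) *ᵥ e t i)
    rw [← hG, dilation_neg_mulVec_cancel] at hei
    refine hei.trans ?_
    rw [hΞ]
    simp only
    rw [mul_comm R]
    gcongr
    exact (norm_le_pi_norm (fun i => dilation G (-Real.log (decayFunction c v₀ t + l)) *ᵥ e t i)
      i).trans hz
  have hcont : ContinuousWithinAt (fun r => Ξ (2 * decayFunction c r t) + Ξ (2 * l))
      (Set.Ioi a) a :=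
    (((hΞ2.comp ((classKL_decayFunction hc0).2.1 t ht.1)).1 a ha0).mono
      fun r hr => ha0.trans (le_of_lt hr)).add continuousWithinAt_const
  -- the initial scale vanishes for `e₀ = 0`, so it is only reached in the limit
  exact ge_of_tendsto hcont (eventually_mem_nhdsWithin.mono key)

end Estimate

/-! ### Continuity of the error field -/

section ErrorFieldContinuity

theorem mul_exp_half_abs_log_le {r : ℝ} (hr : 0 < r) :
    r * Real.exp (|Real.log r| / 2) ≤ r ^ (1 / 2 : ℝ) + r ^ (3 / 2 : ℝ) := by
  have h1 := Real.rpow_pos_of_pos hr (1 / 2 : ℝ)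
  have h2 := Real.rpow_pos_of_pos hr (3 / 2 : ℝ)
  have e : r * Real.exp (|Real.log r| / 2) = Real.exp (Real.log r + |Real.log r| / 2) := by
    rw [Real.exp_add, Real.exp_log hr]
  rw [e]
  rcases le_total r 1 with hr1 | hr1
  · rw [abs_of_nonpos (Real.log_nonpos hr.le hr1),
      show Real.log r + -Real.log r / 2 = Real.log r * (1 / 2) by ring, ← Real.rpow_def_of_pos hr]
    linarith
  · rw [abs_of_nonneg (Real.log_nonneg hr1),
      show Real.log r + Real.log r / 2 = Real.log r * (3 / 2) by ring, ← Real.rpow_def_of_pos hr]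
    linarith

/-- A map that is continuous away from the origin and there dominated by a multiple of
`h exp(|ln h| / 2)`, with `h` a continuous gauge, extends continuously by `0`. -/
theorem continuous_of_norm_le_gauge {X Y : Type*} [NormedAddCommGroup X] [NormedAddCommGroup Y]
    {f : X → Y} {h : X → ℝ} {c : ℝ} (hc : 0 ≤ c) (hcont : Continuous h) (h0 : h 0 = 0)
    (hpos : ∀ x, x ≠ 0 → 0 < h x) (hf0 : f 0 = 0) (hf : ∀ x, x ≠ 0 → ContinuousAt f x)
    (hle : ∀ x, x ≠ 0 → ‖f x‖ ≤ c * (h x * Real.exp (|Real.log (h x)| / 2))) : Continuous f := by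
  refine continuous_iff_continuousAt.2 fun x => ?_
  rcases eq_or_ne x 0 with rfl | hx
  · have hg : Continuous fun x => c * (h x ^ (1 / 2 : ℝ) + h x ^ (3 / 2 : ℝ)) :=
      continuous_const.mul ((hcont.rpow_const fun _ => Or.inr (by norm_num)).add
        (hcont.rpow_const fun _ => Or.inr (by norm_num)))
    have hlim := hg.tendsto 0
    rw [h0, Real.zero_rpow (by norm_num), Real.zero_rpow (by norm_num), add_zero, mul_zero] at hlim
    rw [ContinuousAt, hf0]
    refine squeeze_zero_norm (fun y => ?_) hlim
    rcases eq_or_ne y 0 with rfl | hy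
    · rw [hf0, norm_zero, h0]
      positivity
    · exact (hle y hy).trans (mul_le_mul_of_nonneg_left (mul_exp_half_abs_log_le (hpos y hy)) hc)
  · exact hf x hx

theorem continuous_euclNorm {κ : Type*} [Fintype κ] : Continuous (euclNorm : (κ → ℝ) → ℝ) :=
  (PiLp.continuous_toLp 2 _).norm

variable {N n : ℕ} {G₀ : Matrix (Fin n) (Fin n) ℝ} {k μ : ℝ}

theorem IsExpBound.continuous_injection (h : IsExpBound G₀ k) (hμ : |μ| * k ≤ 1 / 4) {κ : ℕ}
    (H : Matrix (Fin n) (Fin κ) ℝ) : Continuous fun ω : Fin κ → ℝ =>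
      NormedSpace.exp ((μ * Real.log (euclNorm ω)) • (G₀ + 1)) *ᵥ (H *ᵥ ω) := by
  obtain ⟨c, hc, hH⟩ := (Matrix.mulVecLin H).exists_norm_le_mul
  refine continuous_of_norm_le_gauge hc continuous_euclNorm (by simp [euclNorm])
    (fun ω hω => euclNorm_pos hω) (by simp) (fun ω hω => ?_) fun ω hω => ?_
  · have h1 : ContinuousAt (fun ω : Fin κ → ℝ => (μ * Real.log (euclNorm ω)) • (G₀ + 1)) ω :=
      (continuousAt_const.mul (continuous_euclNorm.continuousAt.log (euclNorm_pos hω).ne')).smul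
        continuousAt_const
    have h2 : ContinuousAt (fun ω : Fin κ → ℝ =>
        NormedSpace.exp ((μ * Real.log (euclNorm ω)) • (G₀ + 1))) ω :=
      ContinuousAt.comp (g := NormedSpace.exp) continuous_exp_matrix.continuousAt h1
    have h3 : Continuous fun q : Matrix (Fin n) (Fin n) ℝ × (Fin n → ℝ) => q.1 *ᵥ q.2 :=
      continuous_fst.matrix_mulVec continuous_snd
    have h4 : ContinuousAt (fun ω : Fin κ → ℝ => H *ᵥ ω) ω :=
      (continuous_const.matrix_mulVec continuous_id).continuousAt
    exact ContinuousAt.comp (g := fun q : Matrix (Fin n) (Fin n) ℝ × (Fin n → ℝ) => q.1 *ᵥ q.2)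
      h3.continuousAt (h2.prodMk h4)
  · have h1 : ‖H *ᵥ ω‖ ≤ c * euclNorm ω :=
      (hH ω).trans (mul_le_mul_of_nonneg_left (norm_le_euclNorm ω) hc)
    have hr := euclNorm_pos hω
    calc _ ≤ Real.exp (|Real.log (euclNorm ω)| / 4) * ‖H *ᵥ ω‖ :=
          norm_exp_smul_mulVec_le h.right hμ _ _
      _ ≤ Real.exp (|Real.log (euclNorm ω)| / 2) * (c * euclNorm ω) := by
          have := abs_nonneg (Real.log (euclNorm ω))
          gcongr
          norm_num
      _ = _ := by ring

theorem IsExpBound.continuous_coupling (h : IsExpBound G₀ k) (hμ : |μ| * k ≤ 1 / 4)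
    {P : Matrix (Fin n) (Fin n) ℝ} (hP : IsMonotoneDilation (dilationGenerator G₀ μ) P) :
    Continuous fun θ : Fin n → ℝ => homNorm (dilationGenerator G₀ μ) P θ ^ μ • θ := by
  obtain ⟨c, hc, hequiv⟩ := exists_weightedNorm_equiv hP.posDef
  have hμ1 := abs_le_of_isExpBound h hμ
  refine continuous_of_norm_le_gauge (zero_le_one.trans hc) hP.continuous_homNorm (homNorm_zero _ _)
    (fun θ hθ => homNorm_pos _ _ hθ) (by simp) (fun θ hθ => ?_) fun θ hθ => ?_
  · exact (hP.continuous_homNorm.continuousAt.rpow_const (Or.inl (homNorm_pos _ _ hθ).ne')).smul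
      continuousAt_id
  · set r := homNorm (dilationGenerator G₀ μ) P θ with hr
    have hr0 : 0 < r := homNorm_pos _ _ hθ
    obtain ⟨w, hw1, hw⟩ := hP.eq_smul_exp hθ
    have hwc : ‖w‖ ≤ c := by simpa [hw1] using (hequiv w).2
    have hθn : ‖θ‖ ≤ r * (Real.exp (|Real.log r| / 4) * c) := by
      rw [hw, norm_smul, Real.norm_of_nonneg hr0.le]
      gcongr
      exact (norm_exp_smul_mulVec_le h.left hμ _ w).trans (by gcongr)
    have hrμ : r ^ μ ≤ Real.exp (|Real.log r| / 4) := by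
      rw [Real.rpow_def_of_pos hr0]
      refine Real.exp_le_exp.2 ((le_abs_self _).trans ?_)
      rw [abs_mul]
      nlinarith [abs_nonneg (Real.log r)]
    rw [norm_smul, Real.norm_of_nonneg (by positivity)]
    calc r ^ μ * ‖θ‖ ≤ Real.exp (|Real.log r| / 4) * (r * (Real.exp (|Real.log r| / 4) * c)) := by
          gcongr
      _ = c * (r * (Real.exp (|Real.log r| / 4 + |Real.log r| / 4))) := by
          rw [Real.exp_add]
          ring
      _ = _ := by ring_nf

/-- The error field depends continuously on the time, the plant state, the disturbances and the
error. -/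
theorem IsExpBound.continuous_errorField (h : IsExpBound G₀ k) (hμ : |μ| * k ≤ 1 / 4)
    {P : Matrix (Fin n) (Fin n) ℝ} (hP : IsMonotoneDilation (dilationGenerator G₀ μ) P)
    {p : Fin N → ℕ} (A : Matrix (Fin n) (Fin n) ℝ) (C : ∀ i, Matrix (Fin (p i)) (Fin n) ℝ)
    (H : ∀ i, Matrix (Fin n) (Fin (p i)) ℝ) (𝓛 : Matrix (Fin N) (Fin N) ℝ) (ν : ℝ)
    {γ : ℝ → (Fin n → ℝ) → Fin n → ℝ} (hγ : Continuous (Function.uncurry γ)) :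
    Continuous fun q : ℝ × (Fin n → ℝ) × ((Fin n → ℝ) × (∀ i, Fin (p i) → ℝ)) ×
        (Fin N → Fin n → ℝ) =>
      errorField A C G₀ P H 𝓛 ν μ γ (fun _ => q.2.1) (fun _ => q.2.2.1.1) (fun _ => q.2.2.1.2)
        q.1 q.2.2.2 := by
  refine continuous_pi fun i => ?_
  have he : Continuous fun q : ℝ × (Fin n → ℝ) × ((Fin n → ℝ) × (∀ i, Fin (p i) → ℝ)) ×
      (Fin N → Fin n → ℝ) => q.2.2.2 i := by fun_prop
  have hy : Continuous fun q : ℝ × (Fin n → ℝ) × ((Fin n → ℝ) × (∀ i, Fin (p i) → ℝ)) ×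
      (Fin N → Fin n → ℝ) => q.2.2.1.2 i := by fun_prop
  have hω : Continuous fun q : ℝ × (Fin n → ℝ) × ((Fin n → ℝ) × (∀ i, Fin (p i) → ℝ)) ×
      (Fin N → Fin n → ℝ) => C i *ᵥ q.2.2.2 i - q.2.2.1.2 i :=
    (continuous_const.matrix_mulVec he).sub hy
  have hθ : Continuous fun q : ℝ × (Fin n → ℝ) × ((Fin n → ℝ) × (∀ i, Fin (p i) → ℝ)) ×
      (Fin N → Fin n → ℝ) => -∑ j, 𝓛 i j • q.2.2.2 j := by fun_prop
  have h1 : Continuous fun q : ℝ × (Fin n → ℝ) × ((Fin n → ℝ) × (∀ i, Fin (p i) → ℝ)) ×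
      (Fin N → Fin n → ℝ) => A *ᵥ q.2.2.2 i := continuous_const.matrix_mulVec he
  have h2 := (h.continuous_injection hμ (H i)).comp hω
  have h3 := ((h.continuous_coupling hμ hP).comp hθ).const_smul ν
  have h4 : Continuous fun q : ℝ × (Fin n → ℝ) × ((Fin n → ℝ) × (∀ i, Fin (p i) → ℝ)) ×
      (Fin N → Fin n → ℝ) => γ q.1 (q.2.1 + q.2.2.2 i) - γ q.1 q.2.1 :=
    (hγ.comp (f := fun q : ℝ × (Fin n → ℝ) × ((Fin n → ℝ) × (∀ i, Fin (p i) → ℝ)) ×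
      (Fin N → Fin n → ℝ) => (q.1, q.2.1 + q.2.2.2 i)) (by fun_prop)).sub
    (hγ.comp (f := fun q : ℝ × (Fin n → ℝ) × ((Fin n → ℝ) × (∀ i, Fin (p i) → ℝ)) ×
      (Fin N → Fin n → ℝ) => (q.1, q.2.1)) (by fun_prop))
  have h5 : Continuous fun q : ℝ × (Fin n → ℝ) × ((Fin n → ℝ) × (∀ i, Fin (p i) → ℝ)) ×
      (Fin N → Fin n → ℝ) => q.2.2.1.1 := by fun_prop
  convert (((h1.add h2).add h3).add h4).sub h5 using 2 with q
  simp only [errorField, Pi.add_apply, Pi.sub_apply, Pi.smul_apply, Function.comp_apply, smul_smul]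

end ErrorFieldContinuity

/-! ### Global existence from an a priori bound -/

section GlobalExistence

/-- The coordinatewise truncation of `e` to the box `‖e‖ ≤ R`. -/
noncomputable def boxTruncation {N n : ℕ} (R : ℝ) (e : Fin N → Fin n → ℝ) : Fin N → Fin n → ℝ :=
  fun i j => max (-R) (min R (e i j))

variable {N n : ℕ} {R : ℝ}

theorem continuous_boxTruncation : Continuous (boxTruncation R : (Fin N → Fin n → ℝ) → _) := by
  unfold boxTruncation
  fun_prop

theorem norm_boxTruncation_le (hR : 0 ≤ R) (e : Fin N → Fin n → ℝ) : ‖boxTruncation R e‖ ≤ R := by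
  refine (pi_norm_le_iff_of_nonneg hR).2 fun i => (pi_norm_le_iff_of_nonneg hR).2 fun j => ?_
  exact abs_le.2 ⟨le_max_left _ _, max_le (by linarith) (min_le_left _ _)⟩

theorem boxTruncation_eq_self {e : Fin N → Fin n → ℝ} (he : ‖e‖ ≤ R) : boxTruncation R e = e := by
  funext i j
  have h1 := abs_le.1 (((norm_le_pi_norm (e i) j).trans (norm_le_pi_norm e i)).trans he)
  rw [boxTruncation, min_eq_right h1.2, max_eq_right h1.1]

theorem IsSolutionOn.congr {E : Type*} [NormedAddCommGroup E] [NormedSpace ℝ E] {F F' : ℝ → E → E}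
    {S T : EReal} {e₀ : E} {e : ℝ → E} (h : IsSolutionOn F T e₀ e) (hST : S ≤ T)
    (heq : ∀ t ∈ timeInterval S, F t (e t) = F' t (e t)) : IsSolutionOn F' S e₀ e := by
  intro t ht
  obtain ⟨hint, hval⟩ := h t ⟨ht.1, ht.2.trans_le hST⟩
  have hcongr : ∀ s ∈ Set.uIcc 0 t, F s (e s) = F' s (e s) := fun s hs => by
    rw [Set.uIcc_of_le ht.1] at hs
    exact heq s (timeInterval_subset ht hs.1 hs.2)
  refine ⟨hint.congr fun s hs => hcongr s (Set.uIoc_subset_uIcc hs), ?_⟩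
  rw [hval, intervalIntegral.integral_congr hcongr]

/-- A field whose truncation is a Carathéodory field has a solution as soon as its solutions on
shorter intervals are bounded inside the region where the truncation does nothing: the solution of
the truncated equation never leaves that region. -/
theorem IsCaratheodoryField.exists_isSolutionOn_of_bound {E : Type*} [NormedAddCommGroup E]
    [NormedSpace ℝ E] [FiniteDimensional ℝ E] {F : ℝ → E → E} {T : EReal} {π : E → E} {M : ℝ}
    (hF : IsCaratheodoryField (fun t e => F t (π e)) T) (hπ : ∀ e, ‖e‖ ≤ R → π e = e)
    (hM : M < R) {e₀ : E} (he₀ : ‖e₀‖ < R)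
    (hbound : ∀ S ≤ T, ∀ e, IsSolutionOn F S e₀ e → ∀ t ∈ timeInterval S, ‖e t‖ ≤ M) :
    ∃ e, IsSolutionOn F T e₀ e := by
  obtain ⟨e, he⟩ := hF.exists_isSolutionOn e₀
  have hlt : ∀ t ∈ timeInterval T, ‖e t‖ < R := by
    by_contra! hcon
    obtain ⟨t₁, ht₁, hRt₁⟩ := hcon
    have hcont := he.continuousOn ht₁
    -- the first time at which the norm reaches `R`
    have hclosed : IsClosed (Set.Icc 0 t₁ ∩ (fun t => ‖e t‖) ⁻¹' Set.Ici R) :=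
      hcont.norm.preimage_isClosed_of_isClosed isClosed_Icc isClosed_Ici
    have hne : (Set.Icc 0 t₁ ∩ (fun t => ‖e t‖) ⁻¹' Set.Ici R).Nonempty :=
      ⟨t₁, ⟨ht₁.1, le_rfl⟩, hRt₁⟩
    have hbdd : BddBelow (Set.Icc 0 t₁ ∩ (fun t => ‖e t‖) ⁻¹' Set.Ici R) :=
      ⟨0, fun t ht => ht.1.1⟩
    have hmem := hclosed.csInf_mem hne hbdd
    set t₀ := sInf (Set.Icc 0 t₁ ∩ (fun t => ‖e t‖) ⁻¹' Set.Ici R) with ht₀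
    have hbefore : ∀ t, 0 ≤ t → t < t₀ → ‖e t‖ < R := fun t h0 ht => by
      by_contra! hR
      exact absurd (csInf_le hbdd ⟨⟨h0, ht.le.trans hmem.1.2⟩, hR⟩) (not_le.2 ht)
    have ht₀T : (t₀ : EReal) ≤ T := (EReal.coe_le_coe_iff.2 hmem.1.2).trans ht₁.2.le
    have hsol : IsSolutionOn F t₀ e₀ e := he.congr ht₀T fun t ht => by
      rw [hπ _ (hbefore t ht.1 (EReal.coe_lt_coe_iff.1 ht.2)).le]
    have hpos : 0 < t₀ := by
      refine lt_of_le_of_ne hmem.1.1 fun h0 => ?_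
      have h1 : R ≤ ‖e t₀‖ := hmem.2
      rw [← h0, he.apply_zero (timeInterval_subset ht₁ le_rfl ht₁.1)] at h1
      exact absurd h1 (not_le.2 he₀)
    have hclos : t₀ ∈ closure (Set.Ico 0 t₀) := by
      rw [closure_Ico hpos.ne]
      exact ⟨hpos.le, le_rfl⟩
    have hcw : ContinuousWithinAt (fun t => ‖e t‖) (Set.Ico 0 t₀) t₀ :=
      (hcont.norm t₀ hmem.1).mono fun t ht => ⟨ht.1, ht.2.le.trans hmem.1.2⟩
    have hle : ‖e t₀‖ ≤ M := hcw.closure_le hclos continuousWithinAt_const fun t ht =>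
      hbound t₀ ht₀T e hsol t ⟨ht.1, EReal.coe_lt_coe_iff.2 ht.2⟩
    have h1 : R ≤ ‖e t₀‖ := hmem.2
    linarith
  exact ⟨e, he.congr le_rfl fun t ht => by rw [hπ _ (hlt t ht).le]⟩

/-- A continuous function of time, of a continuous curve, of an essentially bounded disturbance and
of the truncated state is a Carathéodory field. -/
theorem isCaratheodoryField_boxTruncation {X Q : Type*} [NormedAddCommGroup X] [ProperSpace X]
    [NormedAddCommGroup Q] [ProperSpace Q]
    {Φ : ℝ × X × Q × (Fin N → Fin n → ℝ) → Fin N → Fin n → ℝ} (hΦ : Continuous Φ) {T : EReal}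
    {x : ℝ → X} (hx : ∀ t ∈ timeInterval T, ContinuousOn x (Set.Icc 0 t)) {q : ℝ → Q}
    (hq : MemLp q ∞ (volume.restrict (Set.Ici 0))) (hR : 0 ≤ R) :
    IsCaratheodoryField (fun t e => Φ (t, x t, q t, boxTruncation R e)) T where
  meas t ht Y hY := by
    have h1 : AEStronglyMeasurable x (volume.restrict (Set.Ioc 0 t)) :=
      ((hx t ht).mono Set.Ioc_subset_Icc_self).aestronglyMeasurable measurableSet_Ioc
    have h2 : AEStronglyMeasurable q (volume.restrict (Set.Ioc 0 t)) :=
      hq.1.mono_measure (Measure.restrict_mono (fun s hs => hs.1.le) le_rfl)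
    exact hΦ.comp_aestronglyMeasurable (aestronglyMeasurable_id.prodMk (h1.prodMk (h2.prodMk
      (continuous_boxTruncation.comp_stronglyMeasurable hY).aestronglyMeasurable)))
  cont s := hΦ.comp (continuous_const.prodMk (continuous_const.prodMk (continuous_const.prodMk
    continuous_boxTruncation)))
  bdd t ht := by
    obtain ⟨Rx, hRx⟩ := isCompact_Icc.exists_bound_of_continuousOn (hx t ht)
    obtain ⟨M, hM⟩ := (isCompact_Icc.prod ((isCompact_closedBall (0 : X) Rx).prod
      ((isCompact_closedBall (0 : Q) (supNormUpTo q t)).prod (isCompact_closedBall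
        (0 : Fin N → Fin n → ℝ) R)))).exists_bound_of_continuousOn (f := Φ)
        (s := Set.Icc 0 t ×ˢ _) hΦ.continuousOn
    refine ⟨max M 0, le_max_right _ _, ?_⟩
    rw [ae_restrict_iff' measurableSet_Ioc]
    filter_upwards [ae_norm_le_supNormUpTo hq t] with s hs hst e
    refine (hM _ ⟨⟨hst.1.le, hst.2⟩, ?_, ?_, ?_⟩).trans (le_max_left _ _)
    · exact mem_closedBall_zero_iff.2 (hRx s ⟨hst.1.le, hst.2⟩)
    · exact mem_closedBall_zero_iff.2 (hs ⟨hst.1.le, hst.2⟩)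
    · exact mem_closedBall_zero_iff.2 (norm_boxTruncation_le hR e)

theorem supNormUpTo_le {Q : Type*} [NormedAddCommGroup Q] {q : ℝ → Q}
    (hq : MemLp q ∞ (volume.restrict (Set.Ici 0))) (t : ℝ) :
    supNormUpTo q t ≤ (eLpNorm q ∞ (volume.restrict (Set.Ici 0))).toReal :=
  ENNReal.toReal_mono hq.2.ne
    (eLpNorm_mono_measure q (Measure.restrict_mono Set.Ico_subset_Ici_self le_rfl))

theorem ClassKL.le_zero_right {β : ℝ → ℝ → ℝ} (h : ClassKL β) {r t : ℝ} (hr : 0 ≤ r) (ht : 0 ≤ t) :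
    β r t ≤ β r 0 := by
  rcases hr.eq_or_lt with rfl | hr
  -- `β(0, ·)` vanishes identically and is not covered by strict monotonicity
  · exact ((h.2.1 t ht).2.2.trans (h.2.1 0 le_rfl).2.2.symm).le
  · exact (h.2.2.1 r hr).antitoneOn Set.self_mem_Ici ht ht

end GlobalExistence

/-! ### Input-to-state stability of the error equation -/

theorem mainTheorem3 {N n m : ℕ} (hN : 0 < N) (hn : 0 < n) {p : Fin N → ℕ}
    (A : Matrix (Fin n) (Fin n) ℝ) (B : Matrix (Fin n) (Fin m) ℝ)
    (C : ∀ i, Matrix (Fin (p i)) (Fin n) ℝ)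
    (hobs : IsObservablePair A (stackedOutput C))
    (Y₀ : Matrix (Fin n) (Σ i, Fin (p i)) ℝ) (G₀ : Matrix (Fin n) (Fin n) ℝ)
    (hG₀ : IsHomogenizingPair A (stackedOutput C) Y₀ G₀)
    (hL₀ : injectionGain G₀ Y₀ = 0)
    (𝒢 : Digraph (Fin N)) (hloop : ∀ i, ¬ 𝒢.Adj i i) (hconn : IsStronglyConnectedDigraph 𝒢)
    (ζ : Fin N → ℝ) (hζ : ζ ᵥ* laplacianMatrix 𝒢 = 0) (hζ_sum : ∑ i, ζ i = 1)
    (Δ : Matrix (Fin (N - 1)) (Fin (N - 1)) ℝ)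
    (hΔ : IsLaplacianReduction (laplacianMatrix 𝒢) ζ Δ)
    (Pa : Matrix (Fin n) (Fin n) ℝ) (Y : Matrix (Fin n) (Σ i, Fin (p i)) ℝ) (ρ : ℝ)
    (hρ : 0 < ρ) (hPa : Pa.PosDef) (hΔP : ((Δᵀ + Δ) ⊗ₖ Pa).PosDef) :
    ∃ ν₀ : ℝ, 0 < ν₀ ∧ ∀ ν ≥ ν₀, ∃ ε : ℝ, 0 < ε ∧
      ∀ μ : ℝ, |μ| < ε → -1 / (observabilityIndex A (stackedOutput C) : ℝ) < μ →
        SatisfiesLMI A (stackedOutput C) (dilationGenerator G₀ μ) Pa Y ρ →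
        ∀ τ : ℝ, 0 < τ → τ < ρ / 3 →
          ∀ γ : ℝ → (Fin n → ℝ) → Fin n → ℝ, Continuous (Function.uncurry γ) →
            SatisfiesGrowth N (dilationGenerator G₀ μ) Pa μ τ γ →
            ErrorEquationISS A B C G₀ Pa (observerGain Pa Y ζ) (laplacianMatrix 𝒢) ν μ γ := by
  have hA := hG₀.commutator_eq hL₀
  have hC := fun i => mul_eq_zero_of_stackedOutput_mul_eq_zero hG₀.eq_C i
  obtain ⟨Y₁, Y₂, hred⟩ := hΔ.exists_isReductionPair
  have hζpos := pos_of_vecMul_laplacianMatrix_eq_zero hloop hconn hζ hζ_sum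
  obtain ⟨k, hk⟩ := exists_isExpBound G₀
  obtain ⟨ν₀, hν₀, hmain⟩ := hred.exists_dissipation (Y := Y) hN hζpos hζ_sum hPa hΔP hρ hk hA hC
  refine ⟨ν₀, hν₀, fun ν hν => ?_⟩
  obtain ⟨ε, hε, δ, hδ, hmain⟩ := hmain ν hν
  refine ⟨ε, hε, fun μ hμ _ hLMI τ hτ hτρ γ hγ hgrowth => ?_⟩
  obtain ⟨hμk, hdil, hmain⟩ := hmain μ hμ hLMI
  obtain ⟨β, α, hβ, hα, hest⟩ := hk.exists_iss_estimate hμk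
    (Q := lyapunovForm Pa ζ Y₂) (lyapunovForm_comm hPa ζ Y₂)
    (fun z hz => hred.lyapunovForm_self_pos hPa hz)
    (show 0 < ρ / 8 by positivity) hδ (hmain τ hτ hτρ γ hgrowth)
  refine ⟨β, α, hβ, hα, fun T u qx qy x₀ x hq hx e₀ => ⟨?_, fun S _ e he t ht =>
    hest x qx qy hq S e₀ e he t ht⟩⟩
  set q : ℝ → (Fin n → ℝ) × (∀ i, Fin (p i) → ℝ) := fun t => (qx t, qy t) with hqdef
  set K : ℝ := (eLpNorm q ∞ (volume.restrict (Set.Ici 0))).toReal with hK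
  set M : ℝ := β ‖e₀‖ 0 + α K with hM
  have hM0 : 0 ≤ M := add_nonneg ((hβ.2.1 0 le_rfl).nonneg (norm_nonneg _))
    (hα.nonneg ENNReal.toReal_nonneg)
  -- truncation outside the ball that contains `e₀` and all values allowed by the estimate
  have hcar := isCaratheodoryField_boxTruncation (R := ‖e₀‖ + M + 1)
    (hk.continuous_errorField hμk hdil A C (observerGain Pa Y ζ) (laplacianMatrix 𝒢) ν hγ)
    (fun t ht => hx.continuousOn ht) hq (by positivity)
  refine IsCaratheodoryField.exists_isSolutionOn_of_bound (R := ‖e₀‖ + M + 1) (M := M)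
    (π := boxTruncation (‖e₀‖ + M + 1)) hcar (fun e he => boxTruncation_eq_self he)
    (by linarith [norm_nonneg e₀]) (by linarith) fun S _ e he t ht => ?_
  exact (hest x qx qy hq S e₀ e he t ht).trans (add_le_add
    (hβ.le_zero_right (norm_nonneg _) ht.1)
    (hα.mono ENNReal.toReal_nonneg (supNormUpTo_le hq t)))
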